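/- **Proposition 2.1.** Let $M=\mathbb{CP}^2\#\overline{\mathbb{CP}^2}$ be the blow-up of $\mathbb{CP}^2=\mathbb P(\mathbb C\oplus\mathbb C^2)$ at the point $[1:0]$, with its complex structure and the action of $U(2)$ induced by the linear action on $\mathbb C^2$. Let $X,Y,Z$ be the $SU(2)$-invariant vector fields on $S^3\subset\mathbb C^2$, orthonormal for the round metric, $$X=(-iv,-iw),\qquad Y=(\bar w,-\bar v),\qquad Z=(i\bar w,-i\bar v)\qquad\text{at }(v,w)\in S^3,$$ which satisfy $[X,Y]=2Z$, $[Y,Z]=2X$, $[Z,X]=2Y$, and put $H=\partial/\partial t$. Let $\alpha<\beta$ and $c\in\mathbb R$, let $h:[\alpha,\beta]\to(0,\infty)$ be smooth, put $f=-hh'$, and suppose that $f>0$ on $(\alpha,\beta)$. Let $g=dt^2+g_t$ be the $U(2)$-invariant metric on $S^3\times(\alpha,\beta)$ for which $H,\ X/f,\ Y/h,\ Z/h$ are orthonormal, and let $J$ be the almost complex structure with $JH=X/f$, $J(X/f)=-H$, $JY=Z$, $JZ=-Y$. Suppose that on $[\alpha,\beta]$ $$2hh''+4h'^2-4+h^2(1+ch'^2)=0,$$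 and that $h'(\alpha)=h'(\beta)=0$ and $h(\alpha)h''(\alpha)=-h(\beta)h''(\beta)=-1$. Then $h(\alpha)=\sqrt6$ and $h(\beta)=\sqrt2$, and $(g,J)$ extends to a $U(2)$-invariant gradient shrinking Kähler–Ricci soliton on $M$. That is, there is a smooth Riemannian metric $\mathbf g$ on $M$ such that: 1. there is a $U(2)$-equivariant diffeomorphism $\Phi$ of $S^3\times(\alpha,\beta)$ onto the complement in $M$ of the exceptional curve and the line at infinity (the two singular orbits), with $\Phi^*\mathbf g=g$ and with $\Phi$ carrying $J$ to the complex structure of $M$; 2. $\mathbf g$ is $U(2)$-invariant and is Kähler with respect to the complex structure of $M$; 3. there is a smooth $U(2)$-invariant function $u:M\to\mathbb R$ with $\mathrm{Ric}(\mathbf g)+\nabla\nabla u-\mathbf g=0$. -/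

import Mathlib

set_option maxSynthPendingDepth 3

open Set
open scoped ContDiff Manifold Matrix LinearAlgebra.Projectivization

/-! ## Riemannian geometry in coordinates -/

namespace RiemCoord

noncomputable section

/-- The Koszul expression of the first kind of a field of bilinear forms `G` on a vector space `E`,
`(v, w, z) ↦ (∂_v G(w, z) + ∂_w G(v, z) - ∂_z G(v, w)) / 2` at the point `x`. -/
def koszul {E : Type*} [NormedAddCommGroup E] [NormedSpace ℝ E]
    (G : E → E →L[ℝ] E →L[ℝ] ℝ) (x : E) : E →L[ℝ] E →L[ℝ] E →L[ℝ] ℝ :=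
  let D : E →L[ℝ] E →L[ℝ] E →L[ℝ] ℝ := fderiv ℝ G x
  let D' : E →L[ℝ] E →L[ℝ] E →L[ℝ] ℝ :=
    (ContinuousLinearMap.flipₗᵢ ℝ E E ℝ).toContinuousLinearEquiv.toContinuousLinearMap.comp D.flip
  (1 / 2 : ℝ) • (D + D.flip - D')

theorem koszul_apply {E : Type*} [NormedAddCommGroup E] [NormedSpace ℝ E]
    (G : E → E →L[ℝ] E →L[ℝ] ℝ) (x v w z : E) :
    koszul G x v w z =
      (fderiv ℝ G x v w z + fderiv ℝ G x w v z - fderiv ℝ G x z v w) / 2 := by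
  simp [koszul]
  ring

/-- The Christoffel symbols of the metric `G` at `x`: the bilinear map `Γ` with
`G(Γ(v, w), z) = (∂_v G(w, z) + ∂_w G(v, z) - ∂_z G(v, w)) / 2`. -/
def christoffel {E : Type*} [NormedAddCommGroup E] [NormedSpace ℝ E]
    (G : E → E →L[ℝ] E →L[ℝ] ℝ) (x : E) : E →L[ℝ] E →L[ℝ] E :=
  (ContinuousLinearMap.compL ℝ E (E →L[ℝ] ℝ) E (G x).inverse).comp (koszul G x)

theorem christoffel_apply {E : Type*} [NormedAddCommGroup E] [NormedSpace ℝ E]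
    (G : E → E →L[ℝ] E →L[ℝ] ℝ) (x v w : E) :
    christoffel G x v w = (G x).inverse (koszul G x v w) := rfl

/-- The endomorphism `u ↦ R(u, v) w = ∇_u ∇_v w - ∇_v ∇_u w - ∇_[u, v] w`, where `∇` is the
Levi-Civita connection of `G`. -/
def curvature {E : Type*} [NormedAddCommGroup E] [NormedSpace ℝ E]
    (G : E → E →L[ℝ] E →L[ℝ] ℝ) (x v w : E) : E →L[ℝ] E :=
  ((fderiv ℝ (christoffel G) x).flip v).flip w - (fderiv ℝ (christoffel G) x v).flip w
    + (christoffel G x).flip (christoffel G x v w)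
    - (christoffel G x v).comp ((christoffel G x).flip w)

theorem curvature_apply {E : Type*} [NormedAddCommGroup E] [NormedSpace ℝ E]
    (G : E → E →L[ℝ] E →L[ℝ] ℝ) (x u v w : E) :
    curvature G x v w u =
      fderiv ℝ (christoffel G) x u v w - fderiv ℝ (christoffel G) x v u w
        + christoffel G x u (christoffel G x v w) - christoffel G x v (christoffel G x u w) := by
  simp [curvature]

/-- The Ricci tensor `Ric(v, w) = tr (u ↦ R(u, v) w)` of `G` at `x`. -/
def ricci {E : Type*} [NormedAddCommGroup E] [NormedSpace ℝ E]
    (G : E → E →L[ℝ] E →L[ℝ] ℝ) (x v w : E) : ℝ :=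
  LinearMap.trace ℝ E (curvature G x v w : E →ₗ[ℝ] E)

/-- The Hessian `∇∇φ(v, w) = D²φ(v, w) - dφ(Γ(v, w))` of a function `φ` at `x`. -/
def hessian {E : Type*} [NormedAddCommGroup E] [NormedSpace ℝ E]
    (G : E → E →L[ℝ] E →L[ℝ] ℝ) (φ : E → ℝ) (x v w : E) : ℝ :=
  fderiv ℝ (fderiv ℝ φ) x v w - fderiv ℝ φ x (christoffel G x v w)

/-- Smooth Riemannian metrics on a manifold `M` modelled on the vector space `E`. -/
abbrev Metric (E : Type*) [NormedAddCommGroup E] [NormedSpace ℝ E]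
    (M : Type*) [TopologicalSpace M] [ChartedSpace E M] [IsManifold 𝓘(ℝ, E) ∞ M] :=
  Bundle.ContMDiffRiemannianMetric 𝓘(ℝ, E) ∞ E (fun x : M ↦ TangentSpace 𝓘(ℝ, E) x)

/-- The coordinate expression of the metric `g` in the chart `chartAt E p`, that is, the pullback
of `g` by the inverse of that chart. -/
def chartMetric {E : Type*} [NormedAddCommGroup E] [NormedSpace ℝ E]
    {M : Type*} [TopologicalSpace M] [ChartedSpace E M] [IsManifold 𝓘(ℝ, E) ∞ M]
    (g : Metric E M) (p : M) (y : E) : E →L[ℝ] E →L[ℝ] ℝ :=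
  let G : E →L[ℝ] E →L[ℝ] ℝ := g.inner ((chartAt E p).symm y)
  let D : E →L[ℝ] E := mfderiv 𝓘(ℝ, E) 𝓘(ℝ, E) (chartAt E p).symm y
  G.bilinearComp D D

/-- The Ricci tensor of `g` at `p`, computed in the chart `chartAt E p`. (In Mathlib the tangent
space at `p` is identified with `E` by means of this very chart.) -/
def ric {E : Type*} [NormedAddCommGroup E] [NormedSpace ℝ E]
    {M : Type*} [TopologicalSpace M] [ChartedSpace E M] [IsManifold 𝓘(ℝ, E) ∞ M]
    (g : Metric E M) (p : M) (v w : TangentSpace 𝓘(ℝ, E) p) : ℝ :=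
  ricci (chartMetric g p) (chartAt E p p) v w

/-- The Hessian of `u : M → ℝ` with respect to `g` at `p`, computed in the chart `chartAt E p`. -/
def hess {E : Type*} [NormedAddCommGroup E] [NormedSpace ℝ E]
    {M : Type*} [TopologicalSpace M] [ChartedSpace E M] [IsManifold 𝓘(ℝ, E) ∞ M]
    (g : Metric E M) (u : M → ℝ) (p : M) (v w : TangentSpace 𝓘(ℝ, E) p) : ℝ :=
  hessian (chartMetric g p) (u ∘ (chartAt E p).symm) (chartAt E p p) v w

/-- The complex structure of a complex surface on its tangent spaces: multiplication by `i` in the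
chart that identifies the tangent space at `p` with `ℂ × ℂ`. Since changes of charts are
holomorphic, it does not depend on the chart. -/
def J {M : Type*} [TopologicalSpace M] [ChartedSpace (ℂ × ℂ) M] [IsManifold 𝓘(ℂ, ℂ × ℂ) ω M]
    (p : M) (v : TangentSpace 𝓘(ℝ, ℂ × ℂ) p) : TangentSpace 𝓘(ℝ, ℂ × ℂ) p :=
  let v' : ℂ × ℂ := v
  Complex.I • v'

/-- A Riemannian metric on a complex surface is Kähler if it is Hermitian, `g(Jv, Jw) = g(v, w)`,
and `∇J = 0`. As `J` is constant in a holomorphic chart, the latter says that the Christoffel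
symbols satisfy `Γ(v, Jw) = J Γ(v, w)`. -/
def IsKahler {M : Type*} [TopologicalSpace M] [ChartedSpace (ℂ × ℂ) M]
    [IsManifold 𝓘(ℂ, ℂ × ℂ) ω M] [IsManifold 𝓘(ℝ, ℂ × ℂ) ∞ M] (g : Metric (ℂ × ℂ) M) : Prop :=
  (∀ (p : M) (v w : TangentSpace 𝓘(ℝ, ℂ × ℂ) p), g.inner p (J p v) (J p w) = g.inner p v w) ∧
  ∀ (p : M) (v w : ℂ × ℂ),
    christoffel (chartMetric g p) (chartAt (ℂ × ℂ) p p) v (Complex.I • w) =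
      Complex.I • christoffel (chartMetric g p) (chartAt (ℂ × ℂ) p p) v w

end

end RiemCoord

/-! ## The complex surface `ℂP² # -ℂP²` -/

/-- `ℂP² # -ℂP²` as a complex surface: the blow-up of `ℂP² = ℙ(ℂ ⊕ ℂ²)` at the point `[1 : 0]`,
that is, the set of pairs of a line `ℓ ⊆ ℂ ⊕ ℂ²` and a line `m ⊆ ℂ²` with `ℓ ⊆ ℂ ⊕ m`. -/
def CP2Sharp : Type :=
  {p : ℙ ℂ (ℂ × (Fin 2 → ℂ)) × ℙ ℂ (Fin 2 → ℂ) // p.1.rep.2 ∈ p.2.submodule}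

namespace CP2Sharp

noncomputable section

/-- The line `ℓ ⊆ ℂ ⊕ ℂ²`, i.e. the point of `ℂP²` below the given point of the blow-up. -/
def line (p : CP2Sharp) : ℙ ℂ (ℂ × (Fin 2 → ℂ)) := p.1.1

/-- The line `m ⊆ ℂ²`, i.e. the image under the projection to `ℂP¹`. -/
def dir (p : CP2Sharp) : ℙ ℂ (Fin 2 → ℂ) := p.1.2

theorem exists_rep (p : CP2Sharp) : ∃ b : ℂ, p.line.rep.2 = b • p.dir.rep := by
  have h := p.2
  rw [Projectivization.submodule_eq, Submodule.mem_span_singleton] at h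
  obtain ⟨b, hb⟩ := h
  exact ⟨b, hb.symm⟩

/-- The point `([a : b v], [v])`. -/
def mk (a b : ℂ) (v : Fin 2 → ℂ) (hab : (a, b) ≠ (0 : ℂ × ℂ)) (hv : v ≠ 0) : CP2Sharp :=
  ⟨(Projectivization.mk ℂ (a, b • v) (by
      intro h
      rw [Prod.mk_eq_zero, smul_eq_zero] at h
      exact hab (Prod.mk_eq_zero.2 ⟨h.1, h.2.resolve_right hv⟩)), Projectivization.mk ℂ v hv), by
    obtain ⟨c, hc⟩ := Projectivization.exists_smul_eq_mk_rep ℂ ((a, b • v) : ℂ × (Fin 2 → ℂ)) (by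
      intro h
      rw [Prod.mk_eq_zero, smul_eq_zero] at h
      exact hab (Prod.mk_eq_zero.2 ⟨h.1, h.2.resolve_right hv⟩))
    simp only [← hc, Projectivization.submodule_mk, Submodule.mem_span_singleton]
    exact ⟨c * b, by simp [Units.smul_def, mul_smul]⟩⟩

theorem mk_line_rep {a b : ℂ} {v : Fin 2 → ℂ} (hab : (a, b) ≠ (0 : ℂ × ℂ)) (hv : v ≠ 0) :
    ∃ c : ℂ, c ≠ 0 ∧ (mk a b v hab hv).line.rep = (c * a, (c * b) • v) := by
  obtain ⟨c, hc⟩ := Projectivization.exists_smul_eq_mk_rep ℂ ((a, b • v) : ℂ × (Fin 2 → ℂ)) (by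
      intro h
      rw [Prod.mk_eq_zero, smul_eq_zero] at h
      exact hab (Prod.mk_eq_zero.2 ⟨h.1, h.2.resolve_right hv⟩))
  refine ⟨c, c.ne_zero, hc.symm.trans ?_⟩
  simp [Units.smul_def, mul_smul]

theorem mk_dir_rep {a b : ℂ} {v : Fin 2 → ℂ} (hab : (a, b) ≠ (0 : ℂ × ℂ)) (hv : v ≠ 0) :
    ∃ d : ℂ, d ≠ 0 ∧ (mk a b v hab hv).dir.rep = d • v := by
  obtain ⟨c, hc⟩ := Projectivization.exists_smul_eq_mk_rep ℂ v hv
  exact ⟨c, c.ne_zero, hc.symm⟩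

theorem eq_mk (p : CP2Sharp) {a b : ℂ} {v : Fin 2 → ℂ} (hab : (a, b) ≠ (0 : ℂ × ℂ)) (hv : v ≠ 0)
    {c d : ℂ} (h1 : p.line.rep = c • (a, b • v)) (h2 : p.dir.rep = d • v) :
    p = mk a b v hab hv := by
  apply Subtype.ext
  apply Prod.ext
  · change p.line = _
    rw [← p.line.mk_rep]
    exact (Projectivization.mk_eq_mk_iff' ℂ _ _ _ _).2 ⟨c, h1.symm⟩
  · change p.dir = _
    rw [← p.dir.mk_rep]
    exact (Projectivization.mk_eq_mk_iff' ℂ _ _ _ _).2 ⟨d, h2.symm⟩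

/-! ### Charts

There are four charts. The index `k : Fin 2` says which coordinate of `m = [w₀ : w₁]` is normalized
to `1`; the Boolean says whether the chart is around the exceptional curve (`true`) or around the
line at infinity (`false`). -/

/-- The vector of `ℂ²` with `k`-th coordinate `1` and other coordinate `m`. -/
def vec (k : Fin 2) (m : ℂ) : Fin 2 → ℂ := fun j ↦ if j = k then 1 else m

/-- The homogeneous coordinates `(1, x)` or `(x, 1)`. -/
def hom (ε : Bool) (x : ℂ) : ℂ × ℂ := if ε then (1, x) else (x, 1)

theorem vec_ne_zero (k : Fin 2) (m : ℂ) : vec k m ≠ 0 := fun h ↦ by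
  simpa [vec] using congrFun h k

theorem hom_ne_zero (ε : Bool) (x : ℂ) : ((hom ε x).1, (hom ε x).2) ≠ (0 : ℂ × ℂ) := by
  cases ε <;> simp [hom]

/-- The inverses of the charts: `(x, m) ↦ ([1 : x v], [v])` around the exceptional curve and
`(x, m) ↦ ([x : v], [v])` around the line at infinity, where `v = (1, m)` or `v = (m, 1)`. -/
def param (k : Fin 2) (ε : Bool) (y : ℂ × ℂ) : CP2Sharp :=
  mk (hom ε y.1).1 (hom ε y.1).2 (vec k y.2) (hom_ne_zero ε y.1) (vec_ne_zero k y.2)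

/-- The domain of the chart `(k, ε)`. -/
def dom (k : Fin 2) (ε : Bool) : Set CP2Sharp :=
  {p | p.dir.rep k ≠ 0 ∧ if ε then p.line.rep.1 ≠ 0 else p.line.rep.2 k ≠ 0}

/-- The coordinates of the chart `(k, ε)`. -/
def coord (k : Fin 2) (ε : Bool) (p : CP2Sharp) : ℂ × ℂ :=
  (if ε then p.line.rep.2 k / p.line.rep.1 else p.line.rep.1 / p.line.rep.2 k,
    p.dir.rep (k + 1) / p.dir.rep k)

theorem vec_self (k : Fin 2) (m : ℂ) : vec k m k = 1 := by simp [vec]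

theorem vec_other (k : Fin 2) (m : ℂ) : vec k m (k + 1) = m := by
  fin_cases k <;> simp [vec]

theorem param_mem_dom (k k' : Fin 2) (ε ε' : Bool) (y : ℂ × ℂ) :
    param k ε y ∈ dom k' ε' ↔ vec k y.2 k' ≠ 0 ∧
      if ε' then (hom ε y.1).1 ≠ 0 else (hom ε y.1).2 * vec k y.2 k' ≠ 0 := by
  obtain ⟨c, hc, h1⟩ := mk_line_rep (hom_ne_zero ε y.1) (vec_ne_zero k y.2)
  obtain ⟨d, hd, h2⟩ := mk_dir_rep (hom_ne_zero ε y.1) (vec_ne_zero k y.2)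
  cases ε' <;> simp [dom, param, h1, h2, hc, hd]

/-- The changes of coordinates. -/
theorem coord_param (k k' : Fin 2) (ε ε' : Bool) (y : ℂ × ℂ) :
    coord k' ε' (param k ε y) =
      (if ε' then (hom ε y.1).2 * vec k y.2 k' / (hom ε y.1).1
        else (hom ε y.1).1 / ((hom ε y.1).2 * vec k y.2 k'),
        vec k y.2 (k' + 1) / vec k y.2 k') := by
  obtain ⟨c, hc, h1⟩ := mk_line_rep (hom_ne_zero ε y.1) (vec_ne_zero k y.2)
  obtain ⟨d, hd, h2⟩ := mk_dir_rep (hom_ne_zero ε y.1) (vec_ne_zero k y.2)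
  cases ε' <;>
    simp [coord, param, h1, h2, mul_assoc, mul_div_mul_left _ _ hc, mul_div_mul_left _ _ hd]

theorem param_coord (k : Fin 2) (ε : Bool) (p : CP2Sharp) (hp : p ∈ dom k ε) :
    param k ε (coord k ε p) = p := by
  obtain ⟨hk, hε⟩ := hp
  obtain ⟨b, hb⟩ := p.exists_rep
  have hv : p.dir.rep = p.dir.rep k • vec k (p.dir.rep (k + 1) / p.dir.rep k) := by
    ext j
    by_cases hj : j = k
    · subst hj
      simp [vec_self]
    · have : j = k + 1 := by
        fin_cases j <;> fin_cases k <;> simp_all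
      subst this
      simp only [Pi.smul_apply, vec_other, smul_eq_mul]
      field_simp
  have hbk : p.line.rep.2 k = b * p.dir.rep k := by rw [hb]; simp
  cases ε with
  | true =>
    simp only [if_true] at hε
    refine (eq_mk p (c := p.line.rep.1) _ _ ?_ hv).symm
    refine Prod.ext (by simp [hom, coord]) ?_
    rw [hb]
    conv_lhs => rw [hv]
    simp only [hom, coord, if_true, Prod.smul_snd, smul_smul, hbk]
    congr 1
    field_simp
  | false =>
    simp only [Bool.false_eq_true, if_false] at hε
    refine (eq_mk p (c := p.line.rep.2 k) _ _ ?_ hv).symm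
    refine Prod.ext ?_ ?_
    · simp only [hom, coord, Bool.false_eq_true, if_false, Prod.smul_fst, smul_eq_mul]
      field_simp
    · rw [hb]
      conv_lhs => rw [hv]
      simp only [hom, coord, Bool.false_eq_true, if_false, Prod.smul_snd, smul_smul, hbk, mul_one,
        Pi.smul_apply, smul_eq_mul]

/-- The chart `(k, ε)`. -/
def chart (k : Fin 2) (ε : Bool) : PartialEquiv CP2Sharp (ℂ × ℂ) where
  toFun := coord k ε
  invFun := param k ε
  source := dom k ε
  target := univ
  map_source' _ _ := mem_univ _
  map_target' y _ := by
    rw [param_mem_dom]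
    cases ε <;> simp [hom, vec_self]
  left_inv' p hp := param_coord k ε p hp
  right_inv' y _ := by
    rw [coord_param]
    cases ε <;> simp [hom, vec_self, vec_other]

theorem contDiff_vec (k j : Fin 2) : ContDiff ℂ ω (fun y : ℂ × ℂ ↦ vec k y.2 j) := by
  by_cases h : j = k
  · simpa [vec, h] using contDiff_const
  · simpa [vec, h] using contDiff_snd

theorem contDiff_hom (ε : Bool) : ContDiff ℂ ω (fun y : ℂ × ℂ ↦ hom ε y.1) := by
  cases ε
  · simpa [hom] using contDiff_fst.prodMk contDiff_const
  · simpa [hom] using contDiff_const.prodMk contDiff_fst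

theorem trans_source (k k' : Fin 2) (ε ε' : Bool) :
    ((chart k ε).symm.trans (chart k' ε')).source = {y | param k ε y ∈ dom k' ε'} := by
  rw [PartialEquiv.trans_source]
  exact univ_inter _

theorem isOpen_trans_source (k k' : Fin 2) (ε ε' : Bool) :
    IsOpen ((chart k ε).symm.trans (chart k' ε')).source := by
  rw [trans_source]
  simp only [param_mem_dom]
  have h1 := (contDiff_vec k k').continuous
  have h2 := (contDiff_hom ε).continuous
  cases ε'
  · simp only [Bool.false_eq_true, if_false]
    exact (isOpen_ne_fun h1 continuous_const).inter
      (isOpen_ne_fun (h2.snd.mul h1) continuous_const)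
  · simp only [if_true]
    exact (isOpen_ne_fun h1 continuous_const).inter (isOpen_ne_fun h2.fst continuous_const)

/-- The changes of coordinates are holomorphic. -/
theorem contDiffOn_trans (k k' : Fin 2) (ε ε' : Bool) :
    ContDiffOn ℂ ω ((chart k ε).symm.trans (chart k' ε'))
      ((chart k ε).symm.trans (chart k' ε')).source := by
  have h : ∀ y, ((chart k ε).symm.trans (chart k' ε')) y = coord k' ε' (param k ε y) :=
    fun _ ↦ rfl
  refine ContDiffOn.congr ?_ (fun y _ ↦ (h y).trans (coord_param k k' ε ε' y))
  rw [trans_source]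
  have h1 := fun j ↦ (contDiff_vec k j).contDiffOn (s := {y | param k ε y ∈ dom k' ε'})
  have h2 := (contDiff_hom ε).fst.contDiffOn (s := {y | param k ε y ∈ dom k' ε'})
  have h3 := (contDiff_hom ε).snd.contDiffOn (s := {y | param k ε y ∈ dom k' ε'})
  refine ContDiffOn.prodMk ?_ ((h1 _).div (h1 _) fun y hy ↦ ((param_mem_dom ..).1 hy).1)
  cases ε'
  · simp only [Bool.false_eq_true, if_false]
    exact h2.div (h3.mul (h1 _)) fun y hy ↦ by simpa using ((param_mem_dom ..).1 hy).2
  · simp only [if_true]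
    exact (h3.mul (h1 _)).div h2 fun y hy ↦ by simpa using ((param_mem_dom ..).1 hy).2

open Classical in
/-- The index `k` of the preferred chart at `p`. -/
def idx (p : CP2Sharp) : Fin 2 := if p.dir.rep 0 ≠ 0 then 0 else 1

open Classical in
/-- The index `ε` of the preferred chart at `p`. -/
def side (p : CP2Sharp) : Bool := if p.line.rep.1 ≠ 0 then true else false

theorem mem_dom (p : CP2Sharp) : p ∈ dom p.idx p.side := by
  have hk : p.dir.rep p.idx ≠ 0 := by
    by_cases h : p.dir.rep 0 = 0
    · have h1 : p.idx = 1 := by simp [idx, h]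
      rw [h1]
      intro h'
      apply p.dir.rep_nonzero
      ext j
      fin_cases j
      · exact h
      · exact h'
    · have h1 : p.idx = 0 := by simp [idx, h]
      rw [h1]
      exact h
  refine ⟨hk, ?_⟩
  by_cases h : p.line.rep.1 = 0
  · have hs : p.side = false := by simp [side, h]
    rw [hs]
    obtain ⟨b, hb⟩ := p.exists_rep
    simp only [Bool.false_eq_true, if_false, hb, Pi.smul_apply, smul_eq_mul]
    refine mul_ne_zero ?_ hk
    rintro rfl
    exact p.line.rep_nonzero (Prod.ext h (by simpa using hb))
  · have hs : p.side = true := by simp [side, h]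
    rw [hs]
    simpa using h

/-- The atlas consisting of the four charts. -/
def core : ChartedSpaceCore (ℂ × ℂ) CP2Sharp where
  atlas := range fun i : Fin 2 × Bool ↦ chart i.1 i.2
  chartAt p := chart p.idx p.side
  mem_chart_source p := p.mem_dom
  chart_mem_atlas p := ⟨(p.idx, p.side), rfl⟩
  open_source := by
    rintro _ _ ⟨i, rfl⟩ ⟨j, rfl⟩
    exact isOpen_trans_source ..
  continuousOn_toFun := by
    rintro _ _ ⟨i, rfl⟩ ⟨j, rfl⟩
    exact ContDiffOn.continuousOn (contDiffOn_trans i.1 j.1 i.2 j.2)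

instance : TopologicalSpace CP2Sharp := core.toTopologicalSpace

instance : ChartedSpace (ℂ × ℂ) CP2Sharp := core.toChartedSpace

theorem exists_of_mem_atlas {e : OpenPartialHomeomorph CP2Sharp (ℂ × ℂ)}
    (he : e ∈ atlas (ℂ × ℂ) CP2Sharp) : ∃ i : Fin 2 × Bool, e.toPartialEquiv = chart i.1 i.2 := by
  have he' : e ∈ ⋃ (e : PartialEquiv CP2Sharp (ℂ × ℂ)) (he : e ∈ core.atlas),
    {core.openPartialHomeomorph e he} := he
  simp only [mem_iUnion, mem_singleton_iff] at he'
  obtain ⟨_, ⟨i, rfl⟩, rfl⟩ := he'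
  exact ⟨i, rfl⟩

theorem contDiffOn_of_mem_atlas {e e' : OpenPartialHomeomorph CP2Sharp (ℂ × ℂ)}
    (he : e ∈ atlas (ℂ × ℂ) CP2Sharp) (he' : e' ∈ atlas (ℂ × ℂ) CP2Sharp) :
    ContDiffOn ℂ ω (e.symm.trans e') (e.symm.trans e').source := by
  obtain ⟨i, hi⟩ := exists_of_mem_atlas he
  obtain ⟨j, hj⟩ := exists_of_mem_atlas he'
  have h := contDiffOn_trans i.1 j.1 i.2 j.2
  rw [← hi, ← hj] at h
  exact h

/-- `CP2Sharp` is a complex surface. -/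
instance : IsManifold 𝓘(ℂ, ℂ × ℂ) ω CP2Sharp := by
  apply isManifold_of_contDiffOn
  intro e e' he he'
  simpa using contDiffOn_of_mem_atlas he he'

/-- `CP2Sharp` is a smooth real 4-manifold. -/
instance : IsManifold 𝓘(ℝ, ℂ × ℂ) ∞ CP2Sharp := by
  apply isManifold_of_contDiffOn
  intro e e' he he'
  simpa using ((contDiffOn_of_mem_atlas he he').restrict_scalars ℝ).of_le le_top

/-- The exceptional curve, i.e. the preimage of the point `[1 : 0]` of `ℂP²`. -/
def exceptionalCurve : Set CP2Sharp := {p | p.line.rep.2 = 0}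

/-- The (preimage of the) line at infinity of `ℂP²`. -/
def lineAtInfinity : Set CP2Sharp := {p | p.line.rep.1 = 0}

/-! ### The action of `U(2)` -/

theorem unitary_injective (A : Matrix.unitaryGroup (Fin 2) ℂ) :
    Function.Injective (Matrix.toLin' (A : Matrix (Fin 2) (Fin 2) ℂ)) := by
  intro v w h
  simp only [Matrix.toLin'_apply] at h
  have h' := congrArg (fun x ↦ (star (A : Matrix (Fin 2) (Fin 2) ℂ)) *ᵥ x) h
  simp only [Matrix.mulVec_mulVec, Matrix.mem_unitaryGroup_iff'.1 A.2, Matrix.one_mulVec] at h'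
  exact h'

theorem exists_map_rep {V : Type*} [AddCommGroup V] [Module ℂ V] (F : V →ₗ[ℂ] V)
    (hF : Function.Injective F) (l : ℙ ℂ V) :
    ∃ c : ℂ, c ≠ 0 ∧ (l.map F hF).rep = c • F l.rep := by
  have h0 : F l.rep ≠ 0 := fun h ↦ l.rep_nonzero (hF (h.trans (map_zero F).symm))
  have h1 : l.map F hF = Projectivization.mk ℂ (F l.rep) h0 := by
    conv_lhs => rw [← l.mk_rep]
    rfl
  obtain ⟨c, hc⟩ := Projectivization.exists_smul_eq_mk_rep ℂ (F l.rep) h0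
  exact ⟨c, c.ne_zero, by rw [h1, ← hc]; rfl⟩

theorem unitary_prod_injective (A : Matrix.unitaryGroup (Fin 2) ℂ) :
    Function.Injective ((LinearMap.id : ℂ →ₗ[ℂ] ℂ).prodMap
      (Matrix.toLin' (A : Matrix (Fin 2) (Fin 2) ℂ))) := by
  rintro ⟨a, v⟩ ⟨b, w⟩ h
  rw [LinearMap.prodMap_apply, LinearMap.prodMap_apply, Prod.mk.injEq] at h
  exact Prod.ext h.1 (unitary_injective A h.2)

/-- The action of `U(2)`, induced by its linear action on `ℂ²`. -/
def act (A : Matrix.unitaryGroup (Fin 2) ℂ) (p : CP2Sharp) : CP2Sharp :=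
  ⟨(p.line.map _ (unitary_prod_injective A), p.dir.map _ (unitary_injective A)), by
    obtain ⟨b, hb⟩ := p.exists_rep
    obtain ⟨c, -, hc⟩ := exists_map_rep _ (unitary_prod_injective A) p.line
    obtain ⟨d, hd, hd'⟩ := exists_map_rep _ (unitary_injective A) p.dir
    simp only [Projectivization.submodule_eq, hc, hd', Submodule.mem_span_singleton]
    refine ⟨c * b * d⁻¹, ?_⟩
    rw [smul_smul, inv_mul_cancel_right₀ hd, Prod.smul_snd, LinearMap.prodMap_apply, hb, map_smul,
      smul_smul]⟩

end

end CP2Sharp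

/-! ## The invariant metric on `S³ × (α, β)` -/

namespace KoisoCao

noncomputable section

/-- `ℂ²` with its Euclidean norm. -/
abbrev C2 : Type := EuclideanSpace ℂ (Fin 2)

instance : Fact (Module.finrank ℝ C2 = 3 + 1) := ⟨by
  rw [← Module.finrank_mul_finrank ℝ ℂ C2]
  simp⟩

/-- The unit sphere of `ℂ²`. -/
abbrev S3 : Type := Metric.sphere (0 : C2) 1

/-- The tangent space of `S³ × ℝ` at `q`. -/
abbrev T (q : S3 × ℝ) : Type := TangentSpace ((𝓡 3).prod 𝓘(ℝ, ℝ)) q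

/-- The vector field `X` on `S³`, tangent to the fibers of the Hopf fibration. The fields `X`, `Y`,
`Z` are `SU(2)`-invariant, orthonormal for the round metric, and satisfy
`[X, Y] = 2Z`, `[Y, Z] = 2X`, `[Z, X] = 2Y`. -/
def X (s : C2) : C2 := !₂[-Complex.I * s 0, -Complex.I * s 1]

/-- The vector field `Y` on `S³`. -/
def Y (s : C2) : C2 := !₂[star (s 1), -star (s 0)]

/-- The vector field `Z` on `S³`. -/
def Z (s : C2) : C2 := !₂[Complex.I * star (s 1), -Complex.I * star (s 0)]

/-- The coordinates of a tangent vector `ξ` of `S³ × (α, β)` at `(s, t)` with respect to the frame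
`H = ∂/∂t`, `X/f`, `Y/h`, `Z/h`, where `f = f(t)` and `h = h(t)`. -/
def coframe (f h : ℝ → ℝ) (q : S3 × ℝ) (ξ : T q) : Fin 4 → ℝ :=
  let τ : ℝ := mfderiv ((𝓡 3).prod 𝓘(ℝ, ℝ)) 𝓘(ℝ, ℝ) (fun q : S3 × ℝ ↦ q.2) q ξ
  let a : C2 := mfderiv ((𝓡 3).prod 𝓘(ℝ, ℝ)) 𝓘(ℝ, C2) (fun q : S3 × ℝ ↦ (q.1 : C2)) q ξ
  ![τ, f q.2 * inner ℝ (X q.1) a, h q.2 * inner ℝ (Y q.1) a, h q.2 * inner ℝ (Z q.1) a]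

/-- The metric `dt² + g_t` on `S³ × (α, β)` for which `H`, `X/f`, `Y/h`, `Z/h` are orthonormal. -/
def invMetric (f h : ℝ → ℝ) (q : S3 × ℝ) (ξ η : T q) : ℝ :=
  ∑ i, coframe f h q ξ i * coframe f h q η i

/-- `η = J ξ`, where `J` is the almost complex structure on `S³ × (α, β)` with `J H = X/f`,
`J (X/f) = -H`, `J Y = Z`, `J Z = -Y`. -/
def IsJ (f h : ℝ → ℝ) (q : S3 × ℝ) (ξ η : T q) : Prop :=
  coframe f h q η =
    ![-coframe f h q ξ 1, coframe f h q ξ 0, -coframe f h q ξ 3, coframe f h q ξ 2]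

/-- The derivative of a function on `[α, β]` (one-sided at the end points). -/
def der (α β : ℝ) (h : ℝ → ℝ) : ℝ → ℝ := derivWithin h (Icc α β)

/-- The function `f = -h h'`. -/
def fiber (α β : ℝ) (h : ℝ → ℝ) : ℝ → ℝ := fun t ↦ -(h t * der α β h t)

/-- The Hermitian metric `(dt² + g_t, J)` on `S³ × (α, β)` determined by `f` and `h` extends to the
Riemannian metric `g` on `ℂP² # -ℂP²`: there is a `U(2)`-equivariant diffeomorphism `Φ` of
`S³ × (α, β)` onto the complement of the exceptional curve and the line at infinity that pulls `g`
back to `dt² + g_t` and the complex structure back to `J`. (As `Φ` pulls the metric back to a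
metric, its derivative is invertible, so a smooth bijective `Φ` has a smooth inverse.) -/
def Extends (α β : ℝ) (f h : ℝ → ℝ) (g : RiemCoord.Metric (ℂ × ℂ) CP2Sharp) : Prop :=
  ∃ Φ : S3 × ℝ → CP2Sharp,
    ContMDiffOn ((𝓡 3).prod 𝓘(ℝ, ℝ)) 𝓘(ℝ, ℂ × ℂ) ∞ Φ (univ ×ˢ Ioo α β) ∧
    BijOn Φ (univ ×ˢ Ioo α β) (CP2Sharp.exceptionalCurve ∪ CP2Sharp.lineAtInfinity)ᶜ ∧
    (∀ (A : Matrix.unitaryGroup (Fin 2) ℂ) (s s' : S3), ∀ t ∈ Ioo α β,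
      (s' : C2).ofLp = (A : Matrix (Fin 2) (Fin 2) ℂ) *ᵥ (s : C2).ofLp →
        Φ (s', t) = CP2Sharp.act A (Φ (s, t))) ∧
    ∀ (s : S3), ∀ t ∈ Ioo α β, ∀ ξ η : T (s, t),
      g.inner (Φ (s, t)) (mfderiv ((𝓡 3).prod 𝓘(ℝ, ℝ)) 𝓘(ℝ, ℂ × ℂ) Φ (s, t) ξ)
        (mfderiv ((𝓡 3).prod 𝓘(ℝ, ℝ)) 𝓘(ℝ, ℂ × ℂ) Φ (s, t) η) = invMetric f h (s, t) ξ η ∧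
      (IsJ f h (s, t) ξ η →
        mfderiv ((𝓡 3).prod 𝓘(ℝ, ℝ)) 𝓘(ℝ, ℂ × ℂ) Φ (s, t) η =
          RiemCoord.J (Φ (s, t)) (mfderiv ((𝓡 3).prod 𝓘(ℝ, ℝ)) 𝓘(ℝ, ℂ × ℂ) Φ (s, t) ξ))

/-- The metric `g` on `ℂP² # -ℂP²` is invariant under the action of `U(2)`. -/
def IsInvariant (g : RiemCoord.Metric (ℂ × ℂ) CP2Sharp) : Prop :=
  ∀ (A : Matrix.unitaryGroup (Fin 2) ℂ) (p : CP2Sharp) (v w : TangentSpace 𝓘(ℝ, ℂ × ℂ) p),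
    g.inner (CP2Sharp.act A p)
      (mfderiv 𝓘(ℝ, ℂ × ℂ) 𝓘(ℝ, ℂ × ℂ) (CP2Sharp.act A) p v)
      (mfderiv 𝓘(ℝ, ℂ × ℂ) 𝓘(ℝ, ℂ × ℂ) (CP2Sharp.act A) p w) = g.inner p v w

/-- `g` is a gradient shrinking Ricci soliton, normalized so that `Ric(g) + ∇∇u - g = 0`, with a
smooth `U(2)`-invariant potential `u`. -/
def IsGradientShrinkingSoliton (g : RiemCoord.Metric (ℂ × ℂ) CP2Sharp) : Prop :=
  ∃ u : CP2Sharp → ℝ, ContMDiff 𝓘(ℝ, ℂ × ℂ) 𝓘(ℝ, ℝ) ∞ u ∧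
    (∀ (A : Matrix.unitaryGroup (Fin 2) ℂ) (p : CP2Sharp), u (CP2Sharp.act A p) = u p) ∧
    ∀ (p : CP2Sharp) (v w : TangentSpace 𝓘(ℝ, ℂ × ℂ) p),
      RiemCoord.ric g p v w + RiemCoord.hess g u p v w - g.inner p v w = 0

end

end KoisoCao

/-!
# The `U(2)`-invariant shrinking Kähler–Ricci soliton on `ℂP² # -ℂP²`

The function `x = h²` decreases from `6` to `2` along `[α, β]`, as the equation at the two end
points shows, and in terms of it the nonlinear equation for `h` becomes linear: `W(x) = x f²`
satisfies `W' = 2x - x²/2 - (c/2) W` (`IsSolution.exists_momentum`). So `W` is analytic on the whole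
line and vanishes at `2` and `6`, to first order. Holomorphically `S³ × (α, β)` is `ℂ² \ 0`, by
`(s, t) ↦ ρ(t) s` with `ρ' = -ρ / f`. With the coordinate `θ = ρ² / (1 + ρ²)` on the orbit space this
reads `θ (1 - θ) dx/dθ = Q(x)`, where `f² = Q(x) = W(x) / x`. The values of `W'` at `2` and `6` are
exactly those for which the solution `x = F(θ)` of this singular equation is smooth and has positive
derivative up to `θ = 0` and `θ = 1` (`exists_profile`, `IsSolution.exists_radius`); they come from
the boundary conditions on `h''`.

In the charts of `ℂP² # -ℂP²` the metric is expressed by `F` and `F'` at the smooth function `θ`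
(`chartForm`), so it is smooth and positive definite across the two singular orbits. Its expression
in homogeneous coordinates (`homForm`) is visibly independent of the chart and `U(2)`-invariant, and
its pullback to `S³ × (α, β)` is `dt² + g_t` (`extends_metric`).

For a Kähler metric, `-i∂∂̄ log det` is the Ricci form, and the Hessian of a function with a
holomorphic gradient is its `i∂∂̄` (`RiemCoord.ricci_eq_leviForm`,
`RiemCoord.hessian_eq_leviForm`). With the soliton potential `u = -(c/2) h²`, whose gradient
generates the scaling of the fibers over `ℂP¹`, the equation for `W` says that `u - log det` is a
Kähler potential of the metric (`chartForm_eq_leviForm`). This proves at once that the metric is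
Kähler and that `Ric + ∇∇u = g` (`ricci_add_hessian`). Only for this comparison is a point
off the singular orbits needed, and by continuity it suffices to make it there.
-/

/-! ### The Levi-Civita connection in coordinates -/

namespace RiemCoord

theorem two_le_infty : (2 : ℕ∞ω) ≤ ∞ :=
  WithTop.coe_le_coe.2 (le_top : (2 : ℕ∞) ≤ ⊤)

section Connection

variable {E : Type*} [NormedAddCommGroup E] [NormedSpace ℝ E] {G : E → E →L[ℝ] E →L[ℝ] ℝ}

theorem isInvertible_of_pos [FiniteDimensional ℝ E] {B : E →L[ℝ] E →L[ℝ] ℝ}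
    (hB : ∀ v, v ≠ 0 → 0 < B v v) : B.IsInvertible := by
  have hinj : Function.Injective (B : E →ₗ[ℝ] E →L[ℝ] ℝ) := by
    rw [← LinearMap.ker_eq_bot, LinearMap.ker_eq_bot']
    intro v hv
    by_contra h
    have hv' : B v = 0 := hv
    have := hB v h
    simp [hv'] at this
  have hdim : Module.finrank ℝ E = Module.finrank ℝ (E →L[ℝ] ℝ) := by
    rw [← (LinearMap.toContinuousLinearMap (𝕜 := ℝ) (E := E) (F' := ℝ)).finrank_eq]
    exact (Subspace.dual_finrank_eq).symm
  refine ⟨(LinearEquiv.ofInjectiveOfFinrankEq (B : E →ₗ[ℝ] E →L[ℝ] ℝ) hinj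
    hdim).toContinuousLinearEquiv, ?_⟩
  ext v w
  rfl

theorem fderiv_bilin_apply {x : E} (hG : DifferentiableAt ℝ G x) (u v w : E) :
    fderiv ℝ (fun y ↦ G y v w) x u = fderiv ℝ G x u v w := by
  have h := ((hG.hasFDerivAt.clm_apply (hasFDerivAt_const v x)).clm_apply
    (hasFDerivAt_const w x)).fderiv
  rw [h]
  simp

theorem fderiv_symm (hG : Differentiable ℝ G) (hs : ∀ x v w, G x v w = G x w v) (x u v w : E) :
    fderiv ℝ G x u v w = fderiv ℝ G x u w v := by
  rw [← fderiv_bilin_apply (hG x), ← fderiv_bilin_apply (hG x)]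
  simp only [hs]

theorem koszul_symm (hG : Differentiable ℝ G) (hs : ∀ x v w, G x v w = G x w v) (x v w : E) :
    koszul G x v w = koszul G x w v := by
  ext z
  rw [koszul_apply, koszul_apply, fderiv_symm hG hs x z v w]
  ring

theorem christoffel_symm (hG : Differentiable ℝ G) (hs : ∀ x v w, G x v w = G x w v) (x v w : E) :
    christoffel G x v w = christoffel G x w v := by
  rw [christoffel_apply, christoffel_apply, koszul_symm hG hs]

theorem metric_christoffel {x : E} (hi : (G x).IsInvertible) (v w z : E) :
    G x (christoffel G x v w) z = koszul G x v w z := by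
  rw [christoffel_apply, hi.self_apply_inverse]

/-- The connection given by the Christoffel symbols is compatible with the metric. -/
theorem fderiv_eq_christoffel (hG : Differentiable ℝ G) (hs : ∀ x v w, G x v w = G x w v)
    (hi : ∀ x, (G x).IsInvertible) (x u v w : E) :
    fderiv ℝ G x u v w = G x (christoffel G x u v) w + G x v (christoffel G x u w) := by
  rw [hs x v, metric_christoffel (hi x), metric_christoffel (hi x), koszul_apply, koszul_apply,
    fderiv_symm hG hs x u w v]
  ring

theorem contDiff_koszul (hG : ContDiff ℝ ∞ G) : ContDiff ℝ ∞ (koszul G) := by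
  have hD : ContDiff ℝ ∞ (fun x ↦ (fderiv ℝ G x : E →L[ℝ] E →L[ℝ] E →L[ℝ] ℝ)) :=
    hG.fderiv_right (m := ∞) le_rfl
  have hF : ContDiff ℝ ∞ (fun x ↦ (fderiv ℝ G x : E →L[ℝ] E →L[ℝ] E →L[ℝ] ℝ).flip) :=
    (ContinuousLinearMap.flipₗᵢ ℝ E E (E →L[ℝ] ℝ)).contDiff.comp hD
  unfold koszul
  exact ContDiff.const_smul (1 / 2 : ℝ) ((hD.add hF).sub (contDiff_const.clm_comp hF))

theorem contDiff_christoffel [CompleteSpace E] (hG : ContDiff ℝ ∞ G)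
    (hi : ∀ x, (G x).IsInvertible) : ContDiff ℝ ∞ (christoffel G) := by
  have hI : ContDiff ℝ ∞ (fun x ↦ (G x).inverse) := by
    rw [contDiff_iff_contDiffAt]
    intro x
    exact (hi x).contDiffAt_map_inverse.comp x hG.contDiffAt
  unfold christoffel
  exact ((ContinuousLinearMap.compL ℝ E (E →L[ℝ] ℝ) E).contDiff.comp hI).clm_comp
    (contDiff_koszul hG)

theorem fderiv_christoffel_apply [CompleteSpace E] (hG : ContDiff ℝ ∞ G)
    (hi : ∀ x, (G x).IsInvertible) (x v w : E) :
    HasFDerivAt (fun y ↦ christoffel G y v w)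
      (((fderiv ℝ (christoffel G) x).flip v).flip w) x := by
  have h : DifferentiableAt ℝ (christoffel G) x :=
    (contDiff_christoffel hG hi).contDiffAt.differentiableAt (by simp)
  convert (h.hasFDerivAt.clm_apply (hasFDerivAt_const v x)).clm_apply
    (hasFDerivAt_const w x) using 1
  ext u
  simp

theorem fderiv_christoffel_symm [CompleteSpace E] (hG : ContDiff ℝ ∞ G)
    (hs : ∀ x v w, G x v w = G x w v) (hi : ∀ x, (G x).IsInvertible) (x u v w : E) :
    fderiv ℝ (christoffel G) x u v w = fderiv ℝ (christoffel G) x u w v := by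
  have h1 := fderiv_christoffel_apply hG hi x v w
  have h2 := fderiv_christoffel_apply hG hi x w v
  have : (fun y ↦ christoffel G y v w) = fun y ↦ christoffel G y w v :=
    funext fun y ↦ christoffel_symm (hG.differentiable (by simp)) hs y v w
  rw [this] at h1
  exact DFunLike.congr_fun (h1.unique h2) u

/-! ### Symmetries of the curvature tensor -/

theorem curvature_antisymm (x u v w : E) : curvature G x v w u = -curvature G x u w v := by
  rw [curvature_apply, curvature_apply]
  abel

theorem curvature_bianchi [CompleteSpace E] (hG : ContDiff ℝ ∞ G)
    (hs : ∀ x v w, G x v w = G x w v) (hi : ∀ x, (G x).IsInvertible) (x u v w : E) :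
    curvature G x v w u + curvature G x w u v + curvature G x u v w = 0 := by
  have hs' := christoffel_symm (hG.differentiable (by simp)) hs x
  simp only [curvature_apply]
  rw [fderiv_christoffel_symm hG hs hi x u w v, fderiv_christoffel_symm hG hs hi x v u w,
    fderiv_christoffel_symm hG hs hi x w v u, hs' w u, hs' v u, hs' w v]
  abel

/-- The curvature endomorphisms are skew-symmetric, because second derivatives of the metric
commute. -/
theorem curvature_skew [CompleteSpace E] (hG : ContDiff ℝ ∞ G)
    (hs : ∀ x v w, G x v w = G x w v) (hi : ∀ x, (G x).IsInvertible) (x u v w z : E) :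
    G x (curvature G x v w u) z = -G x w (curvature G x v z u) := by
  have hd : Differentiable ℝ G := hG.differentiable (by simp)
  have hfd : DifferentiableAt ℝ (fderiv ℝ G) x :=
    (hG.fderiv_right (m := ∞) le_rfl).contDiffAt.differentiableAt (by simp)
  have key : ∀ u v : E, fderiv ℝ (fderiv ℝ G) x u v w z =
      fderiv ℝ G x u (christoffel G x v w) z + G x (fderiv ℝ (christoffel G) x u v w) z
      + fderiv ℝ G x u w (christoffel G x v z)
      + G x w (fderiv ℝ (christoffel G) x u v z) := by
    intro u v
    have h1 : HasFDerivAt (fun y ↦ fderiv ℝ G y v w z) _ x :=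
      ((hfd.hasFDerivAt.clm_apply (hasFDerivAt_const v x)).clm_apply
        (hasFDerivAt_const w x)).clm_apply (hasFDerivAt_const z x)
    have h2 : HasFDerivAt (fun y ↦ G y (christoffel G y v w) z + G y w (christoffel G y v z)) _ x :=
      (((hd x).hasFDerivAt.clm_apply (fderiv_christoffel_apply hG hi x v w)).clm_apply
        (hasFDerivAt_const z x)).add
      (((hd x).hasFDerivAt.clm_apply (hasFDerivAt_const w x)).clm_apply
        (fderiv_christoffel_apply hG hi x v z))
    have : (fun y ↦ fderiv ℝ G y v w z) =
        fun y ↦ G y (christoffel G y v w) z + G y w (christoffel G y v z) :=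
      funext fun y ↦ fderiv_eq_christoffel hd hs hi y v w z
    rw [this] at h1
    have h3 := DFunLike.congr_fun (h1.unique h2) u
    simp at h3
    rw [h3]
    ring
  have hsymm : fderiv ℝ (fderiv ℝ G) x u v = fderiv ℝ (fderiv ℝ G) x v u :=
    (hG.contDiffAt.isSymmSndFDerivAt (by simpa using two_le_infty)) u v
  have h1 := key u v
  have h2 := key v u
  rw [hsymm, h2] at h1
  simp only [fderiv_eq_christoffel hd hs hi] at h1
  simp only [curvature_apply, map_add, map_sub, add_apply, sub_apply]
  linarith

/-- The symmetry `R(u, v, w, z) = R(w, z, u, v)` of the curvature tensor. -/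
theorem curvature_pair_symm [CompleteSpace E] (hG : ContDiff ℝ ∞ G)
    (hs : ∀ x v w, G x v w = G x w v) (hi : ∀ x, (G x).IsInvertible) (x u v w z : E) :
    G x (curvature G x v w u) z = G x (curvature G x z u w) v := by
  have hb : ∀ a b c d : E, G x (curvature G x b c a) d + G x (curvature G x c a b) d
      + G x (curvature G x a b c) d = 0 := by
    intro a b c d
    have := congrArg (fun e ↦ G x e d) (curvature_bianchi hG hs hi x a b c)
    simpa using this
  have ha : ∀ a b c d : E, G x (curvature G x b c a) d = -G x (curvature G x a c b) d := by
    intro a b c d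
    rw [curvature_antisymm]
    simp
  have hk : ∀ a b c d : E, G x (curvature G x b c a) d = -G x (curvature G x b d a) c := by
    intro a b c d
    rw [curvature_skew hG hs hi, hs]
  linarith [hb u v w z, hb v w z u, hb w z u v, hb z u v w, hk u v w z, hk v w u z, hk w u v z,
    hk v z w u, hk w z u v, hk u z v w, ha u v z w, ha w z u v, ha z u w v, ha z w u v, ha z v w u,
    hk z w u v, hk z u v w, hk z v w u, ha v w z u, ha u w z v, ha v z u w]

end Connection

end RiemCoord

/-! ### Kähler metrics in holomorphic coordinates -/

namespace RiemCoord

section Kahler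

variable {E : Type*} [NormedAddCommGroup E] [NormedSpace ℝ E] {G : E → E →L[ℝ] E →L[ℝ] ℝ}
  {J : E →L[ℝ] E}

theorem contDiff_fderiv_infty {F : Type*} [NormedAddCommGroup F] [NormedSpace ℝ F] {φ : E → F}
    (hφ : ContDiff ℝ ∞ φ) : ContDiff ℝ ∞ (fderiv ℝ φ) :=
  hφ.fderiv_right (m := ∞) le_rfl

theorem sndDeriv_symm {F : Type*} [NormedAddCommGroup F] [NormedSpace ℝ F] {φ : E → F}
    (hφ : ContDiff ℝ ∞ φ) (x u v : E) :
    fderiv ℝ (fderiv ℝ φ) x u v = fderiv ℝ (fderiv ℝ φ) x v u :=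
  (hφ.contDiffAt.isSymmSndFDerivAt (by simpa using two_le_infty)) u v

/-- The `J`-invariant part of the second derivative of `φ`, i.e. twice the real part of
`∑ ∂²φ/∂zⱼ∂z̄ₖ vⱼ w̄ₖ`. -/
noncomputable def leviForm (J : E →L[ℝ] E) (φ : E → ℝ) (x v w : E) : ℝ :=
  (fderiv ℝ (fderiv ℝ φ) x v w + fderiv ℝ (fderiv ℝ φ) x (J v) (J w)) / 2

/-- A Hermitian metric with a local potential is Kähler. -/
theorem christoffel_J_of_potential (hJ : ∀ v, J (J v) = -v) {φ : E → ℝ} (hφ : ContDiff ℝ ∞ φ)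
    (hG : Differentiable ℝ G) (hi : ∀ x, (G x).IsInvertible)
    (hp : ∀ x v w, G x v w = leviForm J φ x v w)
    (x v w : E) : christoffel G x v (J w) = J (christoffel G x v w) := by
  have hφ1 := contDiff_fderiv_infty hφ
  have hφ2 : Differentiable ℝ (fderiv ℝ (fderiv ℝ φ)) :=
    (contDiff_fderiv_infty hφ1).differentiable (by simp)
  have hJG : ∀ a b, G x (J a) b = -G x a (J b) := by
    intro a b
    rw [hp, hp, leviForm, leviForm, hJ, hJ]
    simp only [map_neg, neg_apply]
    ring
  have hd : ∀ b e, HasFDerivAt (fun y ↦ fderiv ℝ (fderiv ℝ φ) y b e)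
      (((fderiv ℝ (fderiv ℝ (fderiv ℝ φ)) x).flip b).flip e) x := by
    intro b e
    refine (((hφ2 x).hasFDerivAt.clm_apply (hasFDerivAt_const b x)).clm_apply
      (hasFDerivAt_const e x)).congr_fderiv ?_
    ext u
    simp
  have h23 : ∀ a b e, fderiv ℝ (fderiv ℝ (fderiv ℝ φ)) x a b e =
      fderiv ℝ (fderiv ℝ (fderiv ℝ φ)) x a e b := by
    intro a b e
    have h1 := hd b e
    simp only [sndDeriv_symm hφ _ b e] at h1
    exact DFunLike.congr_fun (h1.unique (hd e b)) a
  have h12 : ∀ a b e, fderiv ℝ (fderiv ℝ (fderiv ℝ φ)) x a b e =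
      fderiv ℝ (fderiv ℝ (fderiv ℝ φ)) x b a e :=
    fun a b e ↦ DFunLike.congr_fun (sndDeriv_symm hφ1 x a b) e
  have hdG : ∀ a b e, fderiv ℝ G x a b e = (fderiv ℝ (fderiv ℝ (fderiv ℝ φ)) x a b e +
      fderiv ℝ (fderiv ℝ (fderiv ℝ φ)) x a (J b) (J e)) / 2 := by
    intro a b e
    rw [← fderiv_bilin_apply (hG x)]
    simp only [hp, leviForm]
    have := ((hd b e).add (hd (J b) (J e))).const_mul (1 / 2)
    rw [show (fun y ↦ (fderiv ℝ (fderiv ℝ φ) y b e + fderiv ℝ (fderiv ℝ φ) y (J b) (J e)) / 2) =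
      fun y ↦ 1 / 2 * (fderiv ℝ (fderiv ℝ φ) y b e + fderiv ℝ (fderiv ℝ φ) y (J b) (J e)) from
      funext fun y ↦ by ring]
    refine (congrArg (fun L : E →L[ℝ] ℝ ↦ L a) this.fderiv).trans ?_
    simp
    ring
  apply (hi x).injective
  ext z
  have hneg : G x (J (christoffel G x v w)) z = -G x (christoffel G x v w) (J z) := hJG _ _
  rw [hneg, metric_christoffel (hi x), metric_christoffel (hi x), koszul_apply, koszul_apply]
  simp only [hdG, hJ, map_neg, neg_apply]
  rw [h12 z v (J w), h12 z (J v) w, h12 (J z) v w, h12 (J z) (J v) (J w), h12 (J w) v z,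
    h12 (J w) (J v) (J z), h12 w v (J z), h12 w (J v) z, h23 v (J w) z, h23 v w (J z),
    h23 (J v) w z, h23 (J v) (J w) (J z)]
  ring

theorem christoffel_J_left (hs : ∀ x v w, G x v w = G x w v) (hG : Differentiable ℝ G)
    (hK : ∀ x v w, christoffel G x v (J w) = J (christoffel G x v w)) (x v w : E) :
    christoffel G x (J v) w = J (christoffel G x v w) := by
  rw [christoffel_symm hG hs, hK, christoffel_symm hG hs]

theorem fderiv_christoffel_J [CompleteSpace E] (hG : ContDiff ℝ ∞ G)
    (hi : ∀ x, (G x).IsInvertible)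
    (hK : ∀ x v w, christoffel G x v (J w) = J (christoffel G x v w)) (x u v w : E) :
    fderiv ℝ (christoffel G) x u v (J w) = J (fderiv ℝ (christoffel G) x u v w) := by
  have h1 := fderiv_christoffel_apply hG hi x v (J w)
  simp only [hK] at h1
  exact DFunLike.congr_fun (h1.unique (J.hasFDerivAt.comp x (fderiv_christoffel_apply hG hi x v w)))
    u

theorem curvature_J [CompleteSpace E] (hG : ContDiff ℝ ∞ G)
    (hi : ∀ x, (G x).IsInvertible)
    (hK : ∀ x v w, christoffel G x v (J w) = J (christoffel G x v w)) (x u v w : E) :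
    curvature G x v (J w) u = J (curvature G x v w u) := by
  simp only [curvature_apply, fderiv_christoffel_J hG hi hK, hK, map_add, map_sub]

/-- On a Kähler manifold `R(Ju, Jv) = R(u, v)`. -/
theorem curvature_J_J [CompleteSpace E] (hG : ContDiff ℝ ∞ G) (hs : ∀ x v w, G x v w = G x w v)
    (hi : ∀ x, (G x).IsInvertible) (hH : ∀ x v w, G x (J v) (J w) = G x v w)
    (hK : ∀ x v w, christoffel G x v (J w) = J (christoffel G x v w)) (x u v w : E) :
    curvature G x (J v) w (J u) = curvature G x v w u := by
  apply (hi x).injective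
  ext z
  rw [curvature_pair_symm hG hs hi, curvature_J hG hi hK, hH, ← curvature_pair_symm hG hs hi]

/-- The Hessian of a function with a holomorphic gradient, here `P`, is `J`-invariant. -/
theorem hessian_eq_leviForm (hG : ContDiff ℝ ∞ G) (hs : ∀ x v w, G x v w = G x w v)
    (hi : ∀ x, (G x).IsInvertible) (hJ : ∀ v, J (J v) = -v)
    (hH : ∀ x v w, G x (J v) (J w) = G x v w)
    (hK : ∀ x v w, christoffel G x v (J w) = J (christoffel G x v w))
    {u : E → ℝ} (hu : ContDiff ℝ ∞ u) {P : E →L[ℝ] E} (hP : ∀ v, P (J v) = J (P v))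
    (hgrad : ∀ x v, fderiv ℝ u x v = G x v (P x)) (x v w : E) :
    hessian G u x v w = leviForm J u x v w := by
  have hd : Differentiable ℝ G := hG.differentiable (by simp)
  have hh : ∀ v w, hessian G u x v w =
      G x w (christoffel G x v (P x)) + G x w (P v) := by
    intro v w
    have h1 : HasFDerivAt (fun y ↦ fderiv ℝ u y w) _ x :=
      ((contDiff_fderiv_infty hu).contDiffAt.differentiableAt
        (by simp)).hasFDerivAt.clm_apply (hasFDerivAt_const w x)
    have h2 : HasFDerivAt (fun y ↦ G y w (P y)) _ x :=
      ((hd x).hasFDerivAt.clm_apply (hasFDerivAt_const w x)).clm_apply P.hasFDerivAt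
    have : (fun y ↦ fderiv ℝ u y w) = fun y ↦ G y w (P y) := funext fun y ↦ hgrad y w
    rw [this] at h1
    have h3 := DFunLike.congr_fun (h1.unique h2) v
    simp at h3
    rw [hessian, h3, fderiv_eq_christoffel hd hs hi, hgrad]
    ring
  have hinv : hessian G u x (J v) (J w) = hessian G u x v w := by
    rw [hh, hh, christoffel_J_left hs hd hK, hP, hH, hH]
  have t3 : christoffel G x (J v) (J w) = -christoffel G x v w := by
    rw [hK, christoffel_J_left hs hd hK, hJ]
  rw [hessian, hessian, t3, map_neg] at hinv
  rw [hessian, leviForm]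
  linarith

variable [FiniteDimensional ℝ E]

/-- The Ricci tensor of a Kähler metric is `J`-invariant. -/
theorem ricci_J_J (hG : ContDiff ℝ ∞ G) (hs : ∀ x v w, G x v w = G x w v)
    (hi : ∀ x, (G x).IsInvertible)
    (hH : ∀ x v w, G x (J v) (J w) = G x v w)
    (hK : ∀ x v w, christoffel G x v (J w) = J (christoffel G x v w)) (x v w : E) :
    ricci G x (J v) (J w) = ricci G x v w := by
  have : CompleteSpace E := FiniteDimensional.complete ℝ E
  have h1 : (curvature G x (J v) (J w) : E →ₗ[ℝ] E) =
      (J : E →ₗ[ℝ] E) ∘ₗ (curvature G x (J v) w : E →ₗ[ℝ] E) := by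
    ext u
    exact curvature_J hG hi hK x u (J v) w
  have h2 : (curvature G x v w : E →ₗ[ℝ] E) =
      (curvature G x (J v) w : E →ₗ[ℝ] E) ∘ₗ (J : E →ₗ[ℝ] E) := by
    ext u
    exact (curvature_J_J hG hs hi hH hK x u v w).symm
  rw [ricci, ricci, h1, h2, LinearMap.trace_comp_comm']

/-- If the trace of the Kähler connection is the differential of `lam`, that is, if `lam` is the
logarithm of the complex determinant of the metric, then `Ric = -i∂∂̄ lam`. -/
theorem ricci_eq_leviForm (hG : ContDiff ℝ ∞ G) (hs : ∀ x v w, G x v w = G x w v)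
    (hi : ∀ x, (G x).IsInvertible) (hJ : ∀ v, J (J v) = -v)
    (hH : ∀ x v w, G x (J v) (J w) = G x v w)
    (hK : ∀ x v w, christoffel G x v (J w) = J (christoffel G x v w))
    {lam : E → ℝ} (hlam : ContDiff ℝ ∞ lam)
    (htr : ∀ x v, LinearMap.trace ℝ E (christoffel G x v : E →ₗ[ℝ] E) = fderiv ℝ lam x v)
    (x v w : E) : ricci G x v w = -leviForm J lam x v w := by
  have : CompleteSpace E := FiniteDimensional.complete ℝ E
  have hd : Differentiable ℝ G := hG.differentiable (by simp)
  let tr : (E →L[ℝ] E) →L[ℝ] ℝ :=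
    (LinearMap.trace ℝ E ∘ₗ ContinuousLinearMap.coeLM ℝ).toContinuousLinearMap
  have htr' : ∀ T : E →L[ℝ] E, LinearMap.trace ℝ E (T : E →ₗ[ℝ] E) = tr T := fun _ ↦ rfl
  have hdtr : ∀ v w, tr ((fderiv ℝ (christoffel G) x v).flip w) =
      fderiv ℝ (fderiv ℝ lam) x v w := by
    intro v w
    have hflip : (fderiv ℝ (christoffel G) x v).flip w = fderiv ℝ (christoffel G) x v w := by
      ext u
      exact fderiv_christoffel_symm hG hs hi x v u w
    rw [hflip]
    have hc : HasFDerivAt (christoffel G) (fderiv ℝ (christoffel G) x) x :=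
      ((contDiff_christoffel hG hi).contDiffAt.differentiableAt (by simp)).hasFDerivAt
    have h1 : HasFDerivAt (fun y ↦ tr (christoffel G y w)) _ x :=
      tr.hasFDerivAt.comp x (hc.clm_apply (hasFDerivAt_const w x))
    have h2 : HasFDerivAt (fun y ↦ fderiv ℝ lam y w) _ x :=
      ((contDiff_fderiv_infty hlam).contDiffAt.differentiableAt
        (by simp)).hasFDerivAt.clm_apply (hasFDerivAt_const w x)
    have : (fun y ↦ tr (christoffel G y w)) = fun y ↦ fderiv ℝ lam y w := funext fun y ↦ htr y w
    rw [this] at h1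
    simpa using DFunLike.congr_fun (h1.unique h2) v
  have hric : ∀ v w, ricci G x v w = tr (((fderiv ℝ (christoffel G) x).flip v).flip w)
      - fderiv ℝ (fderiv ℝ lam) x v w + fderiv ℝ lam x (christoffel G x v w)
      - tr ((christoffel G x v).comp (christoffel G x w)) := by
    intro v w
    have e1 : ∀ a, (christoffel G x).flip a = christoffel G x a := by
      intro a
      ext u
      exact christoffel_symm hd hs x u a
    rw [ricci, htr', curvature, map_sub, map_add, map_sub, hdtr, e1, e1, ← htr', ← htr', ← htr',
      htr]
  have hinv := ricci_J_J hG hs hi hH hK x v w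
  have t1 : ((fderiv ℝ (christoffel G) x).flip (J v)).flip (J w) =
      -((fderiv ℝ (christoffel G) x).flip v).flip w := by
    ext u
    simp only [ContinuousLinearMap.flip_apply, neg_apply]
    rw [fderiv_christoffel_J hG hi hK, fderiv_christoffel_symm hG hs hi,
      fderiv_christoffel_J hG hi hK, hJ, fderiv_christoffel_symm hG hs hi]
  have t3 : christoffel G x (J v) (J w) = -christoffel G x v w := by
    rw [hK, christoffel_J_left hs hd hK, hJ]
  have t4 : (christoffel G x (J v)).comp (christoffel G x (J w)) =
      -(christoffel G x v).comp (christoffel G x w) := by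
    ext u
    simp only [ContinuousLinearMap.comp_apply, neg_apply]
    rw [christoffel_J_left hs hd hK, christoffel_J_left hs hd hK, hK, hJ]
  have h1 := hric v w
  have h2 := hric (J v) (J w)
  rw [t1, t3, t4, map_neg, map_neg, map_neg, hinv] at h2
  rw [leviForm]
  linarith

end Kahler

end RiemCoord

/-! ### The momentum profile -/

namespace KoisoCao

open Filter Topology

theorem analyticAt_dslope {f : ℝ → ℝ} (hf : ∀ x, AnalyticAt ℝ f x) (a x : ℝ) :
    AnalyticAt ℝ (dslope f a) x := by
  by_cases h : x = a
  · subst h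
    obtain ⟨p, hp⟩ := hf x
    exact ⟨_, hp.has_fpower_series_dslope_fslope⟩
  · refine AnalyticAt.congr ?_ (dslope_eventuallyEq_slope_of_ne f h).symm
    simp only [slope_fun_def, vsub_eq_sub, smul_eq_mul]
    exact ((analyticAt_id.sub analyticAt_const).inv (sub_ne_zero.2 h)).mul
      ((hf x).sub analyticAt_const)

theorem exists_analytic_factor {f : ℝ → ℝ} (hf : ∀ x, AnalyticAt ℝ f x) (h2 : f 2 = 0)
    (h6 : f 6 = 0) :
    ∃ B : ℝ → ℝ, (∀ x, AnalyticAt ℝ B x) ∧ ∀ x, f x = (x - 2) * (6 - x) * B x := by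
  have e1 : ∀ x, (x - 2) * dslope f 2 x = f x := fun x ↦ by
    simpa [h2] using sub_smul_dslope f 2 x
  have h6' : dslope f 2 6 = 0 := by
    have := e1 6
    rw [h6] at this
    linarith
  have e2 : ∀ x, (x - 6) * dslope (dslope f 2) 6 x = dslope f 2 x := fun x ↦ by
    simpa [h6'] using sub_smul_dslope (dslope f 2) 6 x
  refine ⟨fun x ↦ -dslope (dslope f 2) 6 x,
    fun x ↦ (analyticAt_dslope (analyticAt_dslope hf 2) 6 x).neg, fun x ↦ ?_⟩
  rw [← e1, ← e2]
  ring

theorem exists_Ioo_subset {O : Set ℝ} (hO : IsOpen O) (h : Icc 2 6 ⊆ O) :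
    ∃ a < 2, ∃ b > 6, Ioo a b ⊆ O := by
  obtain ⟨a, ha, ha'⟩ := exists_Ioc_subset_of_mem_nhds
    (hO.mem_nhds (h (show (2 : ℝ) ∈ Icc 2 6 by norm_num))) ⟨1, by norm_num⟩
  obtain ⟨b, hb, hb'⟩ := exists_Ico_subset_of_mem_nhds
    (hO.mem_nhds (h (show (6 : ℝ) ∈ Icc 2 6 by norm_num))) ⟨7, by norm_num⟩
  refine ⟨a, ha, b, hb, fun x hx ↦ ?_⟩
  rcases le_or_gt x 2 with h2 | h2
  · exact ha' ⟨hx.1, h2⟩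
  · rcases le_or_gt 6 x with h6 | h6
    · exact hb' ⟨h6, hx.2⟩
    · exact h ⟨h2.le, h6.le⟩

theorem exists_smooth_primitive {a b x₀ : ℝ} {k : ℝ → ℝ} (hx₀ : x₀ ∈ Ioo a b)
    (hk : ContDiffOn ℝ ∞ k (Ioo a b)) :
    ∃ K : ℝ → ℝ, ContDiffOn ℝ ∞ K (Ioo a b) ∧ ∀ x ∈ Ioo a b, HasDerivAt K (k x) x := by
  have hd : ∀ x ∈ Ioo a b, HasDerivAt (fun y ↦ ∫ s in x₀..y, k s) (k x) x := by
    intro x hx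
    refine intervalIntegral.integral_hasDerivAt_right
      ((hk.continuousOn.mono (ordConnected_Ioo.uIcc_subset hx₀ hx)).intervalIntegrable)
      (hk.continuousOn.stronglyMeasurableAtFilter isOpen_Ioo x hx)
      (hk.continuousOn.continuousAt (isOpen_Ioo.mem_nhds hx))
  refine ⟨fun y ↦ ∫ s in x₀..y, k s, ?_, hd⟩
  rw [contDiffOn_infty_iff_deriv_of_isOpen isOpen_Ioo]
  exact ⟨fun x hx ↦ (hd x hx).differentiableAt.differentiableWithinAt,
    hk.congr fun x hx ↦ (hd x hx).deriv⟩

/-- A left inverse of an injective smooth function is smooth where the derivative does not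
vanish. -/
theorem contDiffAt_of_leftInverse {f g : ℝ → ℝ} {s : Set ℝ} (hs : IsOpen s)
    (hg : ∀ x ∈ s, g (f x) = x) {x d : ℝ} (hx : x ∈ s) (hf : ContDiffAt ℝ ∞ f x)
    (hd : HasDerivAt f d x) (h0 : d ≠ 0) :
    ContDiffAt ℝ ∞ g (f x) ∧ deriv g (f x) = d⁻¹ := by
  have hn : (∞ : ℕ∞ω) ≠ 0 := by simp
  have hf' : HasFDerivAt f
      ((ContinuousLinearEquiv.unitsEquivAut ℝ (Units.mk0 d h0) : ℝ ≃L[ℝ] ℝ) : ℝ →L[ℝ] ℝ) x := by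
    refine hd.hasFDerivAt.congr_fderiv ?_
    ext
    simp
  have hc := hf.to_localInverse hf' hn
  have hst := hf.hasStrictFDerivAt' hf' hn
  have hgx : (hf.localInverse hf' hn) (f x) = x := hst.localInverse_apply_image
  have hev : g =ᶠ[𝓝 (f x)] hf.localInverse hf' hn := by
    have h1 : ∀ᶠ y in 𝓝 (f x), f (hf.localInverse hf' hn y) = y :=
      hst.eventually_right_inverse
    have h2 : ∀ᶠ y in 𝓝 (f x), hf.localInverse hf' hn y ∈ s :=
      hc.continuousAt.eventually_mem (by rw [hgx]; exact hs.mem_nhds hx)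
    filter_upwards [h1, h2] with y hy1 hy2
    conv_lhs => rw [← hy1]
    exact hg _ hy2
  have hcg : ContDiffAt ℝ ∞ g (f x) := hc.congr_of_eventuallyEq hev
  refine ⟨hcg, ?_⟩
  have h1 := ((hcg.differentiableAt hn).hasDerivAt).comp x hd
  have h2 : HasDerivAt (g ∘ f) 1 x :=
    (hasDerivAt_id x).congr_of_eventuallyEq (by
      filter_upwards [hs.mem_nhds hx] with y hy using hg y hy)
  exact eq_inv_of_mul_eq_one_left (h1.unique h2)

/-- `F` is the function with `h² = F(θ)`, where `θ ∈ [0, 1]` is the coordinate `|z|²/(1+|z|²)`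
on the orbit space and `Q` is the momentum profile, i.e. `f² = Q(h²)`; the differential equation
for `Q` is the soliton equation with potential `κ h²`. -/
structure IsProfile (κ : ℝ) (Q F : ℝ → ℝ) : Prop where
  contDiffAt : ∀ θ ∈ Icc (0 : ℝ) 1, ContDiffAt ℝ ∞ F θ
  pos : ∀ θ ∈ Icc (0 : ℝ) 1, 0 < F θ
  deriv_pos : ∀ θ ∈ Icc (0 : ℝ) 1, 0 < deriv F θ
  euler : ∀ θ ∈ Icc (0 : ℝ) 1, θ * (1 - θ) * deriv F θ = Q (F θ)
  ode : ∀ x, 0 < x → HasDerivAt Q (2 - x / 2 - Q x / x + κ * Q x) x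

/-- The singular equation `F' = Q(F) / (θ (1 - θ))` has a solution that is smooth up to the end
points `0` and `1`, where it takes the values `2` and `6`. Its inverse `T` is the function
`(x - 2) e^K / (6 - x + (x - 2) e^K)`, where `K` is a primitive of the regular part
of `1 / Q`. -/
theorem exists_profile {c : ℝ} {W : ℝ → ℝ} (hW : ∀ x, AnalyticAt ℝ W x)
    (hW' : ∀ x, HasDerivAt W (2 * x - x ^ 2 / 2 - c / 2 * W x) x) (h2 : W 2 = 0) (h6 : W 6 = 0)
    (hpos : ∀ x ∈ Ioo (2 : ℝ) 6, 0 < W x) :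
    ∃ T F : ℝ → ℝ, IsProfile (-c / 2) (fun x ↦ W x / x) F ∧
      (∀ x ∈ Icc (2 : ℝ) 6, F (T x) = x) ∧ T 2 = 0 ∧ T 6 = 1 ∧
      (∀ x ∈ Ioo (2 : ℝ) 6, T x ∈ Ioo (0 : ℝ) 1) ∧
      ∀ x ∈ Icc (2 : ℝ) 6, ContDiffAt ℝ ∞ T x := by
  obtain ⟨B, hBa, hB⟩ := exists_analytic_factor hW h2 h6
  have hBd : ∀ x, HasDerivAt B (deriv B x) x := fun x ↦ (hBa x).differentiableAt.hasDerivAt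
  have hprod : ∀ x, HasDerivAt (fun x ↦ (x - 2) * (6 - x) * B x)
      ((1 * (6 - x) + (x - 2) * (-1)) * B x + (x - 2) * (6 - x) * deriv B x) x := fun x ↦
    ((((hasDerivAt_id x).sub_const 2).mul ((hasDerivAt_id x).const_sub 6))).mul (hBd x)
  have hWd : ∀ x, 2 * x - x ^ 2 / 2 - c / 2 * W x =
      (1 * (6 - x) + (x - 2) * (-1)) * B x + (x - 2) * (6 - x) * deriv B x := by
    intro x
    have h := hprod x
    rw [← funext hB] at h
    exact (hW' x).unique h
  have hB2 : B 2 = 1 / 2 := by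
    have := hWd 2
    rw [h2] at this
    linarith
  have hB6 : B 6 = 3 / 2 := by
    have := hWd 6
    rw [h6] at this
    linarith
  have hBpos : ∀ x ∈ Icc (2 : ℝ) 6, 0 < B x := by
    intro x hx
    rcases eq_or_lt_of_le hx.1 with rfl | h2'
    · rw [hB2]; norm_num
    rcases eq_or_lt_of_le hx.2 with rfl | h6'
    · rw [hB6]; norm_num
    have := hpos x ⟨h2', h6'⟩
    rw [hB] at this
    exact pos_of_mul_pos_right this (mul_nonneg (by linarith) (by linarith))
  -- The values of `B` at `2` and `6` make the residues of `x / W` there equal to `1` and `-1`, so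
  -- that `x / W = 4 / ((x - 2) (6 - x)) + C / B` with `C` analytic.
  obtain ⟨C, hCa, hC⟩ := exists_analytic_factor (f := fun x ↦ x - 4 * B x)
    (fun x ↦ analyticAt_id.sub (analyticAt_const.mul (hBa x))) (by simp [hB2]; norm_num)
    (by simp [hB6]; norm_num)
  have hBc : Continuous B := continuous_iff_continuousAt.2 fun x ↦ (hBa x).continuousAt
  obtain ⟨a₁, ha₁, b₁, hb₁, hI₁⟩ := exists_Ioo_subset
    ((isOpen_lt continuous_const hBc).inter isOpen_Ioi)
    (fun x hx ↦ ⟨hBpos x hx, show (0 : ℝ) < x by linarith [hx.1]⟩)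
  have hk : ContDiffOn ℝ ∞ (fun x ↦ C x / B x) (Ioo a₁ b₁) := fun x hx ↦
    ((hCa x).contDiffAt.div (hBa x).contDiffAt (hI₁ hx).1.ne').contDiffWithinAt
  obtain ⟨K, hKs, hKd⟩ := exists_smooth_primitive (x₀ := 2) ⟨ha₁, by linarith⟩ hk
  let D : ℝ → ℝ := fun x ↦ (6 - x) + (x - 2) * Real.exp (K x)
  have hDs : ContDiffOn ℝ ∞ D (Ioo a₁ b₁) :=
    (contDiffOn_const.sub contDiffOn_id).add ((contDiffOn_id.sub contDiffOn_const).mul hKs.exp)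
  have hDpos : ∀ x ∈ Icc (2 : ℝ) 6, 0 < D x := by
    intro x hx
    have he := Real.exp_pos (K x)
    rcases eq_or_lt_of_le hx.1 with rfl | h2'
    · simp [D]; norm_num
    · have := mul_pos (sub_pos.2 h2') he
      have := hx.2
      simp only [D]
      linarith
  obtain ⟨a, ha, b, hb, hI⟩ := exists_Ioo_subset
    (hDs.continuousOn.isOpen_inter_preimage isOpen_Ioo isOpen_Ioi) (fun x hx ↦
      ⟨⟨by linarith [hx.1], by linarith [hx.2]⟩, hDpos x hx⟩)
  let T : ℝ → ℝ := fun x ↦ (x - 2) * Real.exp (K x) / D x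
  have hTs : ∀ x ∈ Ioo a b, ContDiffAt ℝ ∞ T x := by
    intro x hx
    have hK : ContDiffAt ℝ ∞ K x := hKs.contDiffAt (isOpen_Ioo.mem_nhds (hI hx).1)
    have hD : ContDiffAt ℝ ∞ D x := hDs.contDiffAt (isOpen_Ioo.mem_nhds (hI hx).1)
    exact ((contDiffAt_id.sub contDiffAt_const).mul hK.exp).div hD (ne_of_gt (hI hx).2)
  have hTd : ∀ x ∈ Ioo a b, HasDerivAt T (Real.exp (K x) * x / (B x * D x ^ 2)) x := by
    intro x hx
    have hBx : 0 < B x := (hI₁ (hI hx).1).1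
    have hDx : 0 < D x := (hI hx).2
    have hN := ((hasDerivAt_id x).sub_const 2).mul (hKd x (hI hx).1).exp
    have hD' := ((hasDerivAt_id x).const_sub 6).add hN
    refine (hN.div hD' hDx.ne').congr_deriv ?_
    have hCx : x = (x - 2) * (6 - x) * C x + 4 * B x := by linarith [hC x]
    simp only [id, Pi.mul_apply, Pi.add_apply]
    change _ / (D x) ^ 2 = _
    rw [show Real.exp (K x) * x / (B x * D x ^ 2) = (Real.exp (K x) * x / B x) / D x ^ 2 by
      field_simp]
    congr 1
    rw [eq_div_iff hBx.ne']
    field_simp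
    linear_combination (-1) * hCx
  have hTpos : ∀ x ∈ Ioo a b, 0 < Real.exp (K x) * x / (B x * D x ^ 2) := by
    intro x hx
    have hBx : 0 < B x := (hI₁ (hI hx).1).1
    have hx0 : 0 < x := (hI₁ (hI hx).1).2
    have hDx : 0 < D x := (hI hx).2
    positivity
  have hsub : Icc 2 6 ⊆ Ioo a b := fun x hx ↦ ⟨by linarith [hx.1], by linarith [hx.2]⟩
  have hmono : StrictMonoOn T (Ioo a b) := by
    refine strictMonoOn_of_deriv_pos (convex_Ioo a b)
      (fun x hx ↦ (hTs x hx).continuousAt.continuousWithinAt) fun x hx ↦ ?_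
    rw [interior_Ioo] at hx
    rw [(hTd x hx).deriv]
    exact hTpos x hx
  have hT2 : T 2 = 0 := by simp [T]
  have hT6 : T 6 = 1 := by
    simp only [T, D, sub_self, zero_add]
    exact div_self (by positivity)
  have m2 : (2 : ℝ) ∈ Icc (2 : ℝ) 6 := by norm_num
  have m6 : (6 : ℝ) ∈ Icc (2 : ℝ) 6 := by norm_num
  let F : ℝ → ℝ := Function.invFunOn T (Ioo a b)
  have hFT : ∀ x ∈ Ioo a b, F (T x) = x := hmono.injOn.leftInvOn_invFunOn
  have hsurj : ∀ θ ∈ Icc (0 : ℝ) 1, ∃ x ∈ Icc (2 : ℝ) 6, T x = θ := by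
    have := intermediate_value_Icc (show (2 : ℝ) ≤ 6 by norm_num)
      (fun x hx ↦ (hTs x (hsub hx)).continuousAt.continuousWithinAt)
    rw [hT2, hT6] at this
    exact this
  have hF : ∀ x ∈ Icc (2 : ℝ) 6, ContDiffAt ℝ ∞ F (T x) ∧
      deriv F (T x) = (Real.exp (K x) * x / (B x * D x ^ 2))⁻¹ := fun x hx ↦
    contDiffAt_of_leftInverse isOpen_Ioo hFT (hsub hx) (hTs x (hsub hx)) (hTd x (hsub hx))
      (hTpos x (hsub hx)).ne'
  refine ⟨T, F, ⟨?_, ?_, ?_, ?_, ?_⟩, fun x hx ↦ hFT x (hsub hx), hT2, hT6, fun x hx ↦ ?_,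
    fun x hx ↦ hTs x (hsub hx)⟩
  · intro θ hθ
    obtain ⟨x, hx, rfl⟩ := hsurj θ hθ
    exact (hF x hx).1
  · intro θ hθ
    obtain ⟨x, hx, rfl⟩ := hsurj θ hθ
    rw [hFT x (hsub hx)]
    linarith [hx.1]
  · intro θ hθ
    obtain ⟨x, hx, rfl⟩ := hsurj θ hθ
    rw [(hF x hx).2]
    exact inv_pos.2 (hTpos x (hsub hx))
  · intro θ hθ
    obtain ⟨x, hx, rfl⟩ := hsurj θ hθ
    have hBx : B x ≠ 0 := (hBpos x hx).ne'
    have hDx : D x ≠ 0 := (hDpos x hx).ne'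
    have hx0 : x ≠ 0 := by linarith [hx.1]
    rw [(hF x hx).2, hFT x (hsub hx), hB]
    have h1 : 1 - T x = (6 - x) / D x := by
      simp only [T]
      rw [eq_div_iff hDx, sub_mul, div_mul_cancel₀ _ hDx]
      simp only [D]
      ring
    rw [h1]
    simp only [T]
    field_simp
  · intro x hx
    refine ((hW' x).div (hasDerivAt_id x) hx.ne').congr_deriv ?_
    simp only [id]
    field_simp
    ring
  · have hx' : x ∈ Icc (2 : ℝ) 6 := ⟨hx.1.le, hx.2.le⟩
    rw [← hT2, ← hT6]
    exact ⟨hmono (hsub m2) (hsub hx') hx.1, hmono (hsub hx') (hsub m6) hx.2⟩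

end KoisoCao

namespace KoisoCao

open Filter Topology

/-- The differential equation for `h` with its boundary conditions. -/
structure IsSolution (α β c : ℝ) (h : ℝ → ℝ) : Prop where
  lt : α < β
  smooth : ContDiffOn ℝ ∞ h (Icc α β)
  pos : ∀ t ∈ Icc α β, 0 < h t
  fiber_pos : ∀ t ∈ Ioo α β, 0 < fiber α β h t
  ode : ∀ t ∈ Icc α β, 2 * h t * der α β (der α β h) t + 4 * der α β h t ^ 2 - 4
        + h t ^ 2 * (1 + c * der α β h t ^ 2) = 0
  der_left : der α β h α = 0
  der_right : der α β h β = 0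
  der_der_left : h α * der α β (der α β h) α = -1
  der_der_right : -(h β * der α β (der α β h) β) = -1

namespace IsSolution

variable {α β c : ℝ} {h : ℝ → ℝ} (H : IsSolution α β c h)
include H

theorem sq_left : h α ^ 2 = 6 := by
  have h1 := H.ode α (left_mem_Icc.2 H.lt.le)
  have h2 := H.der_der_left
  rw [H.der_left] at h1
  nlinarith

theorem sq_right : h β ^ 2 = 2 := by
  have h1 := H.ode β (right_mem_Icc.2 H.lt.le)
  have h2 := H.der_der_right
  rw [H.der_right] at h1
  nlinarith

theorem eq_left : h α = Real.sqrt 6 := by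
  rw [← H.sq_left, Real.sqrt_sq (H.pos α (left_mem_Icc.2 H.lt.le)).le]

theorem eq_right : h β = Real.sqrt 2 := by
  rw [← H.sq_right, Real.sqrt_sq (H.pos β (right_mem_Icc.2 H.lt.le)).le]

theorem smooth_der : ContDiffOn ℝ ∞ (der α β h) (Icc α β) :=
  H.smooth.derivWithin (uniqueDiffOn_Icc H.lt) (by simp)

theorem hasDerivWithinAt {t : ℝ} (ht : t ∈ Icc α β) :
    HasDerivWithinAt h (der α β h t) (Icc α β) t :=
  ((H.smooth t ht).differentiableWithinAt (by simp)).hasDerivWithinAt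

theorem hasDerivWithinAt_der {t : ℝ} (ht : t ∈ Icc α β) :
    HasDerivWithinAt (der α β h) (der α β (der α β h) t) (Icc α β) t :=
  ((H.smooth_der t ht).differentiableWithinAt (by simp)).hasDerivWithinAt

theorem hasDerivAt {t : ℝ} (ht : t ∈ Ioo α β) : HasDerivAt h (der α β h t) t :=
  (H.hasDerivWithinAt (Ioo_subset_Icc_self ht)).hasDerivAt (Icc_mem_nhds ht.1 ht.2)

theorem eq_of_hasDerivWithinAt_zero {E : ℝ → ℝ}
    (hE : ∀ t ∈ Icc α β, HasDerivWithinAt E 0 (Icc α β) t) {t : ℝ} (ht : t ∈ Icc α β) :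
    E t = E α :=
  constant_of_derivWithin_zero (fun t ht ↦ (hE t ht).differentiableWithinAt)
    (fun t ht ↦ (hE t (Ico_subset_Icc_self ht)).derivWithin
      (uniqueDiffOn_Icc H.lt t (Ico_subset_Icc_self ht))) t ht

/-- For `c = 0` the equation would make `h⁴h'² - h⁴ + h⁶/6` constant, against the boundary
conditions. -/
theorem c_ne_zero : c ≠ 0 := by
  rintro rfl
  have hE : ∀ t ∈ Icc α β, HasDerivWithinAt
      (fun t ↦ h t ^ 4 * der α β h t ^ 2 - (h t ^ 4 - h t ^ 6 / 6)) 0 (Icc α β) t := by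
    intro t ht
    have h1 := H.hasDerivWithinAt ht
    have h2 := H.hasDerivWithinAt_der ht
    refine (((h1.pow 4).mul (h2.pow 2)).sub ((h1.pow 4).sub ((h1.pow 6).div_const 6))).congr_deriv
      ?_
    simp only [Pi.pow_apply]
    linear_combination h t ^ 3 * der α β h t * H.ode t ht
  have := H.eq_of_hasDerivWithinAt_zero hE (right_mem_Icc.2 H.lt.le)
  simp only [H.der_left, H.der_right] at this
  have e4 : h α ^ 4 = (h α ^ 2) ^ 2 := by ring
  have e6 : h α ^ 6 = (h α ^ 2) ^ 3 := by ring
  have e4' : h β ^ 4 = (h β ^ 2) ^ 2 := by ring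
  have e6' : h β ^ 6 = (h β ^ 2) ^ 3 := by ring
  rw [e4, e6, e4', e6', H.sq_left, H.sq_right] at this
  norm_num at this

/-- In terms of `x = h²` the equation is linear: `W = x f²` solves
`W' = 2x - x²/2 - (c/2) W`, so it is the sum of a quadratic polynomial and a multiple of
`exp (-cx/2)`. -/
theorem exists_momentum : ∃ W : ℝ → ℝ, (∀ x, AnalyticAt ℝ W x) ∧
    (∀ x, HasDerivAt W (2 * x - x ^ 2 / 2 - c / 2 * W x) x) ∧
    ∀ t ∈ Icc α β, W (h t ^ 2) = h t ^ 2 * fiber α β h t ^ 2 := by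
  have hc := H.c_ne_zero
  let p : ℝ → ℝ := fun x ↦ -x ^ 2 / c + (2 / c) * (2 + 2 / c) * x - (4 / c ^ 2) * (2 + 2 / c)
  have hp : ∀ x, HasDerivAt p (2 * x - x ^ 2 / 2 - c / 2 * p x) x := by
    intro x
    have h1 := ((((hasDerivAt_id x).pow 2).neg.div_const c).add
      ((hasDerivAt_id x).const_mul ((2 / c) * (2 + 2 / c)))).sub_const ((4 / c ^ 2) * (2 + 2 / c))
    refine h1.congr_deriv ?_
    simp only [id, p]
    field_simp
    ring
  have hE : ∀ t ∈ Icc α β, HasDerivWithinAt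
      (fun t ↦ (h t ^ 4 * der α β h t ^ 2 - p (h t ^ 2)) * Real.exp (c / 2 * h t ^ 2)) 0
      (Icc α β) t := by
    intro t ht
    have h1 := H.hasDerivWithinAt ht
    have h2 := H.hasDerivWithinAt_der ht
    have h3 := (hp (h t ^ 2)).comp_hasDerivWithinAt t (h1.pow 2)
    refine ((((h1.pow 4).mul (h2.pow 2)).sub h3).mul
      ((h1.pow 2).const_mul (c / 2)).exp).congr_deriv ?_
    simp only [Pi.pow_apply, Pi.mul_apply, Pi.sub_apply, Function.comp_apply]
    linear_combination Real.exp (c / 2 * h t ^ 2) * h t ^ 3 * der α β h t * H.ode t ht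
  obtain ⟨k, hk⟩ : ∃ k, ∀ t ∈ Icc α β,
      (h t ^ 4 * der α β h t ^ 2 - p (h t ^ 2)) * Real.exp (c / 2 * h t ^ 2) = k :=
    ⟨_, fun t ht ↦ H.eq_of_hasDerivWithinAt_zero hE ht⟩
  refine ⟨fun x ↦ p x + k * Real.exp (-(c / 2 * x)), fun x ↦ ?_, fun x ↦ ?_, fun t ht ↦ ?_⟩
  · simp only [p]
    fun_prop
  · have h1 := (hp x).add (((hasDerivAt_id x).const_mul (c / 2)).neg.exp.const_mul k)
    refine h1.congr_deriv ?_
    simp only [id, Pi.neg_apply]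
    ring
  · simp only [fiber]
    rw [← hk t ht, mul_assoc, ← Real.exp_add, add_neg_cancel, Real.exp_zero]
    ring

theorem der_neg {t : ℝ} (ht : t ∈ Ioo α β) : der α β h t < 0 := by
  have h1 := H.fiber_pos t ht
  have h2 := H.pos t (Ioo_subset_Icc_self ht)
  simp only [fiber] at h1
  by_contra h3
  have := mul_nonneg h2.le (not_lt.1 h3)
  linarith

theorem strictAntiOn_sq : StrictAntiOn (fun t ↦ h t ^ 2) (Icc α β) := by
  refine strictAntiOn_of_deriv_neg (convex_Icc α β) (H.smooth.continuousOn.pow 2) fun t ht ↦ ?_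
  rw [interior_Icc] at ht
  refine ((H.hasDerivAt ht).pow 2).deriv.trans_lt ?_
  have h1 := mul_pos_of_neg_of_neg (neg_neg_of_pos (H.pos t (Ioo_subset_Icc_self ht)))
    (H.der_neg ht)
  simp
  linarith

theorem sq_mem {t : ℝ} (ht : t ∈ Ioo α β) : h t ^ 2 ∈ Ioo (2 : ℝ) 6 := by
  have ht' := Ioo_subset_Icc_self ht
  have h1 := H.strictAntiOn_sq ht' (right_mem_Icc.2 H.lt.le) ht.2
  have h2 := H.strictAntiOn_sq (left_mem_Icc.2 H.lt.le) ht' ht.1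
  simp only [H.sq_left, H.sq_right] at h1 h2
  exact ⟨h1, h2⟩

theorem exists_sq_eq {x : ℝ} (hx : x ∈ Ioo (2 : ℝ) 6) : ∃ t ∈ Ioo α β, h t ^ 2 = x := by
  have := intermediate_value_Ioo' H.lt.le (H.smooth.continuousOn.pow 2)
  simp only [Pi.pow_apply, H.sq_left, H.sq_right] at this
  exact this hx

/-- The radial coordinate: `(s, t) ↦ ρ(t) s` is the holomorphic identification of `S³ × (α, β)`
with `ℂ² \ 0`. -/
theorem exists_radius : ∃ Q F ρ : ℝ → ℝ, IsProfile (-c / 2) Q F ∧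
    ContDiffOn ℝ ∞ ρ (Ioo α β) ∧ BijOn ρ (Ioo α β) (Ioi 0) ∧
    ∀ t ∈ Ioo α β, HasDerivAt ρ (-ρ t / fiber α β h t) t ∧
      F (ρ t ^ 2 / (1 + ρ t ^ 2)) = h t ^ 2 ∧ Q (h t ^ 2) = fiber α β h t ^ 2 := by
  obtain ⟨W, hWa, hWd, hWh⟩ := H.exists_momentum
  have hW2 : W 2 = 0 := by
    have := hWh β (right_mem_Icc.2 H.lt.le)
    rw [H.sq_right] at this
    simp [this, fiber, H.der_right]
  have hW6 : W 6 = 0 := by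
    have := hWh α (left_mem_Icc.2 H.lt.le)
    rw [H.sq_left] at this
    simp [this, fiber, H.der_left]
  obtain ⟨T, F, hF, hFT, hT2, hT6, hT, hTs⟩ := exists_profile hWa hWd hW2 hW6 (by
    intro x hx
    obtain ⟨t, ht, rfl⟩ := H.exists_sq_eq hx
    rw [hWh t (Ioo_subset_Icc_self ht)]
    have := H.pos t (Ioo_subset_Icc_self ht)
    have := H.fiber_pos t ht
    positivity)
  have hQ : ∀ t ∈ Ioo α β, W (h t ^ 2) / h t ^ 2 = fiber α β h t ^ 2 := by
    intro t ht
    rw [hWh t (Ioo_subset_Icc_self ht), mul_div_cancel_left₀]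
    exact pow_ne_zero 2 (H.pos t (Ioo_subset_Icc_self ht)).ne'
  let ρ : ℝ → ℝ := fun t ↦ Real.sqrt (T (h t ^ 2) / (1 - T (h t ^ 2)))
  have hTt : ∀ t ∈ Ioo α β, T (h t ^ 2) ∈ Ioo (0 : ℝ) 1 := fun t ht ↦ hT _ (H.sq_mem ht)
  have hSpos : ∀ t ∈ Ioo α β, 0 < T (h t ^ 2) / (1 - T (h t ^ 2)) := fun t ht ↦
    div_pos (hTt t ht).1 (sub_pos.2 (hTt t ht).2)
  have hρpos : ∀ t ∈ Ioo α β, 0 < ρ t := fun t ht ↦ Real.sqrt_pos.2 (hSpos t ht)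
  have hρsq : ∀ t ∈ Ioo α β, ρ t ^ 2 = T (h t ^ 2) / (1 - T (h t ^ 2)) := fun t ht ↦
    Real.sq_sqrt (hSpos t ht).le
  have hTθ : ∀ t ∈ Ioo α β, ρ t ^ 2 / (1 + ρ t ^ 2) = T (h t ^ 2) := by
    intro t ht
    have := sub_pos.2 (hTt t ht).2
    rw [hρsq t ht]
    field_simp
    ring
  have hρd : ∀ t ∈ Ioo α β, HasDerivAt ρ (-ρ t / fiber α β h t) t := by
    intro t ht
    have hx := H.sq_mem ht
    have hx' : h t ^ 2 ∈ Icc (2 : ℝ) 6 := Ioo_subset_Icc_self hx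
    have hθ := hTt t ht
    have hTd : HasDerivAt T (deriv T (h t ^ 2)) (h t ^ 2) :=
      ((hTs _ hx').differentiableAt (by simp)).hasDerivAt
    have hFd : HasDerivAt F (deriv F (T (h t ^ 2))) (T (h t ^ 2)) :=
      ((hF.contDiffAt _ (Ioo_subset_Icc_self hθ)).differentiableAt (by simp)).hasDerivAt
    have h1 : deriv F (T (h t ^ 2)) * deriv T (h t ^ 2) = 1 := by
      refine (hFd.comp _ hTd).unique ((hasDerivAt_id _).congr_of_eventuallyEq ?_)
      filter_upwards [Icc_mem_nhds hx.1 hx.2] with y hy using hFT y hy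
    have h2 := hF.euler _ (Ioo_subset_Icc_self hθ)
    simp only [hFT _ hx', hQ t ht] at h2
    have hf := H.fiber_pos t ht
    have hθ1 : 1 - T (h t ^ 2) ≠ 0 := (sub_pos.2 hθ.2).ne'
    have hTeq : deriv T (h t ^ 2) = T (h t ^ 2) * (1 - T (h t ^ 2)) / fiber α β h t ^ 2 := by
      rw [eq_div_iff (by positivity), ← h2]
      linear_combination T (h t ^ 2) * (1 - T (h t ^ 2)) * h1
    have hcomp := hTd.comp t ((H.hasDerivAt ht).pow 2)
    have hdiv := hcomp.div (hcomp.const_sub 1) hθ1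
    refine (hdiv.sqrt (hSpos t ht).ne').congr_deriv ?_
    have hρ := hρpos t ht
    change _ / (2 * ρ t) = _
    rw [hTeq]
    have hsq := hρsq t ht
    have hder : h t * der α β h t = -fiber α β h t := by simp [fiber]
    simp only [Function.comp_apply]
    rw [div_eq_div_iff (by positivity) hf.ne']
    rw [show -ρ t * (2 * ρ t) = -2 * ρ t ^ 2 by ring, hsq]
    simp only [Pi.pow_apply]
    field_simp
    norm_num
    linear_combination 2 * T (h t ^ 2) * hder
  refine ⟨_, F, ρ, hF, ?_, ⟨fun t ht ↦ hρpos t ht, ?_, ?_⟩, fun t ht ↦ ⟨hρd t ht, ?_, hQ t ht⟩⟩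
  · intro t ht
    have h1 : ContDiffAt ℝ ∞ h t := H.smooth.contDiffAt (Icc_mem_nhds ht.1 ht.2)
    have h2 : ContDiffAt ℝ ∞ (fun t ↦ T (h t ^ 2)) t :=
      (hTs _ (Ioo_subset_Icc_self (H.sq_mem ht))).comp t (h1.pow 2)
    exact ((h2.div (contDiffAt_const.sub h2) (sub_pos.2 (hTt t ht).2).ne').sqrt
      (hSpos t ht).ne').contDiffWithinAt
  · refine StrictAntiOn.injOn (strictAntiOn_of_deriv_neg (convex_Ioo α β)
      (fun t ht ↦ (hρd t ht).continuousAt.continuousWithinAt) fun t ht ↦ ?_)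
    rw [interior_Ioo] at ht
    rw [(hρd t ht).deriv]
    exact div_neg_of_neg_of_pos (neg_neg_of_pos (hρpos t ht)) (H.fiber_pos t ht)
  · intro y hy
    have hy : 0 < y := hy
    have hivt := intermediate_value_Ioo (show (2 : ℝ) ≤ 6 by norm_num)
      (fun x hx ↦ (hTs x hx).continuousAt.continuousWithinAt)
    rw [hT2, hT6] at hivt
    obtain ⟨x, hx, hxy⟩ := hivt (show y ^ 2 / (1 + y ^ 2) ∈ Ioo (0 : ℝ) 1 from
      ⟨by positivity, by rw [div_lt_one (by positivity)]; linarith⟩)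
    obtain ⟨t, ht, rfl⟩ := H.exists_sq_eq hx
    refine ⟨t, ht, ?_⟩
    simp only [ρ, hxy]
    rw [show y ^ 2 / (1 + y ^ 2) / (1 - y ^ 2 / (1 + y ^ 2)) = y ^ 2 by field_simp; simp]
    exact Real.sqrt_sq hy.le
  · rw [hTθ t ht, hFT _ (Ioo_subset_Icc_self (H.sq_mem ht))]

end IsSolution

end KoisoCao

/-! ### The metric in a chart -/

namespace KoisoCao

noncomputable section

open Filter Topology ComplexConjugate

/-- `|x|²` in the coordinates `(x, m)`. -/
def sqX (y : ℂ × ℂ) : ℝ := y.1.re ^ 2 + y.1.im ^ 2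

/-- `1 + |m|²` in the coordinates `(x, m)`. -/
def sqV (y : ℂ × ℂ) : ℝ := 1 + (y.2.re ^ 2 + y.2.im ^ 2)

/-- The differential of `|x|²`. -/
def dSqX (y v : ℂ × ℂ) : ℝ := 2 * (y.1.re * v.1.re + y.1.im * v.1.im)

/-- The differential of `1 + |m|²`. -/
def dSqV (y v : ℂ × ℂ) : ℝ := 2 * (y.2.re * v.2.re + y.2.im * v.2.im)

/-- The sign `1` around the exceptional curve and `-1` around the line at infinity. -/
def sgn (ε : Bool) : ℝ := if ε then 1 else -1

/-- `|a|²` for the homogeneous coordinates `(a, b, v)`. -/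
def sqA (ε : Bool) (y : ℂ × ℂ) : ℝ := if ε then 1 else sqX y

/-- `|b v|²` for the homogeneous coordinates `(a, b, v)`. -/
def sqB (ε : Bool) (y : ℂ × ℂ) : ℝ := if ε then sqX y * sqV y else sqV y

/-- The coordinate `|b v|² / (|a|² + |b v|²)` on the orbit space. -/
def theta (ε : Bool) (y : ℂ × ℂ) : ℝ := sqB ε y / (sqA ε y + sqB ε y)

/-- The differential of `log (|b v|² / |a|²)`. -/
def dLogR (ε : Bool) (y v : ℂ × ℂ) : ℝ := sgn ε * (dSqX y v / sqX y) + dSqV y v / sqV y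

theorem sqV_pos (y : ℂ × ℂ) : 0 < sqV y := by unfold sqV; positivity

theorem sqX_nonneg (y : ℂ × ℂ) : 0 ≤ sqX y := by unfold sqX; positivity

theorem sqX_pos {y : ℂ × ℂ} (hy : y.1 ≠ 0) : 0 < sqX y := by
  have := Complex.normSq_pos.2 hy
  rw [Complex.normSq_apply] at this
  unfold sqX
  linarith

theorem sqA_nonneg (ε : Bool) (y : ℂ × ℂ) : 0 ≤ sqA ε y := by
  cases ε <;> simp [sqA, sqX_nonneg]

theorem sqB_nonneg (ε : Bool) (y : ℂ × ℂ) : 0 ≤ sqB ε y := by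
  have := sqV_pos y
  have := sqX_nonneg y
  cases ε <;> simp only [sqB] <;> simp <;> positivity

theorem sqA_add_sqB_pos (ε : Bool) (y : ℂ × ℂ) : 0 < sqA ε y + sqB ε y := by
  have := sqV_pos y
  have := sqX_nonneg y
  cases ε <;> simp only [sqA, sqB] <;> simp <;> positivity

theorem theta_mem (ε : Bool) (y : ℂ × ℂ) : theta ε y ∈ Icc (0 : ℝ) 1 := by
  have h1 := sqA_nonneg ε y
  have h2 := sqB_nonneg ε y
  have h3 := sqA_add_sqB_pos ε y
  refine ⟨div_nonneg h2 h3.le, ?_⟩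
  rw [theta, div_le_one h3]
  linarith

theorem contDiff_sqX : ContDiff ℝ ∞ sqX := by
  have h1 : ContDiff ℝ ∞ (fun y : ℂ × ℂ ↦ y.1.re) := Complex.reCLM.contDiff.comp contDiff_fst
  have h2 : ContDiff ℝ ∞ (fun y : ℂ × ℂ ↦ y.1.im) := Complex.imCLM.contDiff.comp contDiff_fst
  exact (h1.pow 2).add (h2.pow 2)

theorem contDiff_sqV : ContDiff ℝ ∞ sqV := by
  have h1 : ContDiff ℝ ∞ (fun y : ℂ × ℂ ↦ y.2.re) := Complex.reCLM.contDiff.comp contDiff_snd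
  have h2 : ContDiff ℝ ∞ (fun y : ℂ × ℂ ↦ y.2.im) := Complex.imCLM.contDiff.comp contDiff_snd
  exact contDiff_const.add ((h1.pow 2).add (h2.pow 2))

theorem contDiff_sqA (ε : Bool) : ContDiff ℝ ∞ (sqA ε) := by
  cases ε
  · exact contDiff_sqX
  · exact (contDiff_const : ContDiff ℝ ∞ fun _ : ℂ × ℂ ↦ (1 : ℝ))

theorem contDiff_sqB (ε : Bool) : ContDiff ℝ ∞ (sqB ε) := by
  cases ε
  · exact contDiff_sqV
  · exact contDiff_sqX.mul contDiff_sqV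

theorem contDiff_theta (ε : Bool) : ContDiff ℝ ∞ (theta ε) :=
  (contDiff_sqB ε).div ((contDiff_sqA ε).add (contDiff_sqB ε)) fun y ↦ (sqA_add_sqB_pos ε y).ne'

/-! ### Derivatives along lines -/

theorem fderiv_eq_of_line {E E' : Type*} [NormedAddCommGroup E] [NormedSpace ℝ E]
    [NormedAddCommGroup E'] [NormedSpace ℝ E'] {f : E → E'} {y v : E} {d : E'}
    (hf : DifferentiableAt ℝ f y) (h : HasDerivAt (fun t : ℝ ↦ f (y + t • v)) d 0) :
    fderiv ℝ f y v = d := by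
  rw [← hf.lineDeriv_eq_fderiv]
  exact h.deriv

section Line

variable (y v : ℂ × ℂ)

theorem hasDerivAt_line (a b : ℝ) : HasDerivAt (fun t : ℝ ↦ a + t * b) b 0 := by
  simpa using ((hasDerivAt_id (0 : ℝ)).mul_const b).const_add a

theorem hasDerivAt_sqX : HasDerivAt (fun t : ℝ ↦ sqX (y + t • v)) (dSqX y v) 0 := by
  have h := ((hasDerivAt_line y.1.re v.1.re).pow 2).add ((hasDerivAt_line y.1.im v.1.im).pow 2)
  simp only [sqX, dSqX, Prod.fst_add, Prod.smul_fst, Complex.add_re, Complex.add_im,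
    Complex.real_smul, Complex.re_ofReal_mul, Complex.im_ofReal_mul]
  exact h.congr_deriv (by simp; ring)

theorem hasDerivAt_sqV : HasDerivAt (fun t : ℝ ↦ sqV (y + t • v)) (dSqV y v) 0 := by
  have h := (((hasDerivAt_line y.2.re v.2.re).pow 2).add
    ((hasDerivAt_line y.2.im v.2.im).pow 2)).const_add 1
  simp only [sqV, dSqV, Prod.snd_add, Prod.smul_snd, Complex.add_re, Complex.add_im,
    Complex.real_smul, Complex.re_ofReal_mul, Complex.im_ofReal_mul]
  exact h.congr_deriv (by simp; ring)

theorem hasDerivAt_dSqX (w : ℂ × ℂ) :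
    HasDerivAt (fun t : ℝ ↦ dSqX (y + t • w) v) (dSqX w v) 0 := by
  have h := (((hasDerivAt_line y.1.re w.1.re).mul_const v.1.re).add
    ((hasDerivAt_line y.1.im w.1.im).mul_const v.1.im)).const_mul 2
  simp only [dSqX, Prod.fst_add, Prod.smul_fst, Complex.add_re, Complex.add_im,
    Complex.real_smul, Complex.re_ofReal_mul, Complex.im_ofReal_mul]
  exact h

theorem hasDerivAt_dSqV (w : ℂ × ℂ) :
    HasDerivAt (fun t : ℝ ↦ dSqV (y + t • w) v) (dSqV w v) 0 := by
  have h := (((hasDerivAt_line y.2.re w.2.re).mul_const v.2.re).add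
    ((hasDerivAt_line y.2.im w.2.im).mul_const v.2.im)).const_mul 2
  simp only [dSqV, Prod.snd_add, Prod.smul_snd, Complex.add_re, Complex.add_im,
    Complex.real_smul, Complex.re_ofReal_mul, Complex.im_ofReal_mul]
  exact h

variable {y} in
theorem hasDerivAt_theta (ε : Bool) (hy : y.1 ≠ 0) :
    HasDerivAt (fun t : ℝ ↦ theta ε (y + t • v))
      (theta ε y * (1 - theta ε y) * dLogR ε y v) 0 := by
  have hX := hasDerivAt_sqX y v
  have hV := hasDerivAt_sqV y v
  have hX0 := sqX_pos hy
  have hV0 := sqV_pos y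
  have e0 : y + (0 : ℝ) • v = y := by simp
  cases ε
  · have hne : sqX (y + (0 : ℝ) • v) + sqV (y + (0 : ℝ) • v) ≠ 0 := by rw [e0]; positivity
    have h := hV.div (hX.add hV) hne
    simp only [theta, sqB, sqA, Bool.false_eq_true, if_false]
    refine h.congr_deriv ?_
    simp only [Pi.add_apply, e0, dLogR, sgn, Bool.false_eq_true, if_false]
    field_simp
    ring
  · have hne : 1 + sqX (y + (0 : ℝ) • v) * sqV (y + (0 : ℝ) • v) ≠ 0 := by rw [e0]; positivity
    have h := (hX.mul hV).div ((hX.mul hV).const_add 1) hne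
    simp only [theta, sqB, sqA, if_true]
    refine h.congr_deriv ?_
    simp only [Pi.mul_apply, e0, dLogR, sgn, if_true]
    field_simp

end Line

/-! ### The metric and its potential -/

section Metric

variable {κ : ℝ} {Q F : ℝ → ℝ}

/-- The square of the length of the vector `∂/∂m - (e x m̄ / (1 + |m|²)) ∂/∂x`, which is
horizontal for the projection onto `ℂP¹`. -/
def horiz (F : ℝ → ℝ) (ε : Bool) (y : ℂ × ℂ) : ℝ := F (theta ε y) / sqV y ^ 2

/-- The square of the length of `∂/∂x`, which is tangent to the fibers over `ℂP¹`. -/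
def vert (F : ℝ → ℝ) (ε : Bool) (y : ℂ × ℂ) : ℝ :=
  deriv F (theta ε y) * sqV y / (sqA ε y + sqB ε y) ^ 2

/-- The coefficient `e x m̄ / (1 + |m|²)` of the connection form. -/
def connCoeff (ε : Bool) (y : ℂ × ℂ) : ℂ := ((sgn ε / sqV y : ℝ) : ℂ) * (y.1 * conj y.2)

/-- The connection form `dx + (e x m̄ / (1 + |m|²)) dm`. -/
def connForm (ε : Bool) (y : ℂ × ℂ) : ℂ × ℂ →L[ℝ] ℂ :=
  ContinuousLinearMap.fst ℝ ℂ ℂ + connCoeff ε y • ContinuousLinearMap.snd ℝ ℂ ℂ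

/-- The invariant metric in the chart `(k, ε)`; it does not depend on `k`. -/
def chartForm (F : ℝ → ℝ) (ε : Bool) (y : ℂ × ℂ) : ℂ × ℂ →L[ℝ] ℂ × ℂ →L[ℝ] ℝ :=
  horiz F ε y • (innerSL ℝ (E := ℂ)).bilinearComp (ContinuousLinearMap.snd ℝ ℂ ℂ)
      (ContinuousLinearMap.snd ℝ ℂ ℂ)
    + vert F ε y • (innerSL ℝ (E := ℂ)).bilinearComp (connForm ε y) (connForm ε y)

theorem connForm_apply (ε : Bool) (y v : ℂ × ℂ) :
    connForm ε y v = v.1 + connCoeff ε y * v.2 := by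
  simp [connForm]

theorem chartForm_apply (ε : Bool) (y v w : ℂ × ℂ) :
    chartForm F ε y v w = horiz F ε y * (v.2.re * w.2.re + v.2.im * w.2.im)
      + vert F ε y * ((connForm ε y v).re * (connForm ε y w).re
        + (connForm ε y v).im * (connForm ε y w).im) := by
  simp [chartForm, Complex.inner]
  ring

theorem contDiffAt_deriv {θ : ℝ} (h : ContDiffAt ℝ ∞ F θ) : ContDiffAt ℝ ∞ (deriv F) θ := by
  have h1 : ContDiffAt ℝ ∞ (fderiv ℝ F) θ := h.fderiv_right (m := ∞) le_rfl
  exact h1.clm_apply contDiffAt_const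

theorem contDiff_horiz (hF : IsProfile κ Q F) (ε : Bool) : ContDiff ℝ ∞ (horiz F ε) := by
  rw [contDiff_iff_contDiffAt]
  intro y
  exact ((hF.contDiffAt _ (theta_mem ε y)).comp y (contDiff_theta ε).contDiffAt).div
    (contDiff_sqV.pow 2).contDiffAt (pow_ne_zero 2 (sqV_pos y).ne')

theorem contDiff_vert (hF : IsProfile κ Q F) (ε : Bool) : ContDiff ℝ ∞ (vert F ε) := by
  rw [contDiff_iff_contDiffAt]
  intro y
  exact (((contDiffAt_deriv (hF.contDiffAt _ (theta_mem ε y))).comp y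
    (contDiff_theta ε).contDiffAt).mul contDiff_sqV.contDiffAt).div
    (((contDiff_sqA ε).add (contDiff_sqB ε)).pow 2).contDiffAt
    (pow_ne_zero 2 (sqA_add_sqB_pos ε y).ne')

theorem horiz_pos (hF : IsProfile κ Q F) (ε : Bool) (y : ℂ × ℂ) : 0 < horiz F ε y :=
  div_pos (hF.pos _ (theta_mem ε y)) (pow_pos (sqV_pos y) 2)

theorem vert_pos (hF : IsProfile κ Q F) (ε : Bool) (y : ℂ × ℂ) : 0 < vert F ε y :=
  div_pos (mul_pos (hF.deriv_pos _ (theta_mem ε y)) (sqV_pos y))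
    (pow_pos (sqA_add_sqB_pos ε y) 2)

theorem contDiff_connForm (ε : Bool) : ContDiff ℝ ∞ (connForm ε) := by
  have h1 : ContDiff ℝ ∞ (fun y : ℂ × ℂ ↦ ((sgn ε / sqV y : ℝ) : ℂ)) :=
    Complex.ofRealCLM.contDiff.comp (contDiff_const.div contDiff_sqV fun y ↦ (sqV_pos y).ne')
  have h2 : ContDiff ℝ ∞ (fun y : ℂ × ℂ ↦ conj y.2) :=
    Complex.conjCLE.contDiff.comp contDiff_snd
  exact contDiff_const.add ((h1.mul (contDiff_fst.mul h2)).smul contDiff_const)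

theorem contDiff_chartForm (hF : IsProfile κ Q F) (ε : Bool) :
    ContDiff ℝ ∞ (chartForm F ε) := by
  have hc := contDiff_connForm ε
  have h1 : ContDiff ℝ ∞ (fun y ↦ ((innerSL ℝ (E := ℂ)).comp (connForm ε y)).flip) :=
    (ContinuousLinearMap.flipₗᵢ ℝ (ℂ × ℂ) ℂ ℝ).contDiff.comp (contDiff_const.clm_comp hc)
  have h2 : ContDiff ℝ ∞ (fun y ↦
      (((innerSL ℝ (E := ℂ)).comp (connForm ε y)).flip.comp (connForm ε y)).flip) :=
    (ContinuousLinearMap.flipₗᵢ ℝ (ℂ × ℂ) (ℂ × ℂ) ℝ).contDiff.comp (h1.clm_comp hc)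
  exact ((contDiff_horiz hF ε).smul contDiff_const).add ((contDiff_vert hF ε).smul h2)

theorem chartForm_symm (ε : Bool) (y v w : ℂ × ℂ) :
    chartForm F ε y v w = chartForm F ε y w v := by
  rw [chartForm_apply, chartForm_apply]
  ring

theorem chartForm_pos (hF : IsProfile κ Q F) (ε : Bool) (y v : ℂ × ℂ) (hv : v ≠ 0) :
    0 < chartForm F ε y v v := by
  have h1 := horiz_pos hF ε y
  have h2 := vert_pos hF ε y
  rw [chartForm_apply]
  by_cases h : v.2 = 0
  · have h3 : v.1 ≠ 0 := fun h3 ↦ hv (Prod.ext h3 h)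
    have := Complex.normSq_pos.2 h3
    rw [Complex.normSq_apply] at this
    simp only [connForm_apply, h]
    simp only [mul_zero, add_zero, Complex.zero_re, Complex.zero_im, zero_add]
    exact mul_pos h2 this
  · have := Complex.normSq_pos.2 h
    rw [Complex.normSq_apply] at this
    have h3 := mul_pos h1 this
    have h4 := mul_nonneg h2.le (add_nonneg (mul_self_nonneg (connForm ε y v).re)
      (mul_self_nonneg (connForm ε y v).im))
    linarith

theorem chartForm_isInvertible (hF : IsProfile κ Q F) (ε : Bool) (y : ℂ × ℂ) :
    (chartForm F ε y).IsInvertible :=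
  RiemCoord.isInvertible_of_pos (chartForm_pos hF ε y)

/-- Multiplication by `i` on `ℂ²`. -/
def mulI : ℂ × ℂ →L[ℝ] ℂ × ℂ := Complex.I • ContinuousLinearMap.id ℝ (ℂ × ℂ)

theorem mulI_apply (v : ℂ × ℂ) : mulI v = Complex.I • v := rfl

theorem mulI_mulI (v : ℂ × ℂ) : mulI (mulI v) = -v := by
  simp [mulI_apply, smul_smul]

theorem connForm_mulI (ε : Bool) (y v : ℂ × ℂ) :
    connForm ε y (mulI v) = Complex.I * connForm ε y v := by
  simp only [connForm_apply, mulI_apply, Prod.smul_fst, Prod.smul_snd, smul_eq_mul]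
  ring

theorem chartForm_mulI (ε : Bool) (y v w : ℂ × ℂ) :
    chartForm F ε y (mulI v) (mulI w) = chartForm F ε y v w := by
  rw [chartForm_apply, chartForm_apply, connForm_mulI, connForm_mulI]
  simp [mulI_apply]
  ring

end Metric

end

end KoisoCao

namespace KoisoCao

noncomputable section

open Filter Topology ComplexConjugate

section Potential

variable {κ : ℝ} {Q F : ℝ → ℝ}

/-- The logarithm of the determinant of the Hermitian matrix of the metric. -/
def logDet (F : ℝ → ℝ) (ε : Bool) (y : ℂ × ℂ) : ℝ :=
  Real.log (horiz F ε y) + Real.log (vert F ε y)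

/-- The soliton potential `κ h²`. -/
def solPot (κ : ℝ) (F : ℝ → ℝ) (ε : Bool) (y : ℂ × ℂ) : ℝ := κ * F (theta ε y)

/-- A Kähler potential of the metric: the soliton equation says that `logDet - solPot` is minus a
Kähler potential. -/
def kahlerPot (κ : ℝ) (F : ℝ → ℝ) (ε : Bool) (y : ℂ × ℂ) : ℝ :=
  solPot κ F ε y - logDet F ε y

theorem contDiff_logDet (hF : IsProfile κ Q F) (ε : Bool) : ContDiff ℝ ∞ (logDet F ε) :=
  ((contDiff_horiz hF ε).log fun y ↦ (horiz_pos hF ε y).ne').add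
    ((contDiff_vert hF ε).log fun y ↦ (vert_pos hF ε y).ne')

theorem contDiff_profile_theta (hF : IsProfile κ Q F) (ε : Bool) :
    ContDiff ℝ ∞ (fun y ↦ F (theta ε y)) := by
  rw [contDiff_iff_contDiffAt]
  intro y
  exact (hF.contDiffAt _ (theta_mem ε y)).comp y (contDiff_theta ε).contDiffAt

theorem contDiff_solPot (hF : IsProfile κ Q F) (ε : Bool) : ContDiff ℝ ∞ (solPot κ F ε) :=
  contDiff_const.mul (contDiff_profile_theta hF ε)

theorem contDiff_kahlerPot (hF : IsProfile κ Q F) (ε : Bool) :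
    ContDiff ℝ ∞ (kahlerPot κ F ε) :=
  (contDiff_solPot hF ε).sub (contDiff_logDet hF ε)

theorem vert_eq (hF : IsProfile κ Q F) (ε : Bool) {y : ℂ × ℂ} (hy : y.1 ≠ 0) :
    vert F ε y = Q (F (theta ε y)) / sqX y := by
  have hX0 := sqX_pos hy
  have hV0 := sqV_pos y
  rw [← hF.euler _ (theta_mem ε y), vert]
  generalize deriv F (theta ε y) = d
  cases ε
  · simp only [theta, sqA, sqB, Bool.false_eq_true, if_false]
    field_simp
    ring
  · simp only [theta, sqA, sqB, if_true]
    field_simp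
    ring

theorem profile_pos (hF : IsProfile κ Q F) (ε : Bool) {y : ℂ × ℂ} (hy : y.1 ≠ 0) :
    0 < Q (F (theta ε y)) := by
  have h := vert_pos hF ε y
  rw [vert_eq hF ε hy] at h
  exact (div_pos_iff_of_pos_right (sqX_pos hy)).1 h

theorem hasDerivAt_profile (hF : IsProfile κ Q F) (ε : Bool) {y : ℂ × ℂ} (hy : y.1 ≠ 0)
    (v : ℂ × ℂ) :
    HasDerivAt (fun t : ℝ ↦ F (theta ε (y + t • v))) (Q (F (theta ε y)) * dLogR ε y v) 0 := by
  have h1 := hasDerivAt_theta v ε hy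
  have h2 : HasDerivAt F (deriv F (theta ε y)) (theta ε (y + (0 : ℝ) • v)) := by
    simpa using ((hF.contDiffAt _ (theta_mem ε y)).differentiableAt (by simp)).hasDerivAt
  refine (h2.comp 0 h1).congr_deriv ?_
  rw [← hF.euler _ (theta_mem ε y)]
  ring

theorem eventually_fst_ne {y : ℂ × ℂ} (hy : y.1 ≠ 0) (v : ℂ × ℂ) :
    ∀ᶠ t : ℝ in 𝓝 0, (y + t • v).1 ≠ 0 := by
  have hc : ContinuousAt (fun t : ℝ ↦ (y + t • v).1) 0 := by fun_prop
  exact hc.eventually_ne (by simpa using hy)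

theorem kahlerPot_eq (hF : IsProfile κ Q F) (ε : Bool) {y : ℂ × ℂ} (hy : y.1 ≠ 0) :
    kahlerPot κ F ε y = κ * F (theta ε y) - Real.log (F (theta ε y))
      - Real.log (Q (F (theta ε y))) + 2 * Real.log (sqV y) + Real.log (sqX y) := by
  have h1 := hF.pos _ (theta_mem ε y)
  have h2 := profile_pos hF ε hy
  rw [kahlerPot, logDet, solPot, vert_eq hF ε hy, horiz, Real.log_div h1.ne'
    (pow_ne_zero 2 (sqV_pos y).ne'), Real.log_div h2.ne' (sqX_pos hy).ne', Real.log_pow]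
  push_cast
  ring

theorem fderiv_kahlerPot (hF : IsProfile κ Q F) (ε : Bool) {y : ℂ × ℂ} (hy : y.1 ≠ 0)
    (v : ℂ × ℂ) :
    fderiv ℝ (kahlerPot κ F ε) y v =
      F (theta ε y) / 2 * dLogR ε y v + (1 - 2 * sgn ε) * (dSqX y v / sqX y) := by
  refine fderiv_eq_of_line ((contDiff_kahlerPot hF ε).differentiable (by simp) y) ?_
  have e0 : y + (0 : ℝ) • v = y := by simp
  have hF0 := hF.pos _ (theta_mem ε y)
  have hQ0 := profile_pos hF ε hy
  have hX0 := sqX_pos hy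
  have hV0 := sqV_pos y
  have hd := hasDerivAt_profile hF ε hy v
  have hQ : HasDerivAt Q _ (F (theta ε (y + (0 : ℝ) • v))) := hF.ode _ (by rw [e0]; exact hF0)
  have hQd := hQ.comp 0 hd
  have h := ((((hd.const_mul κ).sub (hd.log (by rw [e0]; exact hF0.ne'))).sub
    (hQd.log (by simp only [Function.comp_apply, e0]; exact hQ0.ne'))).add
    (((hasDerivAt_sqV y v).log (by rw [e0]; exact hV0.ne')).const_mul 2)).add
    ((hasDerivAt_sqX y v).log (by rw [e0]; exact hX0.ne'))
  refine (h.congr_of_eventuallyEq ?_).congr_deriv ?_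
  · filter_upwards [eventually_fst_ne hy v] with t ht
    exact kahlerPot_eq hF ε ht
  · simp only [Function.comp_apply, e0, dLogR]
    field_simp
    ring

/-- The second derivative of `log |x|²`. -/
def hessLogX (y v w : ℂ × ℂ) : ℝ := (dSqX w v * sqX y - dSqX y v * dSqX y w) / sqX y ^ 2

/-- The second derivative of `log (1 + |m|²)`. -/
def hessLogV (y v w : ℂ × ℂ) : ℝ := (dSqV w v * sqV y - dSqV y v * dSqV y w) / sqV y ^ 2

theorem sndDeriv_kahlerPot (hF : IsProfile κ Q F) (ε : Bool) {y : ℂ × ℂ} (hy : y.1 ≠ 0)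
    (v w : ℂ × ℂ) :
    fderiv ℝ (fderiv ℝ (kahlerPot κ F ε)) y w v =
      Q (F (theta ε y)) / 2 * (dLogR ε y v * dLogR ε y w)
      + F (theta ε y) / 2 * (sgn ε * hessLogX y v w + hessLogV y v w)
      + (1 - 2 * sgn ε) * hessLogX y v w := by
  have hd2 : DifferentiableAt ℝ (fderiv ℝ (kahlerPot κ F ε)) y :=
    (RiemCoord.contDiff_fderiv_infty (contDiff_kahlerPot hF ε)).differentiable (by simp) y
  have h1 : HasFDerivAt (fun y ↦ fderiv ℝ (kahlerPot κ F ε) y v) _ y :=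
    hd2.hasFDerivAt.clm_apply (hasFDerivAt_const v y)
  have h2 : fderiv ℝ (fun y ↦ fderiv ℝ (kahlerPot κ F ε) y v) y w =
      fderiv ℝ (fderiv ℝ (kahlerPot κ F ε)) y w v := by
    rw [h1.fderiv]
    simp
  rw [← h2]
  refine fderiv_eq_of_line h1.differentiableAt ?_
  have e0 : y + (0 : ℝ) • w = y := by simp
  have hX0 := sqX_pos hy
  have hV0 := sqV_pos y
  have hlX := (hasDerivAt_dSqX y v w).div (hasDerivAt_sqX y w) (by rw [e0]; exact hX0.ne')
  have hlV := (hasDerivAt_dSqV y v w).div (hasDerivAt_sqV y w) (by rw [e0]; exact hV0.ne')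
  have h := (((hasDerivAt_profile hF ε hy w).div_const 2).mul
    ((hlX.const_mul (sgn ε)).add hlV)).add (hlX.const_mul (1 - 2 * sgn ε))
  refine (h.congr_of_eventuallyEq ?_).congr_deriv ?_
  · filter_upwards [eventually_fst_ne hy w] with t ht
    exact fderiv_kahlerPot hF ε ht v
  · simp only [e0, Pi.add_apply, Pi.div_apply, dLogR, hessLogX, hessLogV]
    ring

theorem hessLogX_mulI {y : ℂ × ℂ} (hy : y.1 ≠ 0) (v w : ℂ × ℂ) :
    hessLogX y v w + hessLogX y (mulI v) (mulI w) = 0 := by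
  have hX0 := sqX_pos hy
  simp only [hessLogX, dSqX, mulI_apply, Prod.smul_fst, smul_eq_mul, Complex.mul_re, Complex.mul_im,
    Complex.I_re, Complex.I_im]
  rw [← add_div]
  refine div_eq_zero_iff.2 (Or.inl ?_)
  simp only [sqX]
  ring

theorem hessLogV_mulI (y v w : ℂ × ℂ) :
    hessLogV y v w + hessLogV y (mulI v) (mulI w) =
      4 * (v.2.re * w.2.re + v.2.im * w.2.im) / sqV y ^ 2 := by
  simp only [hessLogV, dSqV, mulI_apply, Prod.smul_snd, smul_eq_mul, Complex.mul_re, Complex.mul_im,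
    Complex.I_re, Complex.I_im]
  rw [← add_div]
  congr 1
  simp only [sqV]
  ring

theorem sgn_mul_self (ε : Bool) : sgn ε * sgn ε = 1 := by cases ε <;> simp [sgn]

theorem connForm_re (ε : Bool) (y v : ℂ × ℂ) : (connForm ε y v).re = v.1.re + sgn ε / sqV y *
    ((y.1.re * y.2.re + y.1.im * y.2.im) * v.2.re
      - (y.1.im * y.2.re - y.1.re * y.2.im) * v.2.im) := by
  rw [connForm_apply, connCoeff]
  simp only [Complex.add_re, Complex.mul_re, Complex.mul_im, Complex.ofReal_re, Complex.ofReal_im,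
    Complex.conj_re, Complex.conj_im]
  ring

theorem connForm_im (ε : Bool) (y v : ℂ × ℂ) : (connForm ε y v).im = v.1.im + sgn ε / sqV y *
    ((y.1.re * y.2.re + y.1.im * y.2.im) * v.2.im
      + (y.1.im * y.2.re - y.1.re * y.2.im) * v.2.re) := by
  rw [connForm_apply, connCoeff]
  simp only [Complex.add_im, Complex.mul_re, Complex.mul_im, Complex.ofReal_re, Complex.ofReal_im,
    Complex.conj_re, Complex.conj_im]
  ring

/-- `∂ log (|b v|² / |a|²)` is the connection form divided by `e x`. -/
theorem dLogR_eq (ε : Bool) {y : ℂ × ℂ} (hy : y.1 ≠ 0) (v : ℂ × ℂ) :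
    dLogR ε y v = 2 * sgn ε / sqX y *
      ((connForm ε y v).re * y.1.re + (connForm ε y v).im * y.1.im) := by
  have hX0 := sqX_pos hy
  have hV0 := sqV_pos y
  have he := sgn_mul_self ε
  rw [connForm_re, connForm_im, dLogR, dSqX, dSqV]
  field_simp
  simp only [sqX]
  linear_combination (-(y.1.re ^ 2 + y.1.im ^ 2) *
    (y.2.re * v.2.re + y.2.im * v.2.im)) * he

theorem dLogR_mulI (ε : Bool) {y : ℂ × ℂ} (hy : y.1 ≠ 0) (v w : ℂ × ℂ) :
    dLogR ε y v * dLogR ε y w + dLogR ε y (mulI v) * dLogR ε y (mulI w) =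
      4 * ((connForm ε y v).re * (connForm ε y w).re
        + (connForm ε y v).im * (connForm ε y w).im) / sqX y := by
  have hX0 := sqX_pos hy
  have he := sgn_mul_self ε
  simp only [dLogR_eq ε hy, connForm_mulI, Complex.mul_re, Complex.mul_im, Complex.I_re,
    Complex.I_im]
  field_simp
  simp only [sqX]
  linear_combination (4 * (y.1.re ^ 2 + y.1.im ^ 2) * ((connForm ε y v).re * (connForm ε y w).re
        + (connForm ε y v).im * (connForm ε y w).im)) * he

theorem dense_fst_ne : Dense {y : ℂ × ℂ | y.1 ≠ 0} := by
  have : {y : ℂ × ℂ | y.1 ≠ 0} = ({0}ᶜ : Set ℂ) ×ˢ (univ : Set ℂ) := by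
    ext y
    simp
  rw [this]
  exact (dense_compl_singleton 0).prod dense_univ

/-- The metric is given by the Kähler potential. Both sides are continuous, so that it suffices to
compare them for `x ≠ 0`. -/
theorem chartForm_eq_leviForm (hF : IsProfile κ Q F) (ε : Bool) (y v w : ℂ × ℂ) :
    chartForm F ε y v w = RiemCoord.leviForm mulI (kahlerPot κ F ε) y v w := by
  have hc1 : Continuous (fun y ↦ chartForm F ε y v w) :=
    ((contDiff_chartForm hF ε).continuous.clm_apply continuous_const).clm_apply continuous_const
  have hD : Continuous (fderiv ℝ (fderiv ℝ (kahlerPot κ F ε))) :=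
    (RiemCoord.contDiff_fderiv_infty (RiemCoord.contDiff_fderiv_infty
      (contDiff_kahlerPot hF ε))).continuous
  have hc2 : Continuous (fun y ↦ RiemCoord.leviForm mulI (kahlerPot κ F ε) y v w) :=
    (((hD.clm_apply continuous_const).clm_apply continuous_const).add
      ((hD.clm_apply continuous_const).clm_apply continuous_const)).div_const 2
  refine congrFun (hc1.ext_on dense_fst_ne hc2 fun y hy ↦ ?_) y
  have hy : y.1 ≠ 0 := hy
  beta_reduce
  rw [chartForm_apply, vert_eq hF ε hy, horiz, RiemCoord.leviForm, sndDeriv_kahlerPot hF ε hy,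
    sndDeriv_kahlerPot hF ε hy]
  linear_combination (-(Q (F (theta ε y)) / 4)) * dLogR_mulI ε hy w v
    - ((F (theta ε y) / 2 * sgn ε + (1 - 2 * sgn ε)) / 2) * hessLogX_mulI hy w v
    - (F (theta ε y) / 4) * hessLogV_mulI y w v

/-- The holomorphic vector field `2 κ e x ∂/∂x`, which is the gradient of the soliton potential. -/
def solField (κ : ℝ) (ε : Bool) : ℂ × ℂ →L[ℝ] ℂ × ℂ :=
  (2 * κ * sgn ε) • (ContinuousLinearMap.inl ℝ ℂ ℂ).comp (ContinuousLinearMap.fst ℝ ℂ ℂ)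

theorem solField_apply (ε : Bool) (y : ℂ × ℂ) :
    solField κ ε y = ((2 * κ * sgn ε) • y.1, (0 : ℂ)) := by
  simp [solField]

theorem solField_mulI (ε : Bool) (v : ℂ × ℂ) :
    solField κ ε (mulI v) = mulI (solField κ ε v) := by
  simp only [solField_apply, mulI_apply, Prod.smul_fst, Prod.smul_mk, smul_zero]
  rw [smul_comm]

/-- The gradient of the soliton potential is `solField`. -/
theorem fderiv_solPot (hF : IsProfile κ Q F) (ε : Bool) (y v : ℂ × ℂ) :
    fderiv ℝ (solPot κ F ε) y v = chartForm F ε y v (solField κ ε y) := by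
  have hc1 : Continuous (fun y ↦ fderiv ℝ (solPot κ F ε) y v) :=
    (RiemCoord.contDiff_fderiv_infty (contDiff_solPot hF ε)).continuous.clm_apply continuous_const
  have hc2 : Continuous (fun y ↦ chartForm F ε y v (solField κ ε y)) :=
    ((contDiff_chartForm hF ε).continuous.clm_apply continuous_const).clm_apply
      (solField κ ε).continuous
  refine congrFun (hc1.ext_on dense_fst_ne hc2 fun y hy ↦ ?_) y
  have hy : y.1 ≠ 0 := hy
  have h1 : fderiv ℝ (solPot κ F ε) y v = κ * (Q (F (theta ε y)) * dLogR ε y v) :=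
    fderiv_eq_of_line ((contDiff_solPot hF ε).differentiable (by simp) y)
      ((hasDerivAt_profile hF ε hy v).const_mul κ)
  simp only [h1]
  have h2 : connForm ε y (solField κ ε y) = (2 * κ * sgn ε) • y.1 := by
    simp [connForm_apply, solField_apply]
  rw [chartForm_apply, h2, vert_eq hF ε hy, dLogR_eq ε hy, solField_apply]
  simp
  ring

/-! ### The trace of the connection -/

theorem trace_eq_sum_of_dual {ι E : Type*} [Fintype ι] [DecidableEq ι] [Nonempty ι]
    [AddCommGroup E] [Module ℝ E] (b : ι → E) (φ : ι → E →ₗ[ℝ] ℝ)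
    (h : ∀ i j, φ i (b j) = if i = j then 1 else 0)
    (hcard : Fintype.card ι = Module.finrank ℝ E) (T : E →ₗ[ℝ] E) :
    LinearMap.trace ℝ E T = ∑ i, φ i (T (b i)) := by
  have hli : LinearIndependent ℝ b := by
    rw [Fintype.linearIndependent_iff]
    intro g hg i
    have := congrArg (φ i) hg
    simpa [h] using this
  let B := basisOfLinearIndependentOfCardEqFinrank hli hcard
  have hB : ∀ i, B i = b i := fun i ↦ by simp [B]
  have hcoord : ∀ i v, B.repr v i = φ i v := by
    intro i v
    conv_rhs => rw [← B.sum_repr v]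
    simp [hB, h]
  rw [LinearMap.trace_eq_matrix_trace ℝ B, Matrix.trace]
  refine Finset.sum_congr rfl fun i _ ↦ ?_
  rw [Matrix.diag_apply, LinearMap.toMatrix_apply, hcoord, hB]

/-- The vectors `∂/∂x` and `∂/∂m - (e x m̄ / (1 + |m|²)) ∂/∂x` and their images under `i` form an
orthogonal basis. -/
def frame (ε : Bool) (y : ℂ × ℂ) : Fin 4 → ℂ × ℂ :=
  ![(1, 0), (Complex.I, 0), (-connCoeff ε y, 1), (-connCoeff ε y * Complex.I, Complex.I)]

theorem chartForm_frame (ε : Bool) (y : ℂ × ℂ) (i j : Fin 4) :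
    chartForm F ε y (frame ε y i) (frame ε y j) =
      if i = j then ![vert F ε y, vert F ε y, horiz F ε y, horiz F ε y] i else 0 := by
  rw [chartForm_apply]
  fin_cases i <;> fin_cases j <;> simp [frame, connForm_apply]

theorem hasFDerivAt_chartForm_frame (hF : IsProfile κ Q F) (ε : Bool) (y : ℂ × ℂ) (i : Fin 4) :
    HasFDerivAt (fun z ↦ chartForm F ε z (frame ε y i) (frame ε y i))
      (![fderiv ℝ (vert F ε) y, fderiv ℝ (vert F ε) y, fderiv ℝ (horiz F ε) y,
        fderiv ℝ (horiz F ε) y] i) y := by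
  have hv : HasFDerivAt (vert F ε) (fderiv ℝ (vert F ε) y) y :=
    ((contDiff_vert hF ε).differentiable (by simp) y).hasFDerivAt
  have hh : HasFDerivAt (horiz F ε) (fderiv ℝ (horiz F ε) y) y :=
    ((contDiff_horiz hF ε).differentiable (by simp) y).hasFDerivAt
  have key : ∀ b : ℂ × ℂ, connForm ε y b = 0 → b.2.re * b.2.re + b.2.im * b.2.im = 1 →
      HasFDerivAt (fun z ↦ chartForm F ε z b b) (fderiv ℝ (horiz F ε) y) y := by
    intro b hb hb2
    have hc : HasFDerivAt (fun z ↦ connForm ε z b) _ y :=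
      (((contDiff_connForm ε).differentiable (by simp) y).hasFDerivAt).clm_apply
        (hasFDerivAt_const b y)
    have hre : HasFDerivAt (fun z ↦ (connForm ε z b).re) _ y := Complex.reCLM.hasFDerivAt.comp y hc
    have him : HasFDerivAt (fun z ↦ (connForm ε z b).im) _ y := Complex.imCLM.hasFDerivAt.comp y hc
    have h := hh.add (hv.mul ((hre.mul hre).add (him.mul him)))
    have hfun : (fun z ↦ chartForm F ε z b b) = (horiz F ε + vert F ε *
        ((fun z ↦ (connForm ε z b).re) * (fun z ↦ (connForm ε z b).re)
          + (fun z ↦ (connForm ε z b).im) * (fun z ↦ (connForm ε z b).im))) := by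
      funext z
      rw [chartForm_apply, hb2, mul_one]
      rfl
    rw [hfun]
    refine h.congr_fderiv ?_
    simp [hb]
  fin_cases i
  · refine hv.congr_of_eventuallyEq (Eventually.of_forall fun z ↦ ?_)
    simp [chartForm_apply, frame, connForm_apply]
  · refine hv.congr_of_eventuallyEq (Eventually.of_forall fun z ↦ ?_)
    simp [chartForm_apply, frame, connForm_apply]
  · exact key _ (by simp [frame, connForm_apply]) (by simp [frame])
  · exact key _ (by simp [frame, connForm_apply]) (by simp [frame])

/-- By the Koszul formula the trace of the connection is half the derivative of the logarithm of
the real determinant. The frame is fixed, but it is orthogonal at `y` only, which is enough to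
evaluate the trace there. -/
theorem trace_christoffel (hF : IsProfile κ Q F) (ε : Bool) (y v : ℂ × ℂ) :
    LinearMap.trace ℝ (ℂ × ℂ) (RiemCoord.christoffel (chartForm F ε) y v : ℂ × ℂ →ₗ[ℝ] ℂ × ℂ) =
      fderiv ℝ (logDet F ε) y v := by
  have hd : Differentiable ℝ (chartForm F ε) :=
    (contDiff_chartForm hF ε).differentiable (by simp)
  have hv0 := (vert_pos hF ε y).ne'
  have hh0 := (horiz_pos hF ε y).ne'
  let φ : Fin 4 → ℂ × ℂ →ₗ[ℝ] ℝ := fun i ↦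
    (chartForm F ε y (frame ε y i) (frame ε y i))⁻¹ •
      (chartForm F ε y (frame ε y i) : ℂ × ℂ →ₗ[ℝ] ℝ)
  have hφ : ∀ i j, φ i (frame ε y j) = if i = j then 1 else 0 := by
    intro i j
    have e : φ i (frame ε y j) = (chartForm F ε y (frame ε y i) (frame ε y i))⁻¹ *
      chartForm F ε y (frame ε y i) (frame ε y j) := rfl
    rw [e, chartForm_frame, chartForm_frame]
    fin_cases i <;> fin_cases j <;> simp [hv0, hh0]
  rw [trace_eq_sum_of_dual (frame ε y) φ hφ (by simp [Complex.finrank_real_complex])]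
  have hsum : ∀ i, φ i ((RiemCoord.christoffel (chartForm F ε) y v : ℂ × ℂ →ₗ[ℝ] ℂ × ℂ)
      (frame ε y i)) = (chartForm F ε y (frame ε y i) (frame ε y i))⁻¹ *
      (![fderiv ℝ (vert F ε) y, fderiv ℝ (vert F ε) y, fderiv ℝ (horiz F ε) y,
        fderiv ℝ (horiz F ε) y] i v / 2) := by
    intro i
    have e : φ i ((RiemCoord.christoffel (chartForm F ε) y v : ℂ × ℂ →ₗ[ℝ] ℂ × ℂ)
      (frame ε y i)) = (chartForm F ε y (frame ε y i) (frame ε y i))⁻¹ *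
      chartForm F ε y (frame ε y i) (RiemCoord.christoffel (chartForm F ε) y v (frame ε y i)) :=
      rfl
    rw [e, chartForm_symm ε y (frame ε y i) (RiemCoord.christoffel _ _ _ _),
      RiemCoord.metric_christoffel (chartForm_isInvertible hF ε y), RiemCoord.koszul_apply,
      ← (hasFDerivAt_chartForm_frame hF ε y i).fderiv, RiemCoord.fderiv_bilin_apply (hd y)]
    ring
  have hl : HasFDerivAt (logDet F ε) _ y :=
    (((contDiff_horiz hF ε).differentiable (by simp) y).hasFDerivAt.log hh0).add
      (((contDiff_vert hF ε).differentiable (by simp) y).hasFDerivAt.log hv0)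
  rw [hl.fderiv]
  simp only [hsum, chartForm_frame, Fin.sum_univ_four]
  simp
  ring

/-! ### The soliton equation in a chart -/

theorem christoffel_chartForm_mulI (hF : IsProfile κ Q F) (ε : Bool) (y v w : ℂ × ℂ) :
    RiemCoord.christoffel (chartForm F ε) y v (mulI w) =
      mulI (RiemCoord.christoffel (chartForm F ε) y v w) :=
  RiemCoord.christoffel_J_of_potential mulI_mulI (contDiff_kahlerPot hF ε)
    ((contDiff_chartForm hF ε).differentiable (by simp)) (chartForm_isInvertible hF ε)
    (chartForm_eq_leviForm hF ε) y v w

/-- The soliton equation: `Ric = -i∂∂̄ logDet` and `∇∇ solPot = i∂∂̄ solPot` add up to the form with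
potential `solPot - logDet`, which is the metric. -/
theorem ricci_add_hessian (hF : IsProfile κ Q F) (ε : Bool) (y v w : ℂ × ℂ) :
    RiemCoord.ricci (chartForm F ε) y v w
      + RiemCoord.hessian (chartForm F ε) (solPot κ F ε) y v w = chartForm F ε y v w := by
  have hG := contDiff_chartForm hF ε
  have hi := chartForm_isInvertible hF ε
  have hK := christoffel_chartForm_mulI hF ε
  have h1 := RiemCoord.contDiff_fderiv_infty (contDiff_solPot hF ε)
  have h2 := RiemCoord.contDiff_fderiv_infty (contDiff_logDet hF ε)
  have e1 : fderiv ℝ (kahlerPot κ F ε) =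
      fderiv ℝ (solPot κ F ε) - fderiv ℝ (logDet F ε) := by
    funext z
    exact fderiv_sub ((contDiff_solPot hF ε).differentiable (by simp) z)
      ((contDiff_logDet hF ε).differentiable (by simp) z)
  have e2 : fderiv ℝ (fderiv ℝ (kahlerPot κ F ε)) y =
      fderiv ℝ (fderiv ℝ (solPot κ F ε)) y - fderiv ℝ (fderiv ℝ (logDet F ε)) y := by
    rw [e1]
    exact fderiv_sub (h1.differentiable (by simp) y) (h2.differentiable (by simp) y)
  rw [RiemCoord.ricci_eq_leviForm hG (chartForm_symm ε) hi mulI_mulI (chartForm_mulI ε) hK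
    (contDiff_logDet hF ε) (trace_christoffel hF ε),
    RiemCoord.hessian_eq_leviForm hG (chartForm_symm ε) hi mulI_mulI (chartForm_mulI ε) hK
    (contDiff_solPot hF ε) (solField_mulI ε) (fderiv_solPot hF ε),
    chartForm_eq_leviForm hF ε]
  simp only [RiemCoord.leviForm, e2, sub_apply]
  ring

end Potential

end

end KoisoCao

/-! ### The metric in homogeneous coordinates -/

namespace KoisoCao

noncomputable section

open Filter Topology ComplexConjugate

/-- Homogeneous coordinates `(a, b, v)` of the point `([a : b v], [v])`. -/
abbrev HC : Type := ℂ × ℂ × (Fin 2 → ℂ)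

/-- The square of the norm of `v ∈ ℂ²`. -/
def sqNorm (v : Fin 2 → ℂ) : ℝ := Complex.normSq (v 0) + Complex.normSq (v 1)

/-- The Hermitian product on `ℂ²`. -/
def herm (v w : Fin 2 → ℂ) : ℂ := v 0 * conj (w 0) + v 1 * conj (w 1)

/-- The area form of `ℂ²`. -/
def area (v w : Fin 2 → ℂ) : ℂ := v 0 * w 1 - v 1 * w 0

/-- `|a|² + |b v|²`. -/
def homSq (P : HC) : ℝ := Complex.normSq P.1 + Complex.normSq P.2.1 * sqNorm P.2.2

/-- The coordinate `|b v|² / (|a|² + |b v|²)` on the orbit space. -/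
def homTheta (P : HC) : ℝ := Complex.normSq P.2.1 * sqNorm P.2.2 / homSq P

/-- The form `a b ∂ log (|b v|² / |a|²)`. -/
def homConn (P V : HC) : ℂ :=
  P.1 * V.2.1 - P.2.1 * V.1 + P.1 * P.2.1 * herm V.2.2 P.2.2 / (sqNorm P.2.2 : ℂ)

/-- The invariant metric, pulled back to homogeneous coordinates. -/
def homForm (F : ℝ → ℝ) (P V W : HC) : ℝ :=
  F (homTheta P) / sqNorm P.2.2 ^ 2 * ((area P.2.2 V.2.2).re * (area P.2.2 W.2.2).re
      + (area P.2.2 V.2.2).im * (area P.2.2 W.2.2).im)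
    + deriv F (homTheta P) * sqNorm P.2.2 / homSq P ^ 2 *
      ((homConn P V).re * (homConn P W).re + (homConn P V).im * (homConn P W).im)

/-- The coordinates of the chart `(k, ε)` in terms of homogeneous coordinates. -/
def homCoord (k : Fin 2) (ε : Bool) (P : HC) : ℂ × ℂ :=
  (if ε then P.2.1 * P.2.2 k / P.1 else P.1 / (P.2.1 * P.2.2 k), P.2.2 (k + 1) / P.2.2 k)

/-- The domain of the chart `(k, ε)` in terms of homogeneous coordinates. -/
def homDom (k : Fin 2) (ε : Bool) (P : HC) : Prop :=
  P.2.2 k ≠ 0 ∧ if ε then P.1 ≠ 0 else P.2.1 ≠ 0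

/-- The differential of `homCoord k ε`. -/
def dHomCoord (k : Fin 2) (ε : Bool) (P V : HC) : ℂ × ℂ :=
  (if ε then ((V.2.1 * P.2.2 k + P.2.1 * V.2.2 k) * P.1 - P.2.1 * P.2.2 k * V.1) / P.1 ^ 2
    else (V.1 * (P.2.1 * P.2.2 k) - P.1 * (V.2.1 * P.2.2 k + P.2.1 * V.2.2 k))
      / (P.2.1 * P.2.2 k) ^ 2,
    (V.2.2 (k + 1) * P.2.2 k - P.2.2 (k + 1) * V.2.2 k) / P.2.2 k ^ 2)

theorem sqNorm_eq (k : Fin 2) (v : Fin 2 → ℂ) :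
    sqNorm v = Complex.normSq (v k) + Complex.normSq (v (k + 1)) := by
  fin_cases k
  · rfl
  · exact add_comm _ _

theorem herm_eq (k : Fin 2) (v w : Fin 2 → ℂ) :
    herm v w = v k * conj (w k) + v (k + 1) * conj (w (k + 1)) := by
  fin_cases k
  · rfl
  · exact add_comm _ _

theorem area_eq (k : Fin 2) (v w : Fin 2 → ℂ) :
    area v w = (if k = 0 then 1 else -1) * (v k * w (k + 1) - v (k + 1) * w k) := by
  fin_cases k
  · simp [area]
  · simp [area]

theorem dot_mul (c z w : ℂ) : (c * z).re * (c * w).re + (c * z).im * (c * w).im =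
    Complex.normSq c * (z.re * w.re + z.im * w.im) := by
  simp only [Complex.mul_re, Complex.mul_im, Complex.normSq_apply]
  ring

theorem sqX_eq (y : ℂ × ℂ) : sqX y = Complex.normSq y.1 := by
  simp [sqX, Complex.normSq_apply, sq]

theorem sqV_eq (y : ℂ × ℂ) : sqV y = 1 + Complex.normSq y.2 := by
  simp [sqV, Complex.normSq_apply, sq]

theorem sqNorm_pos {v : Fin 2 → ℂ} {k : Fin 2} (hv : v k ≠ 0) : 0 < sqNorm v := by
  rw [sqNorm_eq k]
  exact add_pos_of_pos_of_nonneg (Complex.normSq_pos.2 hv) (Complex.normSq_nonneg _)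

section Reduction

variable {k : Fin 2} {ε : Bool} {P : HC}

theorem homSq_pos (hP : homDom k ε P) : 0 < homSq P := by
  have h1 := sqNorm_pos hP.1
  have h2 := hP.2
  cases ε
  · have := Complex.normSq_pos.2 (show P.2.1 ≠ 0 by simpa using h2)
    have := Complex.normSq_nonneg P.1
    unfold homSq
    positivity
  · have := Complex.normSq_pos.2 (show P.1 ≠ 0 by simpa using h2)
    have := Complex.normSq_nonneg P.2.1
    unfold homSq
    positivity

theorem sqV_homCoord (hP : homDom k ε P) :
    sqV (homCoord k ε P) = sqNorm P.2.2 / Complex.normSq (P.2.2 k) := by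
  have := Complex.normSq_pos.2 hP.1
  rw [sqV_eq, sqNorm_eq k, homCoord, Complex.normSq_div]
  field_simp

theorem sqA_add_sqB_homCoord (hP : homDom k ε P) :
    sqA ε (homCoord k ε P) + sqB ε (homCoord k ε P) =
      homSq P / (if ε then Complex.normSq P.1 else Complex.normSq (P.2.1 * P.2.2 k)) := by
  have h0 := Complex.normSq_pos.2 hP.1
  have h2 := hP.2
  cases ε
  · have := Complex.normSq_pos.2 (show P.2.1 ≠ 0 by simpa using h2)
    simp only [sqA, sqB, sqV_homCoord hP, Bool.false_eq_true, if_false]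
    simp only [sqX_eq, homCoord, Bool.false_eq_true, if_false, Complex.normSq_div,
      Complex.normSq_mul, homSq]
    field_simp
  · have := Complex.normSq_pos.2 (show P.1 ≠ 0 by simpa using h2)
    simp only [sqA, sqB, sqV_homCoord hP, if_true]
    simp only [sqX_eq, homCoord, if_true, Complex.normSq_div, Complex.normSq_mul, homSq]
    field_simp

theorem theta_homCoord (hP : homDom k ε P) : theta ε (homCoord k ε P) = homTheta P := by
  have h0 := Complex.normSq_pos.2 hP.1
  have h2 := hP.2
  have h3 := homSq_pos hP
  rw [theta, sqA_add_sqB_homCoord hP, homTheta]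
  cases ε
  · have := Complex.normSq_pos.2 (show P.2.1 ≠ 0 by simpa using h2)
    simp only [sqB, sqV_homCoord hP, Bool.false_eq_true, if_false, Complex.normSq_mul]
    field_simp
  · have := Complex.normSq_pos.2 (show P.1 ≠ 0 by simpa using h2)
    simp only [sqB, sqV_homCoord hP, if_true]
    simp only [sqX_eq, homCoord, if_true, Complex.normSq_div, Complex.normSq_mul]
    field_simp

theorem dHomCoord_snd (V : HC) :
    (dHomCoord k ε P V).2 =
      ((if k = 0 then 1 else -1) / P.2.2 k ^ 2) * area P.2.2 V.2.2 := by
  rw [area_eq k]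
  have : (if k = 0 then (1 : ℂ) else -1) * (if k = 0 then 1 else -1) = 1 := by
    split_ifs <;> norm_num
  simp only [dHomCoord]
  linear_combination (-(V.2.2 (k + 1) * P.2.2 k - P.2.2 (k + 1) * V.2.2 k) / P.2.2 k ^ 2) * this

theorem connForm_homCoord (hP : homDom k ε P) (V : HC) :
    connForm ε (homCoord k ε P) (dHomCoord k ε P V) =
      (if ε then P.2.2 k / P.1 ^ 2 else -1 / (P.2.1 ^ 2 * P.2.2 k)) * homConn P V := by
  have hk := hP.1
  have hk' : conj (P.2.2 k) ≠ 0 := by simpa using hk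
  have hN : (sqNorm P.2.2 : ℂ) ≠ 0 := by exact_mod_cast (sqNorm_pos hk).ne'
  have hS : (sqNorm P.2.2 : ℂ) = P.2.2 k * conj (P.2.2 k)
      + P.2.2 (k + 1) * conj (P.2.2 (k + 1)) := by
    rw [sqNorm_eq k, Complex.mul_conj, Complex.mul_conj]
    push_cast
    rfl
  have hq : (Complex.normSq (P.2.2 k) : ℂ) = P.2.2 k * conj (P.2.2 k) := (Complex.mul_conj _).symm
  rw [connForm_apply, connCoeff, sqV_homCoord hP, homConn, herm_eq k]
  push_cast
  rw [hq]
  have h2 := hP.2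
  cases ε
  · have hb : P.2.1 ≠ 0 := by simpa using h2
    simp only [homCoord, dHomCoord, sgn, Bool.false_eq_true, if_false, map_div₀]
    push_cast
    field_simp
    rw [hS]
    ring
  · have ha : P.1 ≠ 0 := by simpa using h2
    simp only [homCoord, dHomCoord, sgn, if_true, map_div₀]
    push_cast
    field_simp
    rw [hS]
    ring

/-- In homogeneous coordinates the metric does not depend on the chart. -/
theorem chartForm_homCoord (F : ℝ → ℝ) (hP : homDom k ε P) (V W : HC) :
    chartForm F ε (homCoord k ε P) (dHomCoord k ε P V) (dHomCoord k ε P W) =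
      homForm F P V W := by
  have h0 := Complex.normSq_pos.2 hP.1
  have hN := sqNorm_pos hP.1
  have hS := homSq_pos hP
  have h2 := hP.2
  have hs : Complex.normSq (if k = 0 then 1 else -1) = 1 := by split_ifs <;> simp
  rw [chartForm_apply, horiz, vert, theta_homCoord hP, sqV_homCoord hP, sqA_add_sqB_homCoord hP,
    connForm_homCoord hP, connForm_homCoord hP, dot_mul, dHomCoord_snd, dHomCoord_snd, dot_mul,
    homForm]
  simp only [Complex.normSq_div, map_pow, hs]
  congr 1
  · field_simp
  · cases ε
    · have := Complex.normSq_pos.2 (show P.2.1 ≠ 0 by simpa using h2)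
      simp only [Bool.false_eq_true, if_false, Complex.normSq_div, Complex.normSq_mul, map_pow,
        Complex.normSq_neg, Complex.normSq_one]
      field_simp
    · have := Complex.normSq_pos.2 (show P.1 ≠ 0 by simpa using h2)
      simp only [if_true, Complex.normSq_div, map_pow]
      field_simp

end Reduction

/-! ### Invariance under `U(2)` -/

/-- The action of a matrix on homogeneous coordinates. -/
def homAct (A : Matrix (Fin 2) (Fin 2) ℂ) (P : HC) : HC := (P.1, P.2.1, A *ᵥ P.2.2)

theorem herm_mulVec (A : Matrix.unitaryGroup (Fin 2) ℂ) (v w : Fin 2 → ℂ) :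
    herm ((A : Matrix (Fin 2) (Fin 2) ℂ) *ᵥ v) ((A : Matrix (Fin 2) (Fin 2) ℂ) *ᵥ w) =
      herm v w := by
  have h : ∀ v w : Fin 2 → ℂ, herm v w = star w ⬝ᵥ v := by
    intro v w
    simp [herm, dotProduct, Fin.sum_univ_two, mul_comm]
  rw [h, h, Matrix.star_mulVec, ← Matrix.dotProduct_mulVec, Matrix.mulVec_mulVec,
    ← Matrix.star_eq_conjTranspose, Matrix.mem_unitaryGroup_iff'.1 A.2, Matrix.one_mulVec]

theorem sqNorm_eq_herm (v : Fin 2 → ℂ) : (sqNorm v : ℂ) = herm v v := by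
  simp [sqNorm, herm, Complex.mul_conj]

theorem sqNorm_mulVec (A : Matrix.unitaryGroup (Fin 2) ℂ) (v : Fin 2 → ℂ) :
    sqNorm ((A : Matrix (Fin 2) (Fin 2) ℂ) *ᵥ v) = sqNorm v := by
  have := herm_mulVec A v v
  rw [← sqNorm_eq_herm, ← sqNorm_eq_herm] at this
  exact_mod_cast this

theorem area_mulVec (A : Matrix (Fin 2) (Fin 2) ℂ) (v w : Fin 2 → ℂ) :
    area (A *ᵥ v) (A *ᵥ w) = A.det * area v w := by
  simp only [area, Matrix.mulVec, dotProduct, Fin.sum_univ_two, Matrix.det_fin_two]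
  ring

theorem normSq_det (A : Matrix.unitaryGroup (Fin 2) ℂ) :
    Complex.normSq (A : Matrix (Fin 2) (Fin 2) ℂ).det = 1 := by
  have h := congrArg Matrix.det (Matrix.mem_unitaryGroup_iff'.1 A.2)
  rw [Matrix.det_mul, Matrix.star_eq_conjTranspose, Matrix.det_conjTranspose, Matrix.det_one] at h
  have h' : (Complex.normSq (A : Matrix (Fin 2) (Fin 2) ℂ).det : ℂ) = 1 := by
    rw [Complex.normSq_eq_conj_mul_self]
    exact h
  exact_mod_cast h'

theorem homForm_homAct (F : ℝ → ℝ) (A : Matrix.unitaryGroup (Fin 2) ℂ) (P V W : HC) :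
    homForm F (homAct A P) (homAct A V) (homAct A W) = homForm F P V W := by
  have h1 : homSq (homAct A P) = homSq P := by
    simp only [homSq, homAct, sqNorm_mulVec]
  have h2 : homTheta (homAct A P) = homTheta P := by
    rw [homTheta, homTheta, h1]
    simp only [homAct, sqNorm_mulVec]
  have h3 : ∀ V, homConn (homAct A P) (homAct A V) = homConn P V := by
    intro V
    simp only [homConn, homAct, sqNorm_mulVec, herm_mulVec]
  rw [homForm, homForm, h1, h2, h3, h3]
  simp only [homAct, sqNorm_mulVec, area_mulVec, dot_mul, normSq_det, one_mul]

end

end KoisoCao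

/-! ### Maps into `ℂP² # -ℂP²` given by homogeneous coordinates -/

namespace KoisoCao

noncomputable section

open Filter Topology ComplexConjugate

/-- `P` are homogeneous coordinates of the point `p`. -/
def IsLift (P : HC) (p : CP2Sharp) : Prop :=
  ∃ (hab : (P.1, P.2.1) ≠ (0 : ℂ × ℂ)) (hv : P.2.2 ≠ 0),
    p = CP2Sharp.mk P.1 P.2.1 P.2.2 hab hv

theorem IsLift.coord_eq {P : HC} {p : CP2Sharp} (h : IsLift P p) (k : Fin 2) (ε : Bool) :
    CP2Sharp.coord k ε p = homCoord k ε P := by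
  obtain ⟨hab, hv, rfl⟩ := h
  obtain ⟨c, hc, h1⟩ := CP2Sharp.mk_line_rep hab hv
  obtain ⟨d, hd, h2⟩ := CP2Sharp.mk_dir_rep hab hv
  cases ε <;>
    simp [CP2Sharp.coord, homCoord, h1, h2, mul_assoc, mul_div_mul_left _ _ hc,
      mul_div_mul_left _ _ hd]

theorem IsLift.mem_dom_iff {P : HC} {p : CP2Sharp} (h : IsLift P p) (k : Fin 2) (ε : Bool) :
    p ∈ CP2Sharp.dom k ε ↔ homDom k ε P := by
  obtain ⟨hab, hv, rfl⟩ := h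
  obtain ⟨c, hc, h1⟩ := CP2Sharp.mk_line_rep hab hv
  obtain ⟨d, hd, h2⟩ := CP2Sharp.mk_dir_rep hab hv
  cases ε
  · simp only [CP2Sharp.dom, homDom, h1, h2, mem_ofPred_eq, Bool.false_eq_true, if_false,
      Pi.smul_apply, smul_eq_mul, mul_ne_zero_iff]
    tauto
  · simp [CP2Sharp.dom, homDom, h1, h2, hc, hd]

/-- Homogeneous coordinates of the point with the coordinates `y` in the chart `(k, ε)`. -/
def lift (k : Fin 2) (ε : Bool) (y : ℂ × ℂ) : HC :=
  ((CP2Sharp.hom ε y.1).1, (CP2Sharp.hom ε y.1).2, CP2Sharp.vec k y.2)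

theorem isLift_lift (k : Fin 2) (ε : Bool) (y : ℂ × ℂ) :
    IsLift (lift k ε y) (CP2Sharp.param k ε y) :=
  ⟨CP2Sharp.hom_ne_zero ε y.1, CP2Sharp.vec_ne_zero k y.2, rfl⟩

theorem isLift_coord {k : Fin 2} {ε : Bool} {p : CP2Sharp} (hp : p ∈ CP2Sharp.dom k ε) :
    IsLift (lift k ε (CP2Sharp.coord k ε p)) p := by
  have h := isLift_lift k ε (CP2Sharp.coord k ε p)
  rwa [CP2Sharp.param_coord k ε p hp] at h

theorem homDom_lift (k : Fin 2) (ε : Bool) (y : ℂ × ℂ) : homDom k ε (lift k ε y) := by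
  cases ε <;> simp [homDom, lift, CP2Sharp.hom, CP2Sharp.vec_self]

theorem homCoord_lift (k : Fin 2) (ε : Bool) (y : ℂ × ℂ) : homCoord k ε (lift k ε y) = y := by
  cases ε <;> simp [homCoord, lift, CP2Sharp.hom, CP2Sharp.vec_self, CP2Sharp.vec_other]

theorem contDiff_lift (k : Fin 2) (ε : Bool) : ContDiff ℝ ∞ (lift k ε) := by
  have h1 : ContDiff ℝ ∞ (fun y : ℂ × ℂ ↦ CP2Sharp.hom ε y.1) :=
    ((CP2Sharp.contDiff_hom ε).restrict_scalars ℝ).of_le le_top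
  have h2 : ContDiff ℝ ∞ (fun y : ℂ × ℂ ↦ CP2Sharp.vec k y.2) :=
    contDiff_pi.2 fun j ↦ ((CP2Sharp.contDiff_vec k j).restrict_scalars ℝ).of_le le_top
  exact h1.fst.prodMk (h1.snd.prodMk h2)

theorem IsLift.act {P : HC} {p : CP2Sharp} (h : IsLift P p) (A : Matrix.unitaryGroup (Fin 2) ℂ) :
    IsLift (homAct A P) (CP2Sharp.act A p) := by
  obtain ⟨hab, hv, rfl⟩ := h
  have hv' : (A : Matrix (Fin 2) (Fin 2) ℂ) *ᵥ P.2.2 ≠ 0 := fun h0 ↦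
    hv (CP2Sharp.unitary_injective A (by simpa using h0))
  refine ⟨hab, hv', Subtype.ext (Prod.ext ?_ ?_)⟩
  · simp only [CP2Sharp.act, CP2Sharp.mk, CP2Sharp.line, homAct, Projectivization.map_mk]
    congr 1
    simp
  · simp only [CP2Sharp.act, CP2Sharp.mk, CP2Sharp.dir, homAct, Projectivization.map_mk]
    rfl

/-! ### The derivative of the coordinates -/

theorem isOpen_homDom (k : Fin 2) (ε : Bool) : IsOpen {P : HC | homDom k ε P} := by
  have h1 : Continuous (fun P : HC ↦ P.2.2 k) := by fun_prop
  cases ε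
  · simp only [homDom, Bool.false_eq_true, if_false]
    exact (isOpen_ne_fun h1 continuous_const).inter
      (isOpen_ne_fun (by fun_prop) continuous_const)
  · simp only [homDom, if_true]
    exact (isOpen_ne_fun h1 continuous_const).inter
      (isOpen_ne_fun (by fun_prop) continuous_const)

theorem contDiffAt_homCoord {k : Fin 2} {ε : Bool} {P : HC} (hP : homDom k ε P) :
    ContDiffAt ℝ ∞ (homCoord k ε) P := by
  have h1 : ∀ j, ContDiffAt ℝ ∞ (fun P : HC ↦ P.2.2 j) P := fun j ↦ by fun_prop
  have ha : ContDiffAt ℝ ∞ (fun P : HC ↦ P.1) P := by fun_prop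
  have hb : ContDiffAt ℝ ∞ (fun P : HC ↦ P.2.1) P := by fun_prop
  refine ContDiffAt.prodMk ?_ ((h1 _).mul ((h1 _).inv hP.1))
  have h2 := hP.2
  cases ε
  · simp only [Bool.false_eq_true, if_false] at h2 ⊢
    exact ha.mul ((hb.mul (h1 _)).inv (mul_ne_zero h2 hP.1))
  · simp only [if_true] at h2 ⊢
    exact (hb.mul (h1 _)).mul (ha.inv h2)

theorem fderiv_homCoord {k : Fin 2} {ε : Bool} {P : HC} (hP : homDom k ε P) (V : HC) :
    fderiv ℝ (homCoord k ε) P V = dHomCoord k ε P V := by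
  refine fderiv_eq_of_line ((contDiffAt_homCoord hP).differentiableAt (by simp)) ?_
  have hl : ∀ a b : ℂ, HasDerivAt (fun t : ℝ ↦ a + t • b) b 0 := fun a b ↦ by
    simpa using ((hasDerivAt_id (0 : ℝ)).smul_const b).const_add a
  have ha := hl P.1 V.1
  have hb := hl P.2.1 V.2.1
  have hv := fun j ↦ hl (P.2.2 j) (V.2.2 j)
  have h2 := hP.2
  refine HasDerivAt.prodMk ?_ ?_
  · cases ε
    · simp only [Bool.false_eq_true, if_false] at h2 ⊢
      exact (ha.div (hb.mul (hv k)) (by simpa using ⟨h2, hP.1⟩)).congr_deriv (by simp)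
    · simp only [if_true] at h2 ⊢
      exact ((hb.mul (hv k)).div ha (by simpa using h2)).congr_deriv (by simp)
  · exact ((hv (k + 1)).div (hv k) (by simpa using hP.1)).congr_deriv (by simp)

/-! ### Maps given by homogeneous coordinates -/

theorem chartAt_eq (p : CP2Sharp) : ⇑(chartAt (ℂ × ℂ) p) = CP2Sharp.coord p.idx p.side := rfl

theorem chartAt_symm_eq (p : CP2Sharp) :
    ⇑(chartAt (ℂ × ℂ) p).symm = CP2Sharp.param p.idx p.side := rfl

theorem chartAt_target (p : CP2Sharp) : (chartAt (ℂ × ℂ) p).target = univ := rfl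

section Maps

variable {EN : Type*} [NormedAddCommGroup EN] [NormedSpace ℝ EN] {HN : Type*} [TopologicalSpace HN]
  {I : ModelWithCorners ℝ EN HN} {N : Type*} [TopologicalSpace N] [ChartedSpace HN N]
  {Φ : N → CP2Sharp} {P : N → HC} {q : N}

theorem eventuallyEq_chart_symm (hP : ContinuousAt P q)
    (hΦ : ∀ᶠ q' in 𝓝 q, IsLift (P q') (Φ q')) :
    Φ =ᶠ[𝓝 q] (chartAt (ℂ × ℂ) (Φ q)).symm ∘ homCoord (Φ q).idx (Φ q).side ∘ P := by
  have hd : homDom (Φ q).idx (Φ q).side (P q) :=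
    (hΦ.self_of_nhds.mem_dom_iff _ _).1 (Φ q).mem_dom
  filter_upwards [hΦ, hP.eventually_mem ((isOpen_homDom _ _).mem_nhds hd)] with q' h1 h2
  simp only [Function.comp_apply, chartAt_symm_eq]
  rw [← h1.coord_eq, CP2Sharp.param_coord _ _ _ ((h1.mem_dom_iff _ _).2 h2)]

theorem contMDiffAt_of_isLift (hP : ContMDiffAt I 𝓘(ℝ, HC) ∞ P q)
    (hΦ : ∀ᶠ q' in 𝓝 q, IsLift (P q') (Φ q')) : ContMDiffAt I 𝓘(ℝ, ℂ × ℂ) ∞ Φ q := by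
  have hd : homDom (Φ q).idx (Φ q).side (P q) :=
    (hΦ.self_of_nhds.mem_dom_iff _ _).1 (Φ q).mem_dom
  refine ContMDiffAt.congr_of_eventuallyEq ?_ (eventuallyEq_chart_symm hP.continuousAt hΦ)
  refine ContMDiffAt.comp q ?_ ((contDiffAt_homCoord hd).contMDiffAt.comp q hP)
  exact contMDiffOn_chart_symm.contMDiffAt ((chartAt (ℂ × ℂ) (Φ q)).open_target.mem_nhds
    (by rw [chartAt_target]; trivial))

theorem hasMFDerivAt_of_chartAt {f : N → CP2Sharp} {D : TangentSpace I q →L[ℝ] ℂ × ℂ}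
    (hf : ContinuousAt f q)
    (h : HasMFDerivAt I 𝓘(ℝ, ℂ × ℂ) (chartAt (ℂ × ℂ) (f q) ∘ f) q D) :
    HasMFDerivAt I 𝓘(ℝ, ℂ × ℂ) f q D := ⟨hf, h.2⟩

/-- The derivative of a map given by homogeneous coordinates `P`; the tangent space of
`ℂP² # -ℂP²` at `Φ q` is identified with `ℂ × ℂ` by the preferred chart. -/
theorem hasMFDerivAt_of_isLift {P' : TangentSpace I q →L[ℝ] HC}
    (hP : HasMFDerivAt I 𝓘(ℝ, HC) P q P') (hΦ : ∀ᶠ q' in 𝓝 q, IsLift (P q') (Φ q')) :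
    HasMFDerivAt I 𝓘(ℝ, ℂ × ℂ) Φ q
      ((fderiv ℝ (homCoord (Φ q).idx (Φ q).side) (P q)).comp P') := by
  have hd : homDom (Φ q).idx (Φ q).side (P q) :=
    (hΦ.self_of_nhds.mem_dom_iff _ _).1 (Φ q).mem_dom
  have hcoord := ((contDiffAt_homCoord hd).differentiableAt (by simp)).hasFDerivAt
  have hcomp : HasMFDerivAt I 𝓘(ℝ, ℂ × ℂ) (homCoord (Φ q).idx (Φ q).side ∘ P) q
      ((fderiv ℝ (homCoord (Φ q).idx (Φ q).side) (P q)).comp P') :=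
    hcoord.hasMFDerivAt.comp q hP
  refine hasMFDerivAt_of_chartAt ?_ (hcomp.congr_of_eventuallyEq ?_)
  · refine ContinuousAt.congr ?_ (eventuallyEq_chart_symm hP.1 hΦ).symm
    refine ContinuousAt.comp ?_ hcomp.1
    exact (chartAt (ℂ × ℂ) (Φ q)).symm.continuousAt (by
      rw [OpenPartialHomeomorph.symm_source, chartAt_target]; trivial)
  · filter_upwards [hΦ] with q' h1
    simp only [Function.comp_apply, chartAt_eq]
    exact h1.coord_eq _ _

end Maps

theorem hasMFDerivAt_chartAt (p : CP2Sharp) :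
    HasMFDerivAt 𝓘(ℝ, ℂ × ℂ) 𝓘(ℝ, ℂ × ℂ) (chartAt (ℂ × ℂ) p) p
      (ContinuousLinearMap.id ℝ (ℂ × ℂ)) :=
  ⟨(chartAt (ℂ × ℂ) p).continuousAt (mem_chart_source _ p),
    (hasMFDerivAt_id (I := 𝓘(ℝ, ℂ × ℂ)) p).2⟩

end

end KoisoCao

/-! ### The metric on `ℂP² # -ℂP²` -/

namespace KoisoCao

noncomputable section

open Filter Topology ComplexConjugate

/-- The inner product at `p`, given by `chartForm` in the preferred chart at `p`. -/
def innerForm (F : ℝ → ℝ) (p : CP2Sharp) :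
    TangentSpace 𝓘(ℝ, ℂ × ℂ) p →L[ℝ] TangentSpace 𝓘(ℝ, ℂ × ℂ) p →L[ℝ] ℝ :=
  (chartForm F p.side (CP2Sharp.coord p.idx p.side p) : ℂ × ℂ →L[ℝ] ℂ × ℂ →L[ℝ] ℝ)

/-- The metric may be evaluated in any homogeneous coordinates of a map `Φ`. -/
theorem innerForm_mfderiv {EN : Type*} [NormedAddCommGroup EN] [NormedSpace ℝ EN] {HN : Type*}
    [TopologicalSpace HN] {I : ModelWithCorners ℝ EN HN} {N : Type*} [TopologicalSpace N]
    [ChartedSpace HN N] {Φ : N → CP2Sharp} {P : N → HC} {q : N} (F : ℝ → ℝ)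
    {P' : TangentSpace I q →L[ℝ] HC} (hP : HasMFDerivAt I 𝓘(ℝ, HC) P q P')
    (hΦ : ∀ᶠ q' in 𝓝 q, IsLift (P q') (Φ q')) (ξ η : TangentSpace I q) :
    innerForm F (Φ q) (mfderiv I 𝓘(ℝ, ℂ × ℂ) Φ q ξ) (mfderiv I 𝓘(ℝ, ℂ × ℂ) Φ q η) =
      homForm F (P q) (P' ξ) (P' η) := by
  have hd : homDom (Φ q).idx (Φ q).side (P q) :=
    (hΦ.self_of_nhds.mem_dom_iff _ _).1 (Φ q).mem_dom
  rw [(hasMFDerivAt_of_isLift hP hΦ).mfderiv, ← chartForm_homCoord F hd,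
    ← fderiv_homCoord hd, ← fderiv_homCoord hd, ← hΦ.self_of_nhds.coord_eq]
  rfl

theorem homForm_lift (F : ℝ → ℝ) (k : Fin 2) (ε : Bool) (y v w : ℂ × ℂ) :
    homForm F (lift k ε y) (fderiv ℝ (lift k ε) y v) (fderiv ℝ (lift k ε) y w) =
      chartForm F ε y v w := by
  have hd := homDom_lift k ε y
  have hl : DifferentiableAt ℝ (lift k ε) y := (contDiff_lift k ε).differentiable (by simp) y
  have hc : DifferentiableAt ℝ (homCoord k ε) (lift k ε y) :=
    (contDiffAt_homCoord hd).differentiableAt (by simp)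
  have hid : ∀ v, fderiv ℝ (homCoord k ε) (lift k ε y) (fderiv ℝ (lift k ε) y v) = v := by
    intro v
    have h1 := hc.hasFDerivAt.comp y hl.hasFDerivAt
    have h2 : homCoord k ε ∘ lift k ε = id := funext (homCoord_lift k ε)
    rw [h2] at h1
    exact DFunLike.congr_fun (h1.unique (hasFDerivAt_id y)) v
  rw [← chartForm_homCoord F hd, ← fderiv_homCoord hd, ← fderiv_homCoord hd, hid, hid,
    homCoord_lift]

theorem innerForm_param (F : ℝ → ℝ) (k : Fin 2) (ε : Bool) (y v w : ℂ × ℂ) :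
    innerForm F (CP2Sharp.param k ε y)
      (mfderiv 𝓘(ℝ, ℂ × ℂ) 𝓘(ℝ, ℂ × ℂ) (CP2Sharp.param k ε) y v)
      (mfderiv 𝓘(ℝ, ℂ × ℂ) 𝓘(ℝ, ℂ × ℂ) (CP2Sharp.param k ε) y w) = chartForm F ε y v w :=
  (innerForm_mfderiv F ((contDiff_lift k ε).differentiable (by simp) y).hasFDerivAt.hasMFDerivAt
    (Eventually.of_forall (isLift_lift k ε)) v w).trans (homForm_lift F k ε y v w)

/-- The unit ball of a positive definite form in finite dimension is bounded. -/
theorem isVonNBounded_of_pos {E : Type*} [NormedAddCommGroup E] [NormedSpace ℝ E]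
    [FiniteDimensional ℝ E] [Nontrivial E] {B : E →L[ℝ] E →L[ℝ] ℝ}
    (hB : ∀ v, v ≠ 0 → 0 < B v v) : Bornology.IsVonNBounded ℝ {v : E | B v v < 1} := by
  have hc : Continuous (fun v ↦ B v v) := B.continuous.clm_apply continuous_id
  have := FiniteDimensional.proper ℝ E
  obtain ⟨e, he, hmin⟩ := (isCompact_sphere (0 : E) 1).exists_isMinOn
    (NormedSpace.sphere_nonempty.2 zero_le_one) hc.continuousOn
  have he0 : e ≠ 0 := by
    rintro rfl
    simp at he
  have hpos := hB e he0
  rw [NormedSpace.isVonNBounded_iff]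
  refine (Metric.isBounded_ball (x := (0 : E)) (r := 1 / B e e + 1)).subset fun v hv ↦ ?_
  have hv : B v v < 1 := hv
  rw [mem_ball_zero_iff]
  rcases eq_or_ne v 0 with rfl | hv0
  · simp only [norm_zero]
    positivity
  have hn : 0 < ‖v‖ := norm_pos_iff.2 hv0
  have h1 : B e e ≤ B (‖v‖⁻¹ • v) (‖v‖⁻¹ • v) := hmin (by simp [norm_smul, hn.ne'])
  simp only [map_smul, smul_apply, smul_eq_mul] at h1
  have h2 : B e e * ‖v‖ ^ 2 ≤ B v v := by
    calc B e e * ‖v‖ ^ 2 ≤ (‖v‖⁻¹ * (‖v‖⁻¹ * B v v)) * ‖v‖ ^ 2 := by gcongr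
      _ = B v v := by field_simp
  have h3 : ‖v‖ ^ 2 < 1 / B e e := by
    rw [lt_div_iff₀ hpos]
    linarith
  nlinarith

variable {κ : ℝ} {Q F : ℝ → ℝ}

theorem contMDiffAt_innerForm (hF : IsProfile κ Q F) (p₀ : CP2Sharp) :
    ContMDiffAt 𝓘(ℝ, ℂ × ℂ) (𝓘(ℝ, ℂ × ℂ).prod 𝓘(ℝ, ℂ × ℂ →L[ℝ] ℂ × ℂ →L[ℝ] ℝ)) ∞
      (fun p ↦ Bundle.TotalSpace.mk' (ℂ × ℂ →L[ℝ] ℂ × ℂ →L[ℝ] ℝ)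
        (E := fun p : CP2Sharp ↦ TangentSpace 𝓘(ℝ, ℂ × ℂ) p →L[ℝ]
          TangentSpace 𝓘(ℝ, ℂ × ℂ) p →L[ℝ] ℝ) p (innerForm F p)) p₀ := by
  rw [Bundle.contMDiffAt_section]
  have h1 : ContMDiffAt 𝓘(ℝ, ℂ × ℂ) 𝓘(ℝ, ℂ × ℂ →L[ℝ] ℂ × ℂ →L[ℝ] ℝ) ∞
      (chartForm F p₀.side ∘ chartAt (ℂ × ℂ) p₀) p₀ :=
    (contDiff_chartForm hF p₀.side).contDiffAt.contMDiffAt.comp p₀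
      (contMDiffAt_of_mem_maximalAtlas (IsManifold.chart_mem_maximalAtlas p₀)
        (mem_chart_source _ p₀))
  refine h1.congr_of_eventuallyEq ?_
  filter_upwards [(chartAt (ℂ × ℂ) p₀).open_source.mem_nhds (mem_chart_source _ p₀)] with p hp
  refine ContinuousLinearMap.ext fun v ↦ ContinuousLinearMap.ext fun w ↦ ?_
  have e : ∀ v : ℂ × ℂ, (trivializationAt (ℂ × ℂ) (TangentSpace 𝓘(ℝ, ℂ × ℂ)) p₀).symm p v =
      mfderiv 𝓘(ℝ, ℂ × ℂ) 𝓘(ℝ, ℂ × ℂ) (chartAt (ℂ × ℂ) p₀).symm (chartAt (ℂ × ℂ) p₀ p) v := by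
    intro v
    have h2 := DFunLike.congr_fun
      (TangentBundle.symmL_trivializationAt (I := 𝓘(ℝ, ℂ × ℂ)) hp) v
    rw [Bundle.Trivialization.symmL_apply _ (by simpa using hp)] at h2
    rw [h2]
    simp [mfderivWithin_univ]
    rfl
  rw [hom_trivializationAt_apply, inCoordinates_apply_eq₂ (by simpa using hp) (by simpa using hp)
    (by simp)]
  simp only [e]
  have hpp : (chartAt (ℂ × ℂ) p₀).symm (chartAt (ℂ × ℂ) p₀ p) = p :=
    (chartAt (ℂ × ℂ) p₀).left_inv hp
  have h3 := innerForm_param F p₀.idx p₀.side (chartAt (ℂ × ℂ) p₀ p) v w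
  rw [← chartAt_symm_eq, hpp] at h3
  refine Eq.trans ?_ h3
  simp
  rfl

/-- The metric on `ℂP² # -ℂP²` determined by a profile. -/
def metric (hF : IsProfile κ Q F) : RiemCoord.Metric (ℂ × ℂ) CP2Sharp where
  inner := innerForm F
  symm p v w := chartForm_symm p.side _ v w
  pos p v hv := chartForm_pos hF p.side _ v hv
  isVonNBounded p := isVonNBounded_of_pos
    (chartForm_pos hF p.side (CP2Sharp.coord p.idx p.side p))
  contMDiff := contMDiffAt_innerForm hF

theorem chartMetric_metric (hF : IsProfile κ Q F) (p : CP2Sharp) :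
    RiemCoord.chartMetric (metric hF) p = chartForm F p.side := by
  funext y
  refine ContinuousLinearMap.ext fun v ↦ ContinuousLinearMap.ext fun w ↦ ?_
  exact innerForm_param F p.idx p.side y v w

/-- The coordinate `|b v|² / (|a|² + |b v|²)` on the orbit space, as a function on
`ℂP² # -ℂP²`. -/
def orbitCoord (p : CP2Sharp) : ℝ := theta p.side (CP2Sharp.coord p.idx p.side p)

theorem IsLift.orbitCoord_eq {P : HC} {p : CP2Sharp} (h : IsLift P p) :
    orbitCoord p = homTheta P := by
  rw [orbitCoord, h.coord_eq, theta_homCoord ((h.mem_dom_iff _ _).1 p.mem_dom)]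

theorem orbitCoord_param (k : Fin 2) (ε : Bool) (y : ℂ × ℂ) :
    orbitCoord (CP2Sharp.param k ε y) = theta ε y := by
  rw [(isLift_lift k ε y).orbitCoord_eq, ← theta_homCoord (homDom_lift k ε y), homCoord_lift]

theorem orbitCoord_act (A : Matrix.unitaryGroup (Fin 2) ℂ) (p : CP2Sharp) :
    orbitCoord (CP2Sharp.act A p) = orbitCoord p := by
  have h := isLift_coord p.mem_dom
  rw [(h.act A).orbitCoord_eq, h.orbitCoord_eq, homTheta, homTheta, homSq, homSq]
  simp only [homAct, sqNorm_mulVec]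

theorem contMDiff_potential (hF : IsProfile κ Q F) :
    ContMDiff 𝓘(ℝ, ℂ × ℂ) 𝓘(ℝ, ℝ) ∞ (fun p : CP2Sharp ↦ κ * F (orbitCoord p)) := by
  intro p
  have h1 : ContMDiffAt 𝓘(ℝ, ℂ × ℂ) 𝓘(ℝ, ℝ) ∞ (solPot κ F p.side ∘ chartAt (ℂ × ℂ) p) p :=
    (contDiff_solPot hF p.side).contDiffAt.contMDiffAt.comp p
      (contMDiffAt_of_mem_maximalAtlas (IsManifold.chart_mem_maximalAtlas p)
        (mem_chart_source _ p))
  refine h1.congr_of_eventuallyEq ?_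
  filter_upwards [(chartAt (ℂ × ℂ) p).open_source.mem_nhds (mem_chart_source _ p)] with p' hp'
  rw [← (chartAt (ℂ × ℂ) p).left_inv hp', chartAt_symm_eq, orbitCoord_param]
  rw [← chartAt_symm_eq, Function.comp_apply, (chartAt (ℂ × ℂ) p).left_inv hp']
  rfl

theorem isGradientShrinkingSoliton_metric (hF : IsProfile κ Q F) :
    IsGradientShrinkingSoliton (metric hF) := by
  refine ⟨fun p ↦ κ * F (orbitCoord p), contMDiff_potential hF, fun A p ↦ ?_, fun p v w ↦ ?_⟩
  · simp only [orbitCoord_act]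
  · have hu : (fun p ↦ κ * F (orbitCoord p)) ∘ (chartAt (ℂ × ℂ) p).symm = solPot κ F p.side := by
      funext y
      simp only [Function.comp_apply, chartAt_symm_eq, orbitCoord_param]
      rfl
    rw [RiemCoord.ric, RiemCoord.hess, chartMetric_metric, hu]
    exact sub_eq_zero.2 (ricci_add_hessian hF p.side _ v w)

theorem isKahler_metric (hF : IsProfile κ Q F) : RiemCoord.IsKahler (metric hF) := by
  refine ⟨fun p v w ↦ chartForm_mulI p.side _ v w, fun p v w ↦ ?_⟩
  rw [chartMetric_metric]
  exact christoffel_chartForm_mulI hF p.side _ v w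

/-- The action on homogeneous coordinates as a linear map. -/
def homActL (A : Matrix (Fin 2) (Fin 2) ℂ) : HC →L[ℝ] HC :=
  LinearMap.toContinuousLinearMap
    { toFun := homAct A
      map_add' := fun P P' ↦ by simp [homAct, Matrix.mulVec_add]
      map_smul' := fun c P ↦ by simp [homAct, Matrix.mulVec_smul] }

theorem isInvariant_metric (hF : IsProfile κ Q F) : IsInvariant (metric hF) := by
  intro A p v w
  have hl : HasMFDerivAt 𝓘(ℝ, ℂ × ℂ) 𝓘(ℝ, HC) (lift p.idx p.side ∘ chartAt (ℂ × ℂ) p) p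
      (fderiv ℝ (lift p.idx p.side) (chartAt (ℂ × ℂ) p p)) :=
    ((contDiff_lift p.idx p.side).differentiable (by simp) _).hasFDerivAt.hasMFDerivAt.comp p
      (hasMFDerivAt_chartAt p)
  have hA : HasMFDerivAt 𝓘(ℝ, ℂ × ℂ) 𝓘(ℝ, HC)
      (homActL (A : Matrix (Fin 2) (Fin 2) ℂ) ∘ lift p.idx p.side ∘ chartAt (ℂ × ℂ) p) p
      ((homActL (A : Matrix (Fin 2) (Fin 2) ℂ)).comp
        (fderiv ℝ (lift p.idx p.side) (chartAt (ℂ × ℂ) p p))) :=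
    (homActL (A : Matrix (Fin 2) (Fin 2) ℂ)).hasFDerivAt.hasMFDerivAt.comp p hl
  have hlift : ∀ᶠ p' in 𝓝 p, IsLift ((homActL (A : Matrix (Fin 2) (Fin 2) ℂ) ∘
      lift p.idx p.side ∘ chartAt (ℂ × ℂ) p) p') (CP2Sharp.act A p') := by
    filter_upwards [(chartAt (ℂ × ℂ) p).open_source.mem_nhds (mem_chart_source _ p)] with p' hp'
    exact (isLift_coord hp').act A
  refine (innerForm_mfderiv F hA hlift v w).trans ?_
  refine (homForm_homAct F A _ _ _).trans ?_
  exact homForm_lift F p.idx p.side _ v w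

end

end KoisoCao

/-! ### The identification of `S³ × (α, β)` with the regular part -/

namespace KoisoCao

noncomputable section

open Filter Topology ComplexConjugate

theorem IsLift.unique {P : HC} {p p' : CP2Sharp} (h : IsLift P p) (h' : IsLift P p') : p = p' := by
  obtain ⟨_, _, rfl⟩ := h
  obtain ⟨_, _, rfl⟩ := h'
  rfl

theorem ofLp_ne_zero (s : S3) : (s : C2).ofLp ≠ 0 := by
  intro h
  have h1 : ‖(s : C2)‖ = 1 := by simp
  rw [(WithLp.ofLp_eq_zero 2).1 h, norm_zero] at h1
  exact zero_ne_one h1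

theorem sqNorm_eq_norm_sq (z : C2) : sqNorm z.ofLp = ‖z‖ ^ 2 := by
  rw [EuclideanSpace.norm_sq_eq, Fin.sum_univ_two, sqNorm, Complex.normSq_eq_norm_sq,
    Complex.normSq_eq_norm_sq]

theorem sqNorm_sphere (s : S3) : sqNorm (s : C2).ofLp = 1 := by
  rw [sqNorm_eq_norm_sq]
  simp

/-- Homogeneous coordinates `(1, ρ(t), s)` of the point `ρ(t) s` of `ℂ² \ 0`. -/
def sphereLift (ρ : ℝ → ℝ) (q : S3 × ℝ) : HC := (1, (ρ q.2 : ℂ), (q.1 : C2).ofLp)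

/-- The map `(s, t) ↦ ρ(t) s` to `ℂ² \ 0`, which is the complement of the exceptional curve and
the line at infinity. -/
def sphereMap (ρ : ℝ → ℝ) (q : S3 × ℝ) : CP2Sharp :=
  CP2Sharp.mk 1 (ρ q.2) (q.1 : C2).ofLp (by simp) (ofLp_ne_zero q.1)

theorem isLift_sphereMap (ρ : ℝ → ℝ) (q : S3 × ℝ) : IsLift (sphereLift ρ q) (sphereMap ρ q) :=
  ⟨by simp [sphereLift], ofLp_ne_zero q.1, rfl⟩

theorem sphereMap_equivariant (ρ : ℝ → ℝ) (A : Matrix.unitaryGroup (Fin 2) ℂ) (s s' : S3) (t : ℝ)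
    (h : (s' : C2).ofLp = (A : Matrix (Fin 2) (Fin 2) ℂ) *ᵥ (s : C2).ofLp) :
    sphereMap ρ (s', t) = CP2Sharp.act A (sphereMap ρ (s, t)) := by
  have h1 := isLift_sphereMap ρ (s', t)
  have h2 := (isLift_sphereMap ρ (s, t)).act A
  have h3 : homAct (A : Matrix (Fin 2) (Fin 2) ℂ) (sphereLift ρ (s, t)) =
      sphereLift ρ (s', t) := by
    simp only [homAct, sphereLift, h]
  rw [h3] at h2
  exact h1.unique h2

theorem bijOn_sphereMap {ρ : ℝ → ℝ} {α β : ℝ} (hρ : BijOn ρ (Ioo α β) (Ioi 0)) :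
    BijOn (sphereMap ρ) (univ ×ˢ Ioo α β)
      (CP2Sharp.exceptionalCurve ∪ CP2Sharp.lineAtInfinity)ᶜ := by
  refine ⟨?_, ?_, ?_⟩
  · rintro ⟨s, t⟩ ⟨-, ht⟩
    have hpos : 0 < ρ t := hρ.mapsTo ht
    obtain ⟨c, hc, h1⟩ := CP2Sharp.mk_line_rep (a := 1) (b := ρ t) (v := (s : C2).ofLp) (by simp)
      (ofLp_ne_zero s)
    have h1' : (sphereMap ρ (s, t)).line.rep = _ := h1
    rintro (h | h)
    · have h : (sphereMap ρ (s, t)).line.rep.2 = 0 := h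
      rw [h1', smul_eq_zero] at h
      rcases h with h | h
      · simp [hc, hpos.ne'] at h
      · exact ofLp_ne_zero s h
    · have h : (sphereMap ρ (s, t)).line.rep.1 = 0 := h
      rw [h1'] at h
      simp [hc] at h
  · rintro ⟨s, t⟩ ⟨-, ht⟩ ⟨s', t'⟩ ⟨-, ht'⟩ h
    have hpos : 0 < ρ t := hρ.mapsTo ht
    have hpos' : 0 < ρ t' := hρ.mapsTo ht'
    have h1 : (sphereMap ρ (s, t)).line = (sphereMap ρ (s', t')).line := by rw [h]
    obtain ⟨c, hc⟩ := (Projectivization.mk_eq_mk_iff' ℂ _ _ _ _).1 h1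
    rw [Prod.smul_mk, Prod.mk.injEq] at hc
    obtain ⟨hc1, hc2⟩ := hc
    have hc1 : c = 1 := by simpa using hc1
    rw [hc1, one_smul] at hc2
    have h2 : ((ρ t' : ℂ) • (s' : C2)) = (ρ t : ℂ) • (s : C2) := by
      ext i
      exact congrFun hc2 i
    have h3 := congrArg norm h2
    rw [norm_smul, norm_smul] at h3
    simp only [Complex.norm_real, Real.norm_eq_abs, abs_of_pos hpos, abs_of_pos hpos',
      norm_eq_of_mem_sphere, mul_one] at h3
    have h4 : t = t' := hρ.injOn ht ht' h3.symm
    subst h4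
    have h5 : (s' : C2) = s :=
      smul_right_injective C2 (show (ρ t : ℂ) ≠ 0 by exact_mod_cast hpos.ne') h2
    rw [Subtype.ext h5]
  · intro p hp
    have hp2 : p.line.rep.2 ≠ 0 := fun h ↦ hp (Or.inl h)
    have hp1 : p.line.rep.1 ≠ 0 := fun h ↦ hp (Or.inr h)
    let z : C2 := WithLp.toLp 2 ((p.line.rep.1)⁻¹ • p.line.rep.2)
    have hz : z ≠ 0 := by
      intro h
      have h' := (WithLp.toLp_eq_zero 2).1 h
      exact (smul_ne_zero (inv_ne_zero hp1) hp2) h'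
    have hr : 0 < ‖z‖ := norm_pos_iff.2 hz
    obtain ⟨t, ht, htz⟩ := hρ.surjOn (show ‖z‖ ∈ Ioi (0 : ℝ) from hr)
    let s : S3 := ⟨((‖z‖⁻¹ : ℝ) : ℂ) • z, by
      rw [mem_sphere_zero_iff_norm, norm_smul, Complex.norm_real, norm_inv, norm_norm,
        inv_mul_cancel₀ hr.ne']⟩
    have hrc : ((‖z‖ : ℝ) : ℂ) ≠ 0 := by exact_mod_cast hr.ne'
    have hs : p.line.rep.2 = (p.line.rep.1 * (‖z‖ : ℂ)) • (s : C2).ofLp := by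
      funext i
      have hzi : z.ofLp i = (p.line.rep.1)⁻¹ * p.line.rep.2 i := rfl
      have hsi : (s : C2).ofLp i = ((‖z‖⁻¹ : ℝ) : ℂ) * z.ofLp i := rfl
      rw [Pi.smul_apply, smul_eq_mul, hsi, hzi, Complex.ofReal_inv]
      generalize (‖z‖ : ℂ) = r at hrc
      field_simp
    refine ⟨(s, t), ⟨trivial, ht⟩, ?_⟩
    obtain ⟨b, hb⟩ := p.exists_rep
    have hb0 : b ≠ 0 := by
      rintro rfl
      exact hp2 (by simpa using hb)
    symm
    refine CP2Sharp.eq_mk p (c := p.line.rep.1) (d := b⁻¹ * (p.line.rep.1 * (‖z‖ : ℂ))) _ _ ?_ ?_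
    · refine Prod.ext (by simp) ?_
      rw [Prod.smul_snd, htz, smul_smul]
      exact hs
    · rw [mul_smul, ← hs, hb, smul_smul, inv_mul_cancel₀ hb0, one_smul]

/-! ### The derivative of the identification -/

section Derivative

variable (q : S3 × ℝ)

/-- The component `dt` of a tangent vector. -/
abbrev dTime : T q →L[ℝ] ℝ :=
  mfderiv ((𝓡 3).prod 𝓘(ℝ, ℝ)) 𝓘(ℝ, ℝ) (fun q : S3 × ℝ ↦ q.2) q

/-- The component of a tangent vector along `S³ ⊆ ℂ²`. -/
abbrev dSphere : T q →L[ℝ] C2 :=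
  mfderiv ((𝓡 3).prod 𝓘(ℝ, ℝ)) 𝓘(ℝ, C2) (fun q : S3 × ℝ ↦ (q.1 : C2)) q

theorem hasMFDerivAt_dTime :
    HasMFDerivAt ((𝓡 3).prod 𝓘(ℝ, ℝ)) 𝓘(ℝ, ℝ) (fun q : S3 × ℝ ↦ q.2) q (dTime q) :=
  mdifferentiableAt_snd.hasMFDerivAt

theorem contMDiff_coe :
    ContMDiff ((𝓡 3).prod 𝓘(ℝ, ℝ)) 𝓘(ℝ, C2) ∞ (fun q : S3 × ℝ ↦ (q.1 : C2)) :=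
  (contMDiff_coe_sphere (n := 3)).comp contMDiff_fst

theorem hasMFDerivAt_dSphere :
    HasMFDerivAt ((𝓡 3).prod 𝓘(ℝ, ℝ)) 𝓘(ℝ, C2) (fun q : S3 × ℝ ↦ (q.1 : C2)) q (dSphere q) :=
  ((contMDiff_coe q).mdifferentiableAt (by simp)).hasMFDerivAt

/-- Tangent vectors of `S³` are orthogonal to the position vector. -/
theorem inner_dSphere (ξ : T q) : inner ℝ (q.1 : C2) (dSphere q ξ) = 0 := by
  have h1 := (hasStrictFDerivAt_norm_sq (F := C2) (q.1 : C2)).hasFDerivAt.hasMFDerivAt.comp q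
    (hasMFDerivAt_dSphere q)
  have h2 : ((fun x : C2 ↦ ‖x‖ ^ 2) ∘ fun q : S3 × ℝ ↦ (q.1 : C2)) = fun _ ↦ (1 : ℝ) := by
    funext q
    simp
  rw [h2] at h1
  have h3 := hasMFDerivAt_unique h1 (hasMFDerivAt_const (1 : ℝ) q)
  have h4 := DFunLike.congr_fun h3 ξ
  have h5 : 2 * inner ℝ (q.1 : C2) (dSphere q ξ) = 0 := by
    refine Eq.trans ?_ h4
    simp [two_smul, two_mul]
    rfl
  linarith

/-- The linear map `(τ, a) ↦ (0, d τ, a)`. -/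
def tangentLift (d : ℝ) : T q →L[ℝ] HC :=
  ContinuousLinearMap.prod 0 (ContinuousLinearMap.prod
    (Complex.ofRealCLM.comp (d • dTime q))
    (((PiLp.continuousLinearEquiv 2 ℝ (fun _ : Fin 2 ↦ ℂ) : C2 →L[ℝ] Fin 2 → ℂ)).comp
      (dSphere q)))

variable {q}

theorem tangentLift_apply (d : ℝ) (ξ : T q) :
    tangentLift q d ξ = ((0 : ℂ), ((d * dTime q ξ : ℝ) : ℂ), (dSphere q ξ).ofLp) := rfl

theorem hasMFDerivAt_sphereLift {ρ : ℝ → ℝ} {d : ℝ} (hρ : HasDerivAt ρ d q.2) :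
    HasMFDerivAt ((𝓡 3).prod 𝓘(ℝ, ℝ)) 𝓘(ℝ, HC) (sphereLift ρ) q (tangentLift q d) := by
  have h1 : HasMFDerivAt ((𝓡 3).prod 𝓘(ℝ, ℝ)) 𝓘(ℝ, ℂ) (fun q : S3 × ℝ ↦ (ρ q.2 : ℂ)) q
      (Complex.ofRealCLM.comp (d • dTime q)) := by
    refine (Complex.ofRealCLM.hasFDerivAt.hasMFDerivAt.comp q
      (hρ.hasFDerivAt.hasMFDerivAt.comp q (hasMFDerivAt_dTime q))).congr_mfderiv ?_
    ext ξ
    exact congrArg Complex.ofReal (mul_comm (dTime q ξ) d)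
  have h2 : HasMFDerivAt ((𝓡 3).prod 𝓘(ℝ, ℝ)) 𝓘(ℝ, Fin 2 → ℂ)
      (fun q : S3 × ℝ ↦ (q.1 : C2).ofLp) q
      (((PiLp.continuousLinearEquiv 2 ℝ (fun _ : Fin 2 ↦ ℂ) : C2 →L[ℝ] Fin 2 → ℂ)).comp
        (dSphere q)) :=
    (PiLp.continuousLinearEquiv 2 ℝ (fun _ : Fin 2 ↦ ℂ) :
      C2 →L[ℝ] Fin 2 → ℂ).hasFDerivAt.hasMFDerivAt.comp q (hasMFDerivAt_dSphere q)
  have h0 : HasMFDerivAt ((𝓡 3).prod 𝓘(ℝ, ℝ)) 𝓘(ℝ, ℂ) (fun _ : S3 × ℝ ↦ (1 : ℂ)) q 0 :=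
    hasMFDerivAt_const (1 : ℂ) q
  exact ⟨h0.1.prodMk (h1.1.prodMk h2.1), h0.2.prodMk (h1.2.prodMk h2.2)⟩

theorem contMDiffAt_sphereLift {ρ : ℝ → ℝ} (hρ : ContDiffAt ℝ ∞ ρ q.2) :
    ContMDiffAt ((𝓡 3).prod 𝓘(ℝ, ℝ)) 𝓘(ℝ, HC) ∞ (sphereLift ρ) q := by
  have h1 : ContMDiffAt ((𝓡 3).prod 𝓘(ℝ, ℝ)) 𝓘(ℝ, ℂ) ∞ (fun q : S3 × ℝ ↦ (ρ q.2 : ℂ)) q :=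
    (Complex.ofRealCLM.contDiff.contDiffAt.comp q.2 hρ).contMDiffAt.comp q contMDiffAt_snd
  have h2 : ContMDiffAt ((𝓡 3).prod 𝓘(ℝ, ℝ)) 𝓘(ℝ, Fin 2 → ℂ) ∞
      (fun q : S3 × ℝ ↦ (q.1 : C2).ofLp) q :=
    (PiLp.continuousLinearEquiv 2 ℝ (fun _ : Fin 2 ↦ ℂ) :
      C2 →L[ℝ] Fin 2 → ℂ).contDiff.contMDiff.contMDiffAt.comp q (contMDiff_coe q)
  exact contMDiffAt_const.prodMk_space (h1.prodMk_space h2)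

/-! ### The frame `X`, `Y`, `Z` -/

theorem herm_dSphere (ξ : T q) : herm (dSphere q ξ).ofLp (q.1 : C2).ofLp =
    -Complex.I * (inner ℝ (X q.1) (dSphere q ξ) : ℝ) := by
  have h := inner_dSphere q ξ
  generalize dSphere q ξ = a at h ⊢
  rw [PiLp.inner_apply, Fin.sum_univ_two] at h ⊢
  simp only [Complex.inner, X] at h ⊢
  simp at h
  apply Complex.ext
  · simp [herm]
    linarith
  · simp [herm]
    ring

theorem area_eq_inner (s a : C2) : area s.ofLp a.ofLp =
    -((inner ℝ (Y s) a : ℝ) : ℂ) - Complex.I * (inner ℝ (Z s) a : ℝ) := by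
  rw [PiLp.inner_apply, Fin.sum_univ_two, PiLp.inner_apply, Fin.sum_univ_two]
  simp only [Complex.inner, Y, Z]
  apply Complex.ext
  · simp [area]
    ring
  · simp [area]
    ring

end Derivative

end

end KoisoCao

/-! ### The extension of the metric on `S³ × (α, β)` -/

namespace KoisoCao

noncomputable section

open Filter Topology ComplexConjugate

variable {q : S3 × ℝ}

theorem coframe_eq (f h : ℝ → ℝ) (ξ : T q) : coframe f h q ξ =
    ![dTime q ξ, f q.2 * inner ℝ (X q.1) (dSphere q ξ), h q.2 * inner ℝ (Y q.1) (dSphere q ξ),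
      h q.2 * inner ℝ (Z q.1) (dSphere q ξ)] := rfl

theorem homConn_tangentLift (ρ : ℝ → ℝ) (d : ℝ) (ξ : T q) :
    homConn (sphereLift ρ q) (tangentLift q d ξ) =
      ((d * dTime q ξ : ℝ) : ℂ) - Complex.I *
        ((ρ q.2 * inner ℝ (X q.1) (dSphere q ξ) : ℝ) : ℂ) := by
  have h1 := herm_dSphere ξ
  simp only [homConn, sphereLift, tangentLift_apply, sqNorm_sphere]
  rw [h1]
  push_cast
  ring

/-- The map `(s, t) ↦ ρ(t) s` pulls the metric with profile `F` back to `dt² + g_t`. -/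
theorem homForm_tangentLift {κ : ℝ} {Q F f h ρ : ℝ → ℝ} (hF : IsProfile κ Q F)
    (hρ : 0 < ρ q.2) (hf : 0 < f q.2)
    (hFh : F (ρ q.2 ^ 2 / (1 + ρ q.2 ^ 2)) = h q.2 ^ 2) (hQ : Q (h q.2 ^ 2) = f q.2 ^ 2)
    (ξ η : T q) :
    homForm F (sphereLift ρ q) (tangentLift q (-ρ q.2 / f q.2) ξ)
      (tangentLift q (-ρ q.2 / f q.2) η) = invMetric f h q ξ η := by
  have hS : homSq (sphereLift ρ q) = 1 + ρ q.2 ^ 2 := by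
    simp [homSq, sphereLift, sqNorm_sphere, Complex.normSq_ofReal, sq]
  have hθ : homTheta (sphereLift ρ q) = ρ q.2 ^ 2 / (1 + ρ q.2 ^ 2) := by
    rw [homTheta, hS]
    simp [sphereLift, sqNorm_sphere, Complex.normSq_ofReal, sq]
  have hθ0 : ρ q.2 ^ 2 / (1 + ρ q.2 ^ 2) ∈ Icc (0 : ℝ) 1 :=
    ⟨by positivity, (div_le_one (by positivity)).2 (by linarith)⟩
  have he := hF.euler _ hθ0
  rw [hFh, hQ] at he
  have hD : deriv F (ρ q.2 ^ 2 / (1 + ρ q.2 ^ 2)) =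
      f q.2 ^ 2 * (1 + ρ q.2 ^ 2) ^ 2 / ρ q.2 ^ 2 := by
    have : (1 + ρ q.2 ^ 2) ≠ 0 := by positivity
    rw [← he]
    field_simp
    ring
  rw [homForm, homConn_tangentLift, homConn_tangentLift, hθ, hS, hFh, hD]
  simp only [sphereLift, tangentLift_apply, sqNorm_sphere, area_eq_inner, invMetric, coframe_eq,
    Fin.sum_univ_four]
  have : (1 + ρ q.2 ^ 2) ≠ 0 := by positivity
  simp
  field_simp
  ring

/-- The frame `s`, `(-s̄₁, s̄₀)` of `ℂ²` is unitary. -/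
theorem eq_herm_add_area (s : S3) (a : Fin 2 → ℂ) : a =
    herm a (s : C2).ofLp • (s : C2).ofLp +
      area (s : C2).ofLp a • ![-conj ((s : C2) 1), conj ((s : C2) 0)] := by
  have h : (s : C2) 0 * conj ((s : C2) 0) + (s : C2) 1 * conj ((s : C2) 1) = 1 := by
    have h1 := sqNorm_eq_herm (s : C2).ofLp
    rw [sqNorm_sphere] at h1
    simpa [herm] using h1.symm
  funext i
  fin_cases i
  · simp [herm, area]
    linear_combination (-a 0) * h
  · simp [herm, area]
    linear_combination (-a 1) * h

/-- The vectors `(0, -μ b, μ v)` are tangent to the fibers of the projection from homogeneous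
coordinates. -/
theorem dHomCoord_add_vertical (k : Fin 2) (ε : Bool) {P : HC} (V : HC) (μ : ℂ) :
    dHomCoord k ε P (Complex.I • V + ((0 : ℂ), -μ * P.2.1, μ • P.2.2)) =
      Complex.I • dHomCoord k ε P V := by
  cases ε
  · simp only [dHomCoord, Bool.false_eq_true, if_false, Prod.fst_add, Prod.snd_add, Prod.smul_fst,
      Prod.smul_snd, Pi.add_apply, Pi.smul_apply, smul_eq_mul, Prod.smul_mk]
    congr 1 <;> ring
  · simp only [dHomCoord, if_true, Prod.fst_add, Prod.snd_add, Prod.smul_fst,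
      Prod.smul_snd, Pi.add_apply, Pi.smul_apply, smul_eq_mul, Prod.smul_mk]
    congr 1 <;> ring

/-- The identification of `S³ × (α, β)` with `ℂ² \ 0` is holomorphic: in homogeneous coordinates
the images of `J ξ` and `ξ` differ by the factor `i`, up to a vertical vector. -/
theorem tangentLift_of_isJ {f h ρ : ℝ → ℝ} (hf : 0 < f q.2) (hh : 0 < h q.2) {ξ η : T q}
    (hJ : IsJ f h q ξ η) :
    ∃ μ : ℂ, tangentLift q (-ρ q.2 / f q.2) η = Complex.I • tangentLift q (-ρ q.2 / f q.2) ξ +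
      ((0 : ℂ), -μ * (sphereLift ρ q).2.1, μ • (sphereLift ρ q).2.2) := by
  rw [IsJ, coframe_eq, coframe_eq] at hJ
  have j0 : dTime q η = -(f q.2 * inner ℝ (X q.1) (dSphere q ξ)) := congrFun hJ 0
  have j1 : f q.2 * inner ℝ (X q.1) (dSphere q η) = dTime q ξ := congrFun hJ 1
  have j2 : h q.2 * inner ℝ (Y q.1) (dSphere q η) = -(h q.2 * inner ℝ (Z q.1) (dSphere q ξ)) :=
    congrFun hJ 2
  have j3 : h q.2 * inner ℝ (Z q.1) (dSphere q η) = h q.2 * inner ℝ (Y q.1) (dSphere q ξ) :=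
    congrFun hJ 3
  rw [← mul_neg] at j2
  have j2 := mul_left_cancel₀ hh.ne' j2
  have j3 := mul_left_cancel₀ hh.ne' j3
  have j1 : inner ℝ (X q.1) (dSphere q η) = dTime q ξ / f q.2 := by
    rw [← j1]
    field_simp
  have hfc : (f q.2 : ℂ) ≠ 0 := by exact_mod_cast hf.ne'
  have hA : area (q.1 : C2).ofLp (dSphere q η).ofLp =
      Complex.I * area (q.1 : C2).ofLp (dSphere q ξ).ofLp := by
    rw [area_eq_inner, area_eq_inner, j2, j3]
    push_cast
    linear_combination ((inner ℝ (Z q.1) (dSphere q ξ) : ℝ) : ℂ) * Complex.I_mul_I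
  refine ⟨-((inner ℝ (X q.1) (dSphere q ξ) : ℝ) +
    Complex.I * (dTime q ξ : ℝ) / (f q.2 : ℝ)), ?_⟩
  rw [tangentLift_apply, tangentLift_apply]
  refine Prod.ext (by simp) (Prod.ext ?_ ?_)
  · simp only [Prod.snd_add, Prod.fst_add, Prod.smul_mk, sphereLift, smul_eq_mul, j0]
    push_cast
    field_simp
    ring
  · rw [eq_herm_add_area q.1 (dSphere q η).ofLp, hA, herm_dSphere, j1]
    simp only [Prod.snd_add, Prod.smul_mk, sphereLift]
    conv_rhs => rw [eq_herm_add_area q.1 (dSphere q ξ).ofLp, herm_dSphere]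
    funext i
    simp only [Pi.add_apply, Pi.smul_apply, smul_eq_mul]
    push_cast
    linear_combination (((inner ℝ (X q.1) (dSphere q ξ) : ℝ) : ℂ) * (q.1 : C2) i) * Complex.I_mul_I

/-- The metric with profile `F` extends `dt² + g_t`, if the radius `ρ` satisfies `ρ' = -ρ / f`
and `F` is the function `h²` in terms of the coordinate `ρ² / (1 + ρ²)`. -/
theorem extends_metric {κ α β : ℝ} {Q F f h ρ : ℝ → ℝ} (hF : IsProfile κ Q F)
    (hf : ∀ t ∈ Ioo α β, 0 < f t) (hh : ∀ t ∈ Ioo α β, 0 < h t)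
    (hρ : ContDiffOn ℝ ∞ ρ (Ioo α β)) (hbij : BijOn ρ (Ioo α β) (Ioi 0))
    (hρ' : ∀ t ∈ Ioo α β, HasDerivAt ρ (-ρ t / f t) t ∧
      F (ρ t ^ 2 / (1 + ρ t ^ 2)) = h t ^ 2 ∧ Q (h t ^ 2) = f t ^ 2) :
    Extends α β f h (metric hF) := by
  refine ⟨sphereMap ρ, ?_, bijOn_sphereMap hbij,
    fun A s s' t _ hs ↦ sphereMap_equivariant ρ A s s' t hs, ?_⟩
  · rintro ⟨s, t⟩ ⟨-, ht⟩
    exact (contMDiffAt_of_isLift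
      (contMDiffAt_sphereLift (q := (s, t)) (hρ.contDiffAt (isOpen_Ioo.mem_nhds ht)))
      (Eventually.of_forall (isLift_sphereMap ρ))).contMDiffWithinAt
  · intro s t ht ξ η
    obtain ⟨h1, h2, h3⟩ := hρ' t ht
    have hd := hasMFDerivAt_sphereLift (q := (s, t)) h1
    have hl : ∀ᶠ q in 𝓝 ((s, t) : S3 × ℝ), IsLift (sphereLift ρ q) (sphereMap ρ q) :=
      Eventually.of_forall (isLift_sphereMap ρ)
    refine ⟨?_, fun hJ ↦ ?_⟩
    · refine (innerForm_mfderiv F hd hl ξ η).trans ?_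
      exact homForm_tangentLift (q := (s, t)) hF (hbij.mapsTo ht) (hf t ht) h2 h3 ξ η
    · have hdom := (hl.self_of_nhds.mem_dom_iff _ _).1 (sphereMap ρ (s, t)).mem_dom
      obtain ⟨μ, hμ⟩ := tangentLift_of_isJ (q := (s, t)) (ρ := ρ) (hf t ht) (hh t ht) hJ
      have e : ∀ ζ : T (s, t), mfderiv ((𝓡 3).prod 𝓘(ℝ, ℝ)) 𝓘(ℝ, ℂ × ℂ) (sphereMap ρ) (s, t) ζ =
          dHomCoord (sphereMap ρ (s, t)).idx (sphereMap ρ (s, t)).side (sphereLift ρ (s, t))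
            (tangentLift (s, t) (-ρ t / f t) ζ) := by
        intro ζ
        rw [(hasMFDerivAt_of_isLift hd hl).mfderiv]
        exact fderiv_homCoord hdom _
      rw [e η, e ξ]
      refine (congrArg _ hμ).trans ?_
      exact dHomCoord_add_vertical _ _ _ μ

end

end KoisoCao

theorem proposition2p1 (α β c : ℝ) (hαβ : α < β) (h : ℝ → ℝ)
    (h_smooth : ContDiffOn ℝ ∞ h (Icc α β))
    (h_pos : ∀ t ∈ Icc α β, 0 < h t)
    (f_pos : ∀ t ∈ Ioo α β, 0 < KoisoCao.fiber α β h t)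
    (h_ode : ∀ t ∈ Icc α β,
      2 * h t * KoisoCao.der α β (KoisoCao.der α β h) t + 4 * KoisoCao.der α β h t ^ 2 - 4
        + h t ^ 2 * (1 + c * KoisoCao.der α β h t ^ 2) = 0)
    (hα : KoisoCao.der α β h α = 0) (hβ : KoisoCao.der α β h β = 0)
    (hα2 : h α * KoisoCao.der α β (KoisoCao.der α β h) α = -1)
    (hβ2 : -(h β * KoisoCao.der α β (KoisoCao.der α β h) β) = -1) :
    (h α = Real.sqrt 6 ∧ h β = Real.sqrt 2) ∧
    ∃ g : RiemCoord.Metric (ℂ × ℂ) CP2Sharp,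
      KoisoCao.Extends α β (KoisoCao.fiber α β h) h g ∧
      KoisoCao.IsInvariant g ∧
      RiemCoord.IsKahler g ∧
      KoisoCao.IsGradientShrinkingSoliton g := by
  have H : KoisoCao.IsSolution α β c h :=
    ⟨hαβ, h_smooth, h_pos, f_pos, h_ode, hα, hβ, hα2, hβ2⟩
  obtain ⟨Q, F, ρ, hF, hρ, hbij, hρ'⟩ := H.exists_radius
  exact ⟨⟨H.eq_left, H.eq_right⟩, KoisoCao.metric hF,
    KoisoCao.extends_metric hF f_pos (fun t ht ↦ h_pos t (Ioo_subset_Icc_self ht)) hρ hbij hρ',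
    KoisoCao.isInvariant_metric hF, KoisoCao.isKahler_metric hF,
    KoisoCao.isGradientShrinkingSoliton_metric hF⟩
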